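/- Consider $N$ spins, labelled by $\Lambda=\{1,\dots,N\}$, each with a $d$-dimensional Hilbert space. Let $k\ge 1$ be an integer, $J>0$, $T>0$, and let $$H(t)=H_0+V(t),\qquad H_0=\sum_{|X|\le k}h_X,\qquad V(t)=\sum_{|X|\le k}v_X(t)=V(t+T),$$ where $X$ runs over subsets of $\Lambda$, the operators $h_X$ and $v_X(t)$ act on the spins in $X$ only, $H_0$ and $V(t)$ are self-adjoint, and each $v_X$ is integrable over $[0,T]$. Assume that, with $\|\cdot\|$ the operator norm, $$\sum_{X\ni i,\ |X|\le k}\bigl(\|h_X\|+\|v_X(t)\|\bigr)\le J\qquad\text{for all } i\in\Lambda \text{ and all } t .$$ Put $$\lambda=2kJ,\qquad V_0=\sum_{|X|\le k}\frac1T\int_0^T\|v_X(t)\|\,dt,\qquad n_0=\Bigl\lfloor\frac{1}{16\lambda T}\Bigr\rfloor ,$$ and assume $T\le 1/(4\lambda)$. For $n\ge 0$ let $$\Omega_n=\frac{1}{(n+1)^2}\sum_{\sigma\in S_{n+1}}(-1)^{n-\theta(\sigma)}\frac{\theta(\sigma)!\,(n-\theta(\sigma))!}{n!}\,\frac{1}{i^nT^{n+1}}\int_{0\le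 t_1\le\cdots\le t_{n+1}\le T}\bigl[H(t_{\sigma(n+1)}),[H(t_{\sigma(n)}),\dots,[H(t_{\sigma(2)}),H(t_{\sigma(1)})]\dots]\bigr]\,dt_1\cdots dt_{n+1},$$ where $\theta(\sigma)$ is the number of $j\in\{1,\dots,n\}$ with $\sigma(j+1)>\sigma(j)$, and let $H_{\rm F}^{(n)}=\sum_{m=0}^{n}T^m\Omega_m$ be the $n$-th order truncated Floquet–Magnus Hamiltonian. A Floquet Hamiltonian is a self-adjoint operator $H_{\rm F}$ with $e^{-iH_{\rm F}T}=\mathcal T\exp\bigl(-i\int_0^T H(t)\,dt\bigr)$, where $\mathcal T\exp$ denotes the time-ordered exponential. Then a Floquet Hamiltonian exists, and for every Floquet Hamiltonian $H_{\rm F}$ $$\bigl\|e^{-iH_{\rm F}T}-e^{-iH_{\rm F}^{(n_0)}T}\bigr\|\le 6V_0T\,2^{-n_0},$$ and, for every integer $m\ge 0$, $e^{-iH_{\rm F}mT}=\mathcal T\exp\bigl(-i\int_0^{mT}H(t)\,dt\bigr)$ and $$\bigl\|e^{-iH_{\rm F}mT}-e^{-iH_{\rm F}^{(n_0)}mT}\bigr\|\le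 6V_0\,mT\,2^{-n_0}.$$ -/

import Mathlib

namespace FloquetMagnus

noncomputable section

/-- The Hilbert space of `N` spins with a `d`-dimensional Hilbert space each, with orthonormal
product basis labelled by the configurations `Fin N → Fin d`. -/
abbrev SpinSpace (N d : ℕ) : Type := EuclideanSpace ℂ (Fin N → Fin d)

/-- Operators on the spin Hilbert space, with the operator norm. -/
abbrev Op (N d : ℕ) : Type := SpinSpace N d →L[ℂ] SpinSpace N d

/-- `A` acts on the spins in `X` only: it is `a ⊗ 1` for an operator `a` on the spins in `X`,
here given by its matrix in the product basis. -/
def SupportedOn {N d : ℕ} (X : Finset (Fin N)) (A : Op N d) : Prop :=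
  ∃ a : Matrix (X → Fin d) (X → Fin d) ℂ, ∀ s t : Fin N → Fin d,
    A (EuclideanSpace.single t 1) s =
      if ∀ i, i ∉ X → s i = t i then a (fun i => s i) (fun i => t i) else 0

/-- `∑_{|X| ≤ k} a_X`. -/
def fewBodySum {N d : ℕ} (k : ℕ) (a : Finset (Fin N) → Op N d) : Op N d :=
  ∑ X with X.card ≤ k, a X

/-- The driving strength `V₀ = ∑_{|X| ≤ k} (1/T) ∫_0^T ‖v_X(t)‖ dt`. -/
def drivingStrength {N d : ℕ} (k : ℕ) (T : ℝ) (v : Finset (Fin N) → ℝ → Op N d) : ℝ :=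
  ∑ X with X.card ≤ k, 1 / T * ∫ t in (0 : ℝ)..T, ‖v X t‖

section Algebra

variable {A : Type*} [NormedRing A] [NormedAlgebra ℂ A]

/-- The `n`-th term of the Dyson series of the Hamiltonian `H(t)`, that is
`(-i)^n ∫_0^t dt_n ∫_0^{t_n} dt_{n-1} ⋯ ∫_0^{t_2} dt_1 H(t_n) ⋯ H(t_1)`. -/
def dysonTerm (H : ℝ → A) : ℕ → ℝ → A
  | 0, _ => 1
  | n + 1, t => ∫ s in (0 : ℝ)..t, (-Complex.I) • (H s * dysonTerm H n s)

/-- The time-ordered exponential `𝒯 exp(-i ∫_0^t H(s) ds)`. -/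
def timeOrderedExp (H : ℝ → A) (t : ℝ) : A := ∑' n, dysonTerm H n t

/-- `exp(-i G t)` for a time-independent `G`. -/
def evolution (G : A) (t : ℝ) : A := NormedSpace.exp ((-Complex.I * (t : ℂ)) • G)

/-- The multi-commutator `[a_n, [a_{n-1}, …, [a_1, a_0] … ]]`. -/
def multiCommutator : (n : ℕ) → (Fin (n + 1) → A) → A
  | 0, a => a 0
  | n + 1, a => ⁅a (Fin.last (n + 1)), multiCommutator n (fun j => a j.castSucc)⁆

/-- `θ(σ)`: the number of ascents of the permutation `σ`. -/
def ascents {n : ℕ} (σ : Equiv.Perm (Fin (n + 1))) : ℕ :=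
  (Finset.univ.filter fun i : Fin n => σ i.castSucc < σ i.succ).card

/-- The ordered simplex `0 ≤ t_0 ≤ t_1 ≤ ⋯ ≤ t_n ≤ T`. -/
def orderedSimplex (n : ℕ) (T : ℝ) : Set (Fin (n + 1) → ℝ) :=
  {t | Monotone t ∧ ∀ i, t i ∈ Set.Icc 0 T}

/-- The `n`-th term `Ω_n` of the Floquet–Magnus expansion of the `T`-periodic `H(t)`. -/
def magnusTerm (H : ℝ → A) (T : ℝ) (n : ℕ) : A :=
  (1 / ((n : ℂ) + 1) ^ 2) • ∑ σ : Equiv.Perm (Fin (n + 1)),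
    ((-1 : ℂ) ^ (n - ascents σ) *
      (((ascents σ).factorial * (n - ascents σ).factorial : ℕ) : ℂ) / (n.factorial : ℂ)) •
    (1 / (Complex.I ^ n * (T : ℂ) ^ (n + 1))) •
      ∫ t in orderedSimplex n T, multiCommutator n (fun j => H (t (σ j)))

/-- The truncated Floquet–Magnus Hamiltonian `H_F^{(n)} = ∑_{m ≤ n} T^m Ω_m`. -/
def truncatedFloquet (H : ℝ → A) (T : ℝ) (n : ℕ) : A :=
  ∑ m ∈ Finset.range (n + 1), ((T : ℂ) ^ m) • magnusTerm H T m

/-- `G` is a Floquet Hamiltonian of the `T`-periodic `H(t)`: it is self-adjoint and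
`exp(-i G T) = 𝒯 exp(-i ∫_0^T H(t) dt)`. -/
def IsFloquetHamiltonian [StarRing A] (H : ℝ → A) (T : ℝ) (G : A) : Prop :=
  IsSelfAdjoint G ∧ evolution G T = timeOrderedExp H T

end Algebra

end

end FloquetMagnus

/-! Put `h(t) = -i H(t)` and insert a complex coupling `y`. Let `U(y)` be the one-period propagator
of `y h(t)`, and let `W(y) = exp P(y)`, where `P` is the Magnus polynomial through order `y^(n+1)`.
At `y = 1` these are the two unitaries to be compared. Both are entire and invertible in `y`, so
they have logarithmic derivatives `G = U⁻¹U' = ∫_0^T U_s⁻¹ h(s) U_s ds` and `K = W⁻¹W' = ∫_0^1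
e^{-sP} P' e^{sP} ds`. No convergence of the Magnus series is needed; three facts suffice.

Agreement at the origin (`exp_magnus_sub_coupledExp_isBigO`): `W - U = O(y^(n+2))`, hence `G - K =
O(y^(n+1))`. The permutation formula for `Ω_n` has to be recognised as the expansion of `log U`.
Expanding `log(1+Z) = ∫_0^1 Z(1+xZ)⁻¹ dx` gives words in `h` weighted by products of
`1_{t_i<t_{i+1}} - x`, and a Beta integral over `x` turns these into the factorial weights. Words
become commutators by applying the same expansion to a system on `A × ℂ` whose logarithm has `y (log
U)'` as a component; this also produces the second factor `1/(n+1)`.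

Locality (`IsDrivenInteraction.norm_logDeriv_sub_le`): `‖G - K‖ ≤ 3 V₀ T` on the disc `|y| < 2` when
`n ≥ 1`. Operators are handled as interactions, measured by sums of norms of their terms. Commuting
an `m`-site interaction with one of local strength `J` costs at most a factor `2mJ`, so the
nested-commutator series of a conjugation sums to a power of `(1 - 2KJs)⁻¹`. The static energy does
not enter, because `G` and `K` are each within a multiple of the drive of the static value `T h₀`.
Magnus terms grow like `m! (λT|y|)^m`, and `n λ T ≤ 1/16` keeps this geometric up to order `n`.

Schwarz lemma (`norm_logDeriv_sub_le_of_isBigO`): a function bounded by `M` on `|y| < 2` and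
vanishing to order `n+1` at `0` is at most `M 2^{-(n+1)}` on `|y| ≤ 1`. For real `y` both families
are unitary and `(U W⁻¹)' = U (G - K) W⁻¹`, so integration over `[0,1]` gives the one-period bound
(`norm_sub_le_of_logDeriv`). For `n = 0` the bound on `G - K` over `[0,1]` is already enough.

Several periods follow by telescoping powers of contractions. A Floquet Hamiltonian exists because a
unitary with finite spectrum has a self-adjoint logarithm. -/

namespace FloquetMagnus

noncomputable section

set_option linter.unusedSectionVars false

open MeasureTheory Set Filter Topology

/-! ### Calculus for primitives of integrable functions -/

section Primitive

variable {A : Type*} [NormedRing A] [NormedAlgebra ℝ A] [CompleteSpace A]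

/-- The product of two primitives is the primitive of the Leibniz expression. -/
theorem integral_mul_integral {f g : ℝ → A} {t : ℝ} (ht : 0 ≤ t)
    (hf : IntervalIntegrable f volume 0 t) (hg : IntervalIntegrable g volume 0 t) :
    (∫ s in (0 : ℝ)..t, f s) * (∫ s in (0 : ℝ)..t, g s) =
      ∫ s in (0 : ℝ)..t, (f s * (∫ r in (0 : ℝ)..s, g r) + (∫ r in (0 : ℝ)..s, f r) * g s) := by
  set μ : Measure ℝ := volume.restrict (Ioc 0 t) with hμ
  have hf' : Integrable f μ := (intervalIntegrable_iff_integrableOn_Ioc_of_le ht).1 hf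
  have hg' : Integrable g μ := (intervalIntegrable_iff_integrableOn_Ioc_of_le ht).1 hg
  have hfg : Integrable (fun z : ℝ × ℝ => f z.1 * g z.2) (μ.prod μ) := hf'.mul_prod hg'
  have hms : MeasurableSet {z : ℝ × ℝ | z.2 ≤ z.1} := measurableSet_le measurable_snd measurable_fst
  have h1 : ∫ z, f z.1 * g z.2 ∂(μ.prod μ) = (∫ s, f s ∂μ) * (∫ s, g s ∂μ) := by
    rw [integral_prod _ hfg]
    rw [← integral_mul_const_of_integrable hf']
    refine integral_congr_ae (Eventually.of_forall fun r => ?_)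
    simpa only using integral_const_mul_of_integrable hg'
  have h2 : ∫ z in {z : ℝ × ℝ | z.2 ≤ z.1}, f z.1 * g z.2 ∂(μ.prod μ)
      = ∫ s, f s * (∫ r in (0 : ℝ)..s, g r) ∂μ := by
    rw [← integral_indicator hms, integral_prod _ (hfg.indicator hms)]
    refine integral_congr_ae ?_
    filter_upwards [ae_restrict_mem measurableSet_Ioc] with r hr
    have e : ∀ s, ({z : ℝ × ℝ | z.2 ≤ z.1}.indicator (fun z : ℝ × ℝ => f z.1 * g z.2)) (r, s)
        = (Iic r).indicator (fun s => f r * g s) s := by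
      intro s; by_cases h : s ≤ r <;> simp [indicator, h]
    simp_rw [e]
    rw [integral_indicator measurableSet_Iic, integral_const_mul_of_integrable hg'.integrableOn,
      hμ, Measure.restrict_restrict measurableSet_Iic, intervalIntegral.integral_of_le hr.1.le,
      inter_comm, Ioc_inter_Iic, min_eq_right hr.2]
  have h3 : ∫ z in {z : ℝ × ℝ | z.2 ≤ z.1}ᶜ, f z.1 * g z.2 ∂(μ.prod μ)
      = ∫ s, (∫ r in (0 : ℝ)..s, f r) * g s ∂μ := by
    rw [← integral_indicator hms.compl, integral_prod_symm _ (hfg.indicator hms.compl)]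
    refine integral_congr_ae ?_
    filter_upwards [ae_restrict_mem measurableSet_Ioc] with s hs
    have e : ∀ r, ({z : ℝ × ℝ | z.2 ≤ z.1}ᶜ.indicator (fun z : ℝ × ℝ => f z.1 * g z.2)) (r, s)
        = (Iio s).indicator (fun r => f r * g s) r := by
      intro r; by_cases h : r < s
      · simp [indicator, h]
      · simp [indicator, h, not_lt.1 h]
    simp_rw [e]
    rw [integral_indicator measurableSet_Iio, integral_mul_const_of_integrable hf'.integrableOn,
      hμ, Measure.restrict_restrict measurableSet_Iio, intervalIntegral.integral_of_le hs.1.le,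
      integral_Ioc_eq_integral_Ioo]
    congr 3
    ext x; simp only [mem_inter_iff, mem_Iio, mem_Ioc, mem_Ioo]
    exact ⟨fun h => ⟨h.2.1, h.1⟩, fun h => ⟨h.2, h.1, h.2.le.trans hs.2⟩⟩
  have hi1 : Integrable (fun s => f s * (∫ r in (0 : ℝ)..s, g r)) μ := by
    refine (hf.mul_continuousOn ?_).1
    exact intervalIntegral.continuousOn_primitive_interval
      (by rw [uIcc_of_le ht, integrableOn_Icc_iff_integrableOn_Ioc]; exact hg')
  have hi2 : Integrable (fun s => (∫ r in (0 : ℝ)..s, f r) * g s) μ := by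
    refine (hg.continuousOn_mul ?_).1
    exact intervalIntegral.continuousOn_primitive_interval
      (by rw [uIcc_of_le ht, integrableOn_Icc_iff_integrableOn_Ioc]; exact hf')
  rw [intervalIntegral.integral_of_le ht, intervalIntegral.integral_of_le ht,
    intervalIntegral.integral_of_le ht, ← h1, ← integral_add_compl hms hfg, h2, h3,
    integral_add hi1 hi2]

/-- `F` is a primitive on `[0, T]` of the integrable function `f`. -/
structure IsPrimitive {E : Type*} [NormedAddCommGroup E] [NormedSpace ℝ E]
    (T : ℝ) (F f : ℝ → E) : Prop where
  nonneg : 0 ≤ T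
  integrable : IntervalIntegrable f volume 0 T
  eq : ∀ t ∈ Icc 0 T, F t = F 0 + ∫ s in (0 : ℝ)..t, f s

namespace IsPrimitive

variable {T : ℝ}

theorem integrable_of_mem {E : Type*} [NormedAddCommGroup E] [NormedSpace ℝ E] {F f : ℝ → E}
    (h : IsPrimitive T F f) {t : ℝ} (ht : t ∈ Icc 0 T) : IntervalIntegrable f volume 0 t :=
  h.integrable.mono_set (by
    rw [uIcc_of_le ht.1, uIcc_of_le (ht.1.trans ht.2)]; exact Icc_subset_Icc_right ht.2)

theorem continuousOn {E : Type*} [NormedAddCommGroup E] [NormedSpace ℝ E] [CompleteSpace E]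
    {F f : ℝ → E} (h : IsPrimitive T F f) : ContinuousOn F (Icc 0 T) := by
  have hT := h.nonneg
  have : ContinuousOn (fun t => F 0 + ∫ s in (0 : ℝ)..t, f s) (Icc 0 T) := by
    refine continuousOn_const.add ?_
    have := intervalIntegral.continuousOn_primitive_interval (f := f) (μ := volume)
        (a := 0) (b := T)
      (by rw [uIcc_of_le hT, integrableOn_Icc_iff_integrableOn_Ioc]; exact h.integrable.1)
    rwa [uIcc_of_le hT] at this
  exact this.congr h.eq

theorem const {E : Type*} [NormedAddCommGroup E] [NormedSpace ℝ E] (hT : 0 ≤ T) (c : E) :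
    IsPrimitive T (fun _ => c) (fun _ => 0) :=
  ⟨hT, intervalIntegrable_const, fun t _ => by simp⟩

theorem congr_deriv {E : Type*} [NormedAddCommGroup E] [NormedSpace ℝ E] {F f g : ℝ → E}
    (h : IsPrimitive T F f) (hfg : ∀ t, f t = g t) : IsPrimitive T F g := by
  obtain rfl : f = g := funext hfg
  exact h

theorem of_le {E : Type*} [NormedAddCommGroup E] [NormedSpace ℝ E] {F f : ℝ → E} {S : ℝ}
    (h : IsPrimitive T F f) (hS : S ∈ Icc 0 T) : IsPrimitive S F f :=
  ⟨hS.1, h.integrable_of_mem hS, fun t ht => h.eq t ⟨ht.1, ht.2.trans hS.2⟩⟩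

/-- The generators are only integrable in time, so there is no pointwise derivative to use. The
Leibniz rule comes from Fubini on the square, after splitting off the initial values `F 0` and `G
0`. -/
theorem mul {F f G g : ℝ → A} (hF : IsPrimitive T F f) (hG : IsPrimitive T G g) :
    IsPrimitive T (fun t => F t * G t) (fun t => f t * G t + F t * g t) := by
  have hT := hF.nonneg
  refine ⟨hT, (hF.integrable.mul_continuousOn (by rw [uIcc_of_le hT]; exact hG.continuousOn)).add
    (hG.integrable.continuousOn_mul (by rw [uIcc_of_le hT]; exact hF.continuousOn)), fun t ht => ?_⟩
  have hf := hF.integrable_of_mem ht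
  have hg := hG.integrable_of_mem ht
  have key := integral_mul_integral ht.1 hf hg
  have cF : ContinuousOn (fun s => ∫ r in (0 : ℝ)..s, f r) (uIcc 0 t) :=
    intervalIntegral.continuousOn_primitive_interval
      (by rw [uIcc_of_le ht.1, integrableOn_Icc_iff_integrableOn_Ioc]; exact hf.1)
  have cG : ContinuousOn (fun s => ∫ r in (0 : ℝ)..s, g r) (uIcc 0 t) :=
    intervalIntegral.continuousOn_primitive_interval
      (by rw [uIcc_of_le ht.1, integrableOn_Icc_iff_integrableOn_Ioc]; exact hg.1)
  have e : ∫ s in (0 : ℝ)..t, (f s * G s + F s * g s) =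
      ∫ s in (0 : ℝ)..t, ((f s * G 0 + F 0 * g s) +
        (f s * (∫ r in (0 : ℝ)..s, g r) + (∫ r in (0 : ℝ)..s, f r) * g s)) := by
    refine intervalIntegral.integral_congr fun s hs => ?_
    rw [uIcc_of_le ht.1] at hs
    have hs' : s ∈ Icc 0 T := ⟨hs.1, hs.2.trans ht.2⟩
    simp only [hF.eq s hs', hG.eq s hs']
    noncomm_ring
  have i1 : IntervalIntegrable (fun s => f s * G 0) volume 0 t := hf.mul_const _
  have i2 : IntervalIntegrable (fun s => F 0 * g s) volume 0 t := hg.const_mul _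
  rw [e, intervalIntegral.integral_add (i1.add i2)
    ((hf.mul_continuousOn cG).add (hg.continuousOn_mul cF)), ← key,
    intervalIntegral.integral_add i1 i2, hF.eq t ht, hG.eq t ht,
    intervalIntegral.integral_of_le ht.1, intervalIntegral.integral_of_le ht.1,
    intervalIntegral.integral_of_le ht.1, intervalIntegral.integral_of_le ht.1,
    integral_mul_const_of_integrable hf.1, integral_const_mul_of_integrable hg.1]
  noncomm_ring

theorem pow {F f : ℝ → ℝ} (hF : IsPrimitive T F f) (n : ℕ) :
    IsPrimitive T (fun t => F t ^ (n + 1)) (fun t => (n + 1) * (f t * F t ^ n)) := by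
  induction n with
  | zero => simpa using hF
  | succ n ih =>
    refine IsPrimitive.congr_deriv (F := fun t => F t ^ (n + 1 + 1)) (ih.mul hF) fun t => ?_
    push_cast; ring

/-- A function whose derivative vanishes is constant. -/
theorem eq_of_deriv_eq_zero {E : Type*} [NormedAddCommGroup E] [NormedSpace ℝ E] {F f : ℝ → E}
    (h : IsPrimitive T F f) (hf : ∀ t ∈ Icc 0 T, f t = 0) {t : ℝ} (ht : t ∈ Icc 0 T) :
    F t = F 0 := by
  rw [h.eq t ht, intervalIntegral.integral_congr (g := fun _ => 0)]
  · simp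
  · intro s hs
    rw [uIcc_of_le ht.1] at hs
    exact hf s ⟨hs.1, hs.2.trans ht.2⟩

theorem of_integrable {E : Type*} [NormedAddCommGroup E] [NormedSpace ℝ E] {f : ℝ → E}
    (hT : 0 ≤ T) (hf : IntervalIntegrable f volume 0 T) :
    IsPrimitive T (fun t => ∫ s in (0 : ℝ)..t, f s) f :=
  ⟨hT, hf, fun t _ => by simp⟩

theorem map {E F : Type*} [NormedAddCommGroup E] [NormedSpace ℝ E] [NormedAddCommGroup F]
    [NormedSpace ℝ F] [CompleteSpace E] [CompleteSpace F] {G g : ℝ → E} (h : IsPrimitive T G g)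
    (L : E →L[ℝ] F) : IsPrimitive T (fun t => L (G t)) (fun t => L (g t)) :=
  ⟨h.nonneg, ⟨L.integrable_comp h.integrable.1, L.integrable_comp h.integrable.2⟩, fun t ht => by
    rw [L.intervalIntegral_comp_comm (h.integrable_of_mem ht), ← map_add, ← h.eq t ht]⟩

end IsPrimitive

end Primitive

/-! ### Dyson series and propagators -/

section Dyson

variable {A : Type*} [NormedRing A] [NormedAlgebra ℂ A] [CompleteSpace A] {T : ℝ}

theorem dysonTerm_zero_time (H : ℝ → A) (n : ℕ) : dysonTerm H (n + 1) 0 = 0 := by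
  simp [dysonTerm]

theorem isPrimitive_dysonTerm {H : ℝ → A} (hT : 0 ≤ T) (hH : IntervalIntegrable H volume 0 T)
    (n : ℕ) : IsPrimitive T (dysonTerm H (n + 1))
      (fun s => (-Complex.I) • (H s * dysonTerm H n s)) := by
  induction n with
  | zero =>
    refine ⟨hT, ?_, fun t _ => by simp [dysonTerm]⟩
    simp only [dysonTerm, mul_one]
    exact hH.smul (-Complex.I)
  | succ n ih =>
    refine ⟨hT, ?_, fun t _ => by rw [dysonTerm_zero_time, zero_add]; rfl⟩
    have : IntervalIntegrable (fun s => H s * dysonTerm H (n + 1) s) volume 0 T := by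
      refine hH.mul_continuousOn ?_
      rw [uIcc_of_le hT]; exact ih.continuousOn
    exact this.smul (-Complex.I)

theorem continuousOn_dysonTerm {H : ℝ → A} (hT : 0 ≤ T) (hH : IntervalIntegrable H volume 0 T)
    (n : ℕ) : ContinuousOn (dysonTerm H n) (Icc 0 T) := by
  cases n with
  | zero => exact continuousOn_const
  | succ n => exact (isPrimitive_dysonTerm hT hH n).continuousOn

/-- The `n`-th power of the primitive of `‖H‖` has derivative `n ‖H‖` times the previous power,
which yields `1/n!` without integrating over a simplex. The factor `‖1‖` is kept because the norm of
the unit is not assumed to be `1`. -/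
theorem norm_dysonTerm_le {H : ℝ → A} (hT : 0 ≤ T) (hH : IntervalIntegrable H volume 0 T)
    (n : ℕ) {t : ℝ} (ht : t ∈ Icc 0 T) :
    ‖dysonTerm H n t‖ ≤ ‖(1 : A)‖ * ((∫ s in (0 : ℝ)..t, ‖H s‖) ^ n / n.factorial) := by
  induction n generalizing t with
  | zero => simp [dysonTerm]
  | succ n ih =>
    have hp := (IsPrimitive.of_integrable hT hH.norm).pow n
    have e := hp.eq t ht
    simp only [intervalIntegral.integral_same, ne_eq, Nat.add_eq_zero_iff, one_ne_zero, and_false,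
      not_false_eq_true, zero_pow, zero_add] at e
    rw [e]
    have e2 : ‖(1 : A)‖ * ((∫ s in (0 : ℝ)..t, ((n : ℝ) + 1) *
        (‖H s‖ * (∫ r in (0 : ℝ)..s, ‖H r‖) ^ n)) / (n + 1).factorial) =
        ∫ s in (0 : ℝ)..t, ‖H s‖ * (‖(1 : A)‖ * ((∫ r in (0 : ℝ)..s, ‖H r‖) ^ n / n.factorial)) := by
      rw [← intervalIntegral.integral_div, ← intervalIntegral.integral_const_mul]
      refine intervalIntegral.integral_congr fun s _ => ?_
      simp only [Nat.factorial_succ]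
      push_cast
      have : (n.factorial : ℝ) ≠ 0 := by positivity
      have : (n : ℝ) + 1 ≠ 0 := by positivity
      field_simp
    rw [e2]
    refine intervalIntegral.norm_integral_le_of_norm_le ht.1
      (Eventually.of_forall fun s hs => ?_) ?_
    · rw [norm_smul]
      simp only [norm_neg, Complex.norm_I, one_mul]
      refine (norm_mul_le _ _).trans ?_
      gcongr
      exact ih ⟨hs.1.le, hs.2.trans ht.2⟩
    · have hn := hp.integrable_of_mem ht
      refine ((hn.const_mul (‖(1 : A)‖ / (n + 1).factorial))).congr (fun s _ => ?_)
      simp only [Nat.factorial_succ]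
      push_cast
      have : (n.factorial : ℝ) ≠ 0 := by positivity
      have : (n : ℝ) + 1 ≠ 0 := by positivity
      field_simp

theorem integral_norm_mono {H : ℝ → A} (hH : IntervalIntegrable H volume 0 T) {t : ℝ}
    (ht : t ∈ Icc 0 T) : ∫ s in (0 : ℝ)..t, ‖H s‖ ≤ ∫ s in (0 : ℝ)..T, ‖H s‖ :=
  intervalIntegral.integral_mono_interval le_rfl ht.1 ht.2
    (Eventually.of_forall fun _ => norm_nonneg _) hH.norm

theorem norm_dysonTerm_le' {H : ℝ → A} (hT : 0 ≤ T) (hH : IntervalIntegrable H volume 0 T)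
    (n : ℕ) {t : ℝ} (ht : t ∈ Icc 0 T) :
    ‖dysonTerm H n t‖ ≤ ‖(1 : A)‖ * ((∫ s in (0 : ℝ)..T, ‖H s‖) ^ n / n.factorial) := by
  refine (norm_dysonTerm_le hT hH n ht).trans ?_
  have h0 : 0 ≤ ∫ s in (0 : ℝ)..t, ‖H s‖ :=
    intervalIntegral.integral_nonneg ht.1 fun _ _ => norm_nonneg _
  gcongr
  exact integral_norm_mono hH ht

theorem summable_dysonTerm {H : ℝ → A} (hT : 0 ≤ T) (hH : IntervalIntegrable H volume 0 T)
    {t : ℝ} (ht : t ∈ Icc 0 T) : Summable (fun n => dysonTerm H n t) :=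
  Summable.of_norm_bounded ((Real.summable_pow_div_factorial _).mul_left _)
    fun n => norm_dysonTerm_le' hT hH n ht

theorem norm_timeOrderedExp_le {H : ℝ → A} (hT : 0 ≤ T) (hH : IntervalIntegrable H volume 0 T)
    {t : ℝ} (ht : t ∈ Icc 0 T) :
    ‖timeOrderedExp H t‖ ≤ ‖(1 : A)‖ * Real.exp (∫ s in (0 : ℝ)..T, ‖H s‖) := by
  rw [Real.exp_eq_exp_ℝ, NormedSpace.exp_eq_tsum_div (𝔸 := ℝ), ← tsum_mul_left]
  exact tsum_of_norm_bounded ((Real.summable_pow_div_factorial _).mul_left _).hasSum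
    fun n => norm_dysonTerm_le' hT hH n ht

theorem timeOrderedExp_zero (H : ℝ → A) : timeOrderedExp H 0 = 1 := by
  rw [timeOrderedExp, tsum_eq_single 0]
  · rfl
  · rintro (_ | n) hn
    · exact absurd rfl hn
    · exact dysonTerm_zero_time H n

/-- The time-ordered exponential solves the Schrödinger equation in integral form. -/
theorem isPrimitive_timeOrderedExp {H : ℝ → A} (hT : 0 ≤ T)
    (hH : IntervalIntegrable H volume 0 T) :
    IsPrimitive T (timeOrderedExp H) (fun s => ((-Complex.I) • H s) * timeOrderedExp H s) := by
  have hC := fun (n : ℕ) (t : ℝ) (ht : t ∈ Icc 0 T) => norm_dysonTerm_le' hT hH n ht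
  have hcont : ContinuousOn (timeOrderedExp H) (Icc 0 T) :=
    continuousOn_tsum (fun n => continuousOn_dysonTerm hT hH n)
      ((Real.summable_pow_div_factorial _).mul_left _) hC
  have h_int : IntervalIntegrable (fun s => ((-Complex.I) • H s) * timeOrderedExp H s) volume 0 T :=
    IntervalIntegrable.mul_continuousOn (hH.smul (-Complex.I))
      (by rwa [uIcc_of_le hT])
  refine ⟨hT, h_int, fun t ht => ?_⟩
  have hsum : HasSum (fun n => dysonTerm H (n + 1) t)
      (∫ s in (0 : ℝ)..t, ((-Complex.I) • H s) * timeOrderedExp H s) := by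
    refine intervalIntegral.hasSum_integral_of_dominated_convergence
      (fun n s => ‖H s‖ * (‖(1 : A)‖ * ((∫ s in (0 : ℝ)..T, ‖H s‖) ^ n / n.factorial)))
      (fun n => ?_) (fun n => Eventually.of_forall fun s hs => ?_)
      (Eventually.of_forall fun s _ => ?_) ?_ (Eventually.of_forall fun s hs => ?_)
    · rw [uIoc_of_le ht.1]
      exact ((isPrimitive_dysonTerm hT hH n).integrable_of_mem ht).1.aestronglyMeasurable
    · rw [uIoc_of_le ht.1] at hs
      rw [norm_smul]
      simp only [norm_neg, Complex.norm_I, one_mul]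
      refine (norm_mul_le _ _).trans ?_
      gcongr
      exact hC n _ ⟨hs.1.le, hs.2.trans ht.2⟩
    · exact ((Real.summable_pow_div_factorial _).mul_left _).mul_left _
    · simp_rw [tsum_mul_left]
      exact ((IsPrimitive.of_integrable hT hH.norm).integrable_of_mem ht).mul_const _
    · rw [uIoc_of_le ht.1] at hs
      have := (summable_dysonTerm hT hH (t := s) ⟨hs.1.le, hs.2.trans ht.2⟩).hasSum
      have := this.mul_left ((-Complex.I) • H s)
      simp only [smul_mul_assoc] at this ⊢
      exact this
  rw [timeOrderedExp_zero, timeOrderedExp, (summable_dysonTerm hT hH ht).tsum_eq_zero_add,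
    hsum.tsum_eq]
  rfl

/-- `U` and `W` are the forward and the inverse propagator of the generator `h` on `[0, T]`:
`U' = h U`, `W' = - W h` and `U(0) = W(0) = 1`. -/
structure IsPropagator (T : ℝ) (h U W : ℝ → A) : Prop where
  integrable : IntervalIntegrable h volume 0 T
  left_zero : U 0 = 1
  right_zero : W 0 = 1
  left : IsPrimitive T U (fun s => h s * U s)
  right : IsPrimitive T W (fun s => -(W s * h s))

/-- The inverse of the time-ordered exponential, as a reversed Dyson series. -/
def inverseTimeOrderedExp (H : ℝ → A) (t : ℝ) : A :=
  (timeOrderedExp (fun s => MulOpposite.op (-H s)) t).unop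

/-- The inverse has its factors in reverse order, so it is the Dyson series of `-H` in the opposite
algebra, and its equation is the forward one transported back. -/
theorem isPropagator_timeOrderedExp {H : ℝ → A} (hT : 0 ≤ T)
    (hH : IntervalIntegrable H volume 0 T) :
    IsPropagator T (fun s => (-Complex.I) • H s) (timeOrderedExp H) (inverseTimeOrderedExp H) := by
  let L : A ≃L[ℝ] Aᵐᵒᵖ := MulOpposite.opContinuousLinearEquiv ℝ
  have hop : IntervalIntegrable (fun s => MulOpposite.op (-H s)) volume 0 T :=
    ⟨(L : A →L[ℝ] Aᵐᵒᵖ).integrable_comp hH.neg.1, (L : A →L[ℝ] Aᵐᵒᵖ).integrable_comp hH.neg.2⟩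
  refine ⟨hH.smul (-Complex.I), timeOrderedExp_zero H, ?_, isPrimitive_timeOrderedExp hT hH, ?_⟩
  · simp [inverseTimeOrderedExp, timeOrderedExp_zero]
  · have := (isPrimitive_timeOrderedExp hT hop).map (L.symm : Aᵐᵒᵖ →L[ℝ] A)
    refine IsPrimitive.congr_deriv (F := inverseTimeOrderedExp H) this fun t => ?_
    simp [L, inverseTimeOrderedExp]

namespace IsPropagator

variable {h U W : ℝ → A}

theorem nonneg (P : IsPropagator T h U W) : 0 ≤ T := P.left.nonneg

theorem mem_right (P : IsPropagator T h U W) : T ∈ Icc 0 T := ⟨P.nonneg, le_rfl⟩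

theorem of_le (P : IsPropagator T h U W) {S : ℝ} (hS : S ∈ Icc 0 T) : IsPropagator S h U W :=
  ⟨P.integrable.mono_set (by
      rw [uIcc_of_le hS.1, uIcc_of_le P.nonneg]; exact Icc_subset_Icc_right hS.2),
    P.left_zero, P.right_zero, P.left.of_le hS, P.right.of_le hS⟩

theorem right_mul_left (P : IsPropagator T h U W) {t : ℝ} (ht : t ∈ Icc 0 T) : W t * U t = 1 := by
  rw [(P.right.mul P.left).eq_of_deriv_eq_zero (fun s _ => by noncomm_ring) ht, P.left_zero,
    P.right_zero, one_mul]

/-- The derivative of `U W` is a commutator with `h` and does not visibly vanish. Dedekind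
finiteness replaces the uniqueness theorem for that equation. -/
theorem left_mul_right [IsDedekindFiniteMonoid A] (P : IsPropagator T h U W) {t : ℝ}
    (ht : t ∈ Icc 0 T) : U t * W t = 1 :=
  mul_eq_one_symm (P.right_mul_left ht)

/-- Every solution of `F' = h F` is `F(t) = U(t) F(0)`. -/
theorem eq_mul [IsDedekindFiniteMonoid A] (P : IsPropagator T h U W) {F : ℝ → A}
    (hF : IsPrimitive T F (fun s => h s * F s)) {t : ℝ} (ht : t ∈ Icc 0 T) :
    F t = U t * F 0 := by
  have := (P.right.mul hF).eq_of_deriv_eq_zero (fun s _ => by noncomm_ring) ht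
  rw [P.right_zero, one_mul] at this
  rw [← this, ← mul_assoc, P.left_mul_right ht, one_mul]

/-- The Heisenberg equation of motion. -/
theorem conj (P : IsPropagator T h U W) {F f : ℝ → A} (hF : IsPrimitive T F f) :
    IsPrimitive T (fun t => W t * F t * U t)
      (fun t => W t * (f t - ⁅h t, F t⁆) * U t) := by
  refine ((P.right.mul hF).mul P.left).congr_deriv fun t => ?_
  rw [Ring.lie_def]; noncomm_ring

theorem continuousOn_left (P : IsPropagator T h U W) : ContinuousOn U (uIcc 0 T) := by
  rw [uIcc_of_le P.nonneg]; exact P.left.continuousOn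

theorem continuousOn_right (P : IsPropagator T h U W) : ContinuousOn W (uIcc 0 T) := by
  rw [uIcc_of_le P.nonneg]; exact P.right.continuousOn

theorem exists_bound_left (P : IsPropagator T h U W) : ∃ C, 0 ≤ C ∧ ∀ t ∈ Icc 0 T, ‖U t‖ ≤ C := by
  obtain ⟨C, hC⟩ := isCompact_Icc.exists_bound_of_continuousOn P.left.continuousOn
  exact ⟨C, (norm_nonneg _).trans (hC T P.mem_right), hC⟩

theorem exists_bound_right (P : IsPropagator T h U W) :
    ∃ C, 0 ≤ C ∧ ∀ t ∈ Icc 0 T, ‖W t‖ ≤ C := by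
  obtain ⟨C, hC⟩ := isCompact_Icc.exists_bound_of_continuousOn P.right.continuousOn
  exact ⟨C, (norm_nonneg _).trans (hC T P.mem_right), hC⟩

/-- Propagator of a constant generator. -/
theorem exp_smul (P : A) : IsPropagator 1 (fun _ => P)
    (fun s => NormedSpace.exp (s • P)) (fun s => NormedSpace.exp (-(s • P))) := by
  let : NormedAlgebra ℚ A := NormedAlgebra.restrictScalars ℚ ℂ A
  have c1 : Continuous fun s : ℝ => NormedSpace.exp (s • P) :=
    NormedSpace.exp_continuous.comp (by fun_prop)
  have c2 : Continuous fun s : ℝ => NormedSpace.exp (-(s • P)) :=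
    NormedSpace.exp_continuous.comp (by fun_prop)
  have d1 : ∀ s : ℝ, HasDerivAt (fun s : ℝ => NormedSpace.exp (s • P))
      (P * NormedSpace.exp (s • P)) s := fun s => hasDerivAt_exp_smul_const' P s
  have d2 : ∀ s : ℝ, HasDerivAt (fun s : ℝ => NormedSpace.exp (-(s • P)))
      (-(NormedSpace.exp (-(s • P)) * P)) s := fun s => by
    have := hasDerivAt_exp_smul_const (𝕂 := ℝ) (-P) s
    simpa only [smul_neg, mul_neg] using this
  refine ⟨intervalIntegrable_const, by simp, by simp, ⟨zero_le_one, ?_, fun t _ => ?_⟩,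
    ⟨zero_le_one, ?_, fun t _ => ?_⟩⟩
  · exact (continuous_const.mul c1).intervalIntegrable _ _
  · rw [intervalIntegral.integral_eq_sub_of_hasDerivAt (fun s _ => d1 s)
      ((continuous_const.mul c1).intervalIntegrable _ _)]
    abel
  · exact ((c2.mul continuous_const).neg).intervalIntegrable _ _
  · rw [intervalIntegral.integral_eq_sub_of_hasDerivAt (fun s _ => d2 s)
      (((c2.mul continuous_const).neg).intervalIntegrable _ _)]
    abel

/-- Comparison of two propagators. -/
theorem sub_eq [IsDedekindFiniteMonoid A] (P : IsPropagator T h U W) {h' U' W' : ℝ → A}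
    (P' : IsPropagator T h' U' W') {t : ℝ} (ht : t ∈ Icc 0 T) :
    U' t - U t = U t * ∫ s in (0 : ℝ)..t, W s * (h' s - h s) * U' s := by
  have := ((P.right.mul P'.left).congr_deriv
    (g := fun s => W s * (h' s - h s) * U' s) (fun s => by noncomm_ring)).eq t ht
  rw [P.right_zero, P'.left_zero, one_mul] at this
  have e : ∫ s in (0 : ℝ)..t, W s * (h' s - h s) * U' s = W t * U' t - 1 := by rw [this]; abel
  rw [e, mul_sub, mul_one, ← mul_assoc, P.left_mul_right ht, one_mul]

/-- Differentiation of the propagator with respect to a parameter of the generator. -/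
theorem hasDerivAt_param [IsDedekindFiniteMonoid A] {h U W : ℂ → ℝ → A}
    (P : ∀ y, IsPropagator T (h y) (U y) (W y)) {y₀ : ℂ} {g : ℂ → ℝ → A} {g₀ : ℝ → A}
    (hg : ∀ y s, h y s - h y₀ s = (y - y₀) • g y s)
    {C : ℝ} (hC : ∀ᶠ y in 𝓝 y₀, ∀ s ∈ Icc 0 T, ‖U y s‖ ≤ C)
    {κ : ℝ → ℝ} (hκ : IntervalIntegrable κ volume 0 T)
    (hgκ : ∀ᶠ y in 𝓝 y₀, ∀ s ∈ Icc 0 T, ‖g y s‖ ≤ κ s)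
    (hgm : ∀ᶠ y in 𝓝[≠] y₀, IntervalIntegrable (g y) volume 0 T)
    (hlim : ∀ s ∈ Icc 0 T, Tendsto (fun y => g y s) (𝓝[≠] y₀) (𝓝 (g₀ s))) :
    HasDerivAt (fun y => U y T) (U y₀ T * ∫ s in (0 : ℝ)..T, W y₀ s * g₀ s * U y₀ s) y₀ := by
  have hT := (P y₀).nonneg
  obtain ⟨C1, hC1, hW⟩ := (P y₀).exists_bound_right
  have e : ∀ y, ∀ t ∈ Icc 0 T, U y t - U y₀ t =
      (y - y₀) • (U y₀ t * ∫ s in (0 : ℝ)..t, W y₀ s * g y s * U y s) := by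
    intro y t ht
    rw [(P y₀).sub_eq (P y) ht, ← mul_smul_comm, ← intervalIntegral.integral_smul]
    congr 1
    refine intervalIntegral.integral_congr fun s _ => ?_
    simp only [hg, mul_smul_comm, smul_mul_assoc]
  have hbd : ∀ᶠ y in 𝓝 y₀, ∀ s ∈ Icc 0 T, ‖W y₀ s * g y s * U y s‖ ≤ C1 * κ s * C := by
    filter_upwards [hC, hgκ] with y hy1 hy2 s hs
    refine (norm_mul₃_le).trans ?_
    have : 0 ≤ κ s := (norm_nonneg _).trans (hy2 s hs)
    have := hy1 s hs; have := hy2 s hs; have := hW s hs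
    gcongr
  have hκ' : IntervalIntegrable (fun s => C1 * κ s * C) volume 0 T := (hκ.const_mul C1).mul_const C
  -- Continuity in the parameter comes first, from the comparison formula and the uniform bound; it
  -- then feeds the dominated convergence of the difference quotient.
  have hptw : ∀ t ∈ Icc 0 T, Tendsto (fun y => U y t) (𝓝 y₀) (𝓝 (U y₀ t)) := by
    intro t ht
    rw [tendsto_iff_norm_sub_tendsto_zero]
    have hsub : uIoc 0 t ⊆ uIoc 0 T := by
      rw [uIoc_of_le ht.1, uIoc_of_le hT]; exact Ioc_subset_Ioc_right ht.2
    have b : ∀ᶠ y in 𝓝 y₀, ‖U y t - U y₀ t‖ ≤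
        ‖y - y₀‖ * (‖U y₀ t‖ * ∫ s in (0 : ℝ)..t, C1 * κ s * C) := by
      filter_upwards [hbd] with y hy
      rw [e y t ht, norm_smul]
      gcongr
      refine (norm_mul_le _ _).trans ?_
      gcongr
      refine intervalIntegral.norm_integral_le_of_norm_le ht.1
        (Eventually.of_forall fun s hs => hy s ⟨hs.1.le, hs.2.trans ht.2⟩)
        (hκ'.mono_set (by rw [uIcc_of_le ht.1, uIcc_of_le hT]; exact Icc_subset_Icc_right ht.2))
    refine squeeze_zero' (Eventually.of_forall fun _ => norm_nonneg _) b ?_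
    have : Tendsto (fun y : ℂ => ‖y - y₀‖ * (‖U y₀ t‖ * ∫ s in (0 : ℝ)..t, C1 * κ s * C)) (𝓝 y₀)
        (𝓝 (‖y₀ - y₀‖ * (‖U y₀ t‖ * ∫ s in (0 : ℝ)..t, C1 * κ s * C))) :=
      Continuous.tendsto (by fun_prop) y₀
    simpa using this
  rw [hasDerivAt_iff_tendsto_slope]
  have h_int : Tendsto (fun y => ∫ s in (0 : ℝ)..T, W y₀ s * g y s * U y s) (𝓝[≠] y₀)
      (𝓝 (∫ s in (0 : ℝ)..T, W y₀ s * g₀ s * U y₀ s)) := by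
    refine intervalIntegral.tendsto_integral_filter_of_dominated_convergence
      (fun s => C1 * κ s * C) ?_ ?_ hκ' (Eventually.of_forall fun s hs => ?_)
    · filter_upwards [hgm] with y hy
      rw [uIoc_of_le hT]
      exact ((hy.continuousOn_mul (P y₀).continuousOn_right).mul_continuousOn
        (P y).continuousOn_left).1.aestronglyMeasurable
    · filter_upwards [nhdsWithin_le_nhds hbd] with y hy
      refine Eventually.of_forall fun s hs => ?_
      rw [uIoc_of_le hT] at hs
      exact hy s ⟨hs.1.le, hs.2⟩
    · rw [uIoc_of_le hT] at hs
      have hs' : s ∈ Icc 0 T := ⟨hs.1.le, hs.2⟩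
      exact (tendsto_const_nhds.mul (hlim s hs')).mul ((hptw s hs').mono_left nhdsWithin_le_nhds)
  refine (tendsto_const_nhds.mul h_int).congr' ?_
  filter_upwards [self_mem_nhdsWithin] with y hy
  rw [slope_def_module, e y T (P y₀).mem_right, smul_smul, inv_mul_cancel₀ (sub_ne_zero.2 hy),
    one_smul]

end IsPropagator

end Dyson

/-- If `a b = 1`, left multiplication by `a` is surjective, hence injective in finite dimension. -/
theorem isDedekindFiniteMonoid_of_finiteDimensional (A : Type*) [Ring A] [Algebra ℂ A]
    [FiniteDimensional ℂ A] : IsDedekindFiniteMonoid A where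
  mul_eq_one_symm {a b} hab := by
    have hs : Function.Surjective (LinearMap.mulLeft ℂ a) := fun x =>
      ⟨b * x, by simp [← mul_assoc, hab]⟩
    have hi := LinearMap.injective_iff_surjective.2 hs
    apply hi
    simp [← mul_assoc, hab]

/-! ### Duhamel's formula and an integral representation of the logarithm -/

section Exponential

variable {A : Type*} [NormedRing A] [NormedAlgebra ℂ A] [FiniteDimensional ℂ A]

/-- `exp (L y)` is the time-one propagator of the constant generator `L y`, so Duhamel's formula is
a case of differentiating a propagator in a parameter. -/
theorem hasDerivAt_exp_comp {L : ℂ → A} {L' : A} {y₀ : ℂ} (hL : HasDerivAt L L' y₀) :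
    HasDerivAt (fun y => NormedSpace.exp (L y))
      (NormedSpace.exp (L y₀) * ∫ s in (0 : ℝ)..1,
        NormedSpace.exp (-(s • L y₀)) * L' * NormedSpace.exp (s • L y₀)) y₀ := by
  have := FiniteDimensional.complete ℂ A
  have := isDedekindFiniteMonoid_of_finiteDimensional A
  let : NormedAlgebra ℚ A := NormedAlgebra.restrictScalars ℚ ℂ A
  have P := fun y => IsPropagator.exp_smul (L y)
  have hnorm : ∀ᶠ y in 𝓝 y₀, ‖L y‖ ≤ ‖L y₀‖ + 1 := by
    filter_upwards [hL.continuousAt.norm.eventually (gt_mem_nhds (lt_add_one ‖L y₀‖))] with y hy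
    exact hy.le
  have : ProperSpace A := FiniteDimensional.proper ℂ A
  obtain ⟨C, hC⟩ := (isCompact_closedBall (0 : A) (‖L y₀‖ + 1)).exists_bound_of_continuousOn
    (f := NormedSpace.exp) NormedSpace.exp_continuous.continuousOn
  have hslope := hasDerivAt_iff_tendsto_slope.1 hL
  have hsl : ∀ᶠ y in 𝓝 y₀, ‖slope L y₀ y‖ ≤ ‖L'‖ + 1 := by
    have h1 : ∀ᶠ y in 𝓝[≠] y₀, ‖slope L y₀ y‖ ≤ ‖L'‖ + 1 := by
      filter_upwards [hslope.norm.eventually (gt_mem_nhds (lt_add_one ‖L'‖))] with y hy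
      exact hy.le
    rw [eventually_nhdsWithin_iff] at h1
    filter_upwards [h1] with y hy
    -- At the base point the slope is `0` by convention, so the bound extends from the punctured
    -- neighbourhood.
    by_cases h : y = y₀
    · rw [h, slope_same, norm_zero]; positivity
    · exact hy h
  have := IsPropagator.hasDerivAt_param P (y₀ := y₀) (g := fun y _ => slope L y₀ y)
    (g₀ := fun _ => L') (fun y s => ?_) (C := C) ?_ (κ := fun _ => ‖L'‖ + 1)
    intervalIntegrable_const ?_ (Eventually.of_forall fun y => intervalIntegrable_const)
    (fun s _ => hslope)
  · simpa only [one_smul] using this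
  · exact (sub_smul_slope L y₀ y).symm
  · filter_upwards [hnorm] with y hy s hs
    refine hC _ ?_
    rw [mem_closedBall_zero_iff, norm_smul, Real.norm_of_nonneg hs.1]
    exact (mul_le_of_le_one_left (norm_nonneg _) hs.2).trans hy
  · filter_upwards [hsl] with y hy s _
    exact hy

theorem commute_intervalIntegral {c : A} {f : ℝ → A} {a b : ℝ}
    (hf : IntervalIntegrable f volume a b) (h : ∀ x ∈ uIcc a b, Commute c (f x)) :
    Commute c (∫ x in a..b, f x) := by
  have := FiniteDimensional.complete ℂ A
  have h1 := (ContinuousLinearMap.mul ℂ A c).intervalIntegral_comp_comm hf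
  have h2 := ((ContinuousLinearMap.mul ℂ A).flip c).intervalIntegral_comp_comm hf
  simp only [ContinuousLinearMap.mul_apply', ContinuousLinearMap.flip_apply] at h1 h2
  rw [Commute, SemiconjBy, ← h1, ← h2]
  exact intervalIntegral.integral_congr fun x hx => h x hx

/-- The open interval is wider than `[0,1]` so that two-sided derivatives are available at both
endpoints; `‖Z‖ < 1/2` pays for `|x| < 2`. -/
theorem isUnit_one_add_smul {Z : A} (hZ : ‖Z‖ < 1 / 2) {x : ℝ} (hx : x ∈ Ioo (-2 : ℝ) 2) :
    IsUnit (1 + x • Z) := by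
  have := FiniteDimensional.complete ℂ A
  have := isUnit_one_sub_of_norm_lt_one (x := -(x • Z)) (by
    rw [norm_neg, norm_smul, Real.norm_eq_abs]
    have : |x| < 2 := abs_lt.2 hx
    nlinarith [norm_nonneg Z, abs_nonneg x])
  simpa using this

/-- The integrand `Z (1 + x Z)⁻¹` of the integral representation of `log (1 + Z)`. -/
def logIntegrand (Z : A) (x : ℝ) : A := Z * Ring.inverse (1 + x • Z)

theorem continuousAt_logIntegrand {Z : A} (hZ : ‖Z‖ < 1 / 2) {x : ℝ} (hx : x ∈ Ioo (-2 : ℝ) 2) :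
    ContinuousAt (logIntegrand Z) x := by
  have := FiniteDimensional.complete ℂ A
  obtain ⟨u, hu⟩ := isUnit_one_add_smul hZ hx
  have h1 : ContinuousAt (fun x : ℝ => Ring.inverse (1 + x • Z)) x := by
    refine ContinuousAt.comp (g := Ring.inverse) (f := fun x : ℝ => 1 + x • Z) ?_ (by fun_prop)
    rw [← hu]
    exact NormedRing.inverse_continuousAt u
  exact continuousAt_const.mul h1

theorem commute_logIntegrand (Z : A) (x x' : ℝ) :
    Commute (logIntegrand Z x) (logIntegrand Z x') := by
  have h0 : ∀ x : ℝ, Commute Z (1 + x • Z) := fun x =>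
    (Commute.one_right Z).add_right ((Commute.refl Z).smul_right x)
  have h1 : ∀ x : ℝ, Commute Z (Ring.inverse (1 + x • Z)) := fun x => by
    by_cases hu : IsUnit (1 + x • Z)
    · obtain ⟨u, hu⟩ := hu
      rw [← hu, Ring.inverse_unit]
      exact Commute.units_inv_right (by rw [hu]; exact h0 x)
    · rw [Ring.inverse_non_unit _ hu]; exact Commute.zero_right Z
  have h2 : Commute (1 + x • Z) (1 + x' • Z) :=
    (Commute.one_left _).add_left ((h0 x').smul_left x)
  exact ((Commute.refl Z).mul_right (h1 x')).mul_left
    (((h1 x).symm).mul_right h2.ringInverse_ringInverse)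

/-- `exp (∫_0^1 Z (1 + x Z)⁻¹ dx) = 1 + Z`. -/
theorem exp_integral_logIntegrand {Z : A} (hZ : ‖Z‖ < 1 / 2) :
    NormedSpace.exp (∫ x in (0 : ℝ)..1, logIntegrand Z x) = 1 + Z := by
  have := FiniteDimensional.complete ℂ A
  let : NormedAlgebra ℚ A := NormedAlgebra.restrictScalars ℚ ℂ A
  have hcont : ContinuousOn (logIntegrand Z) (Ioo (-2 : ℝ) 2) := fun x hx =>
    (continuousAt_logIntegrand hZ hx).continuousWithinAt
  have h_int : ∀ a ∈ Ioo (-2 : ℝ) 2, ∀ b ∈ Ioo (-2 : ℝ) 2,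
      IntervalIntegrable (logIntegrand Z) volume a b := fun a ha b hb =>
    (hcont.mono (ordConnected_Ioo.uIcc_subset ha hb)).intervalIntegrable
  have h0 : (0 : ℝ) ∈ Ioo (-2 : ℝ) 2 := by norm_num
  have hsub : ∀ x ∈ Icc (0 : ℝ) 1, x ∈ Ioo (-2 : ℝ) 2 := fun x hx =>
    ⟨by linarith [hx.1], by linarith [hx.2]⟩
  set L : ℝ → A := fun τ => ∫ x in (0 : ℝ)..τ, logIntegrand Z x with hL
  have dL : ∀ τ ∈ Ioo (-2 : ℝ) 2, HasDerivAt L (logIntegrand Z τ) τ := fun τ hτ =>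
    intervalIntegral.integral_hasDerivAt_right (h_int 0 h0 τ hτ)
      (hcont.stronglyMeasurableAtFilter isOpen_Ioo τ hτ) (continuousAt_logIntegrand hZ hτ)
  have hcomm : ∀ τ ∈ Ioo (-2 : ℝ) 2, ∀ τ' ∈ Ioo (-2 : ℝ) 2, Commute (L τ) (L τ') := by
    intro τ hτ τ' hτ'
    refine commute_intervalIntegral (h_int 0 h0 τ' hτ') fun x' _ => ?_
    exact (commute_intervalIntegral (h_int 0 h0 τ hτ)
      fun x _ => commute_logIntegrand Z x' x).symm
  -- All values of `L` commute, so `exp (-L τ')` factors through `exp (L τ - L τ')` and only the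
  -- derivative of `exp` at `0` is used.
  have dE : ∀ τ ∈ Ioo (-2 : ℝ) 2, HasDerivAt (fun τ => NormedSpace.exp (-L τ))
      (-(NormedSpace.exp (-L τ) * logIntegrand Z τ)) τ := by
    intro τ hτ
    have d1 : HasDerivAt (fun τ' => L τ - L τ') (-logIntegrand Z τ) τ := (dL τ hτ).const_sub _
    have d2 : HasFDerivAt (NormedSpace.exp : A → A) (1 : A →L[ℝ] A) (L τ - L τ) := by
      rw [sub_self]; exact hasFDerivAt_exp_zero
    have d3 := (d2.comp_hasDerivAt τ d1).const_mul (NormedSpace.exp (-L τ))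
    have d4 : HasDerivAt (fun τ' => NormedSpace.exp (-L τ) * NormedSpace.exp (L τ - L τ'))
        (-(NormedSpace.exp (-L τ) * logIntegrand Z τ)) τ := by
      simpa [Function.comp_def] using d3
    refine d4.congr_of_eventuallyEq ?_
    filter_upwards [Ioo_mem_nhds hτ.1 hτ.2] with τ' hτ'
    rw [← NormedSpace.exp_add_of_commute]
    · congr 1; abel
    · exact (Commute.neg_left (((Commute.refl _)).sub_right (hcomm τ hτ τ' hτ')))
  -- `exp (-L τ) (1 + τ Z)` is constant, equal to its value `1` at `τ = 0`.
  have dG : ∀ τ ∈ Ioo (-2 : ℝ) 2,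
      HasDerivAt (fun τ => NormedSpace.exp (-L τ) * (1 + τ • Z)) 0 τ := by
    intro τ hτ
    have d1 : HasDerivAt (fun τ : ℝ => 1 + τ • Z) Z τ := by
      simpa using ((hasDerivAt_id τ).smul_const Z).const_add 1
    have hz : -(NormedSpace.exp (-L τ) * logIntegrand Z τ) * (1 + τ • Z) +
        NormedSpace.exp (-L τ) * Z = 0 := by
      rw [logIntegrand, neg_mul, mul_assoc, mul_assoc,
        Ring.inverse_mul_cancel _ (isUnit_one_add_smul hZ hτ), mul_one, neg_add_cancel]
    have := (dE τ hτ).mul d1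
    rwa [hz] at this
  have hconst := constant_of_has_deriv_right_zero (a := 0) (b := 1)
    (fun τ hτ => (dG τ (hsub τ hτ)).continuousAt.continuousWithinAt)
    (fun τ hτ => (dG τ (hsub τ ⟨hτ.1, hτ.2.le⟩)).hasDerivWithinAt) 1 (by norm_num)
  have e1 : NormedSpace.exp (-L 1) * (1 + Z) = 1 := by
    simpa [hL] using hconst
  calc NormedSpace.exp (L 1) = NormedSpace.exp (L 1) * (NormedSpace.exp (-L 1) * (1 + Z)) := by
        rw [e1, mul_one]
    _ = 1 + Z := by
        rw [← mul_assoc, ← NormedSpace.exp_add_of_commute (Commute.neg_right (Commute.refl _)),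
          add_neg_cancel, NormedSpace.exp_zero, one_mul]

end Exponential

/-! ### An affine extension of the adjoint action, turning words into commutators -/

section Block

variable (A : Type*) [NormedRing A] [NormedAlgebra ℂ A] [FiniteDimensional ℂ A]

/-- Operators on `A × ℂ`. -/
def BlockOp : Type _ := (A × ℂ) →L[ℂ] (A × ℂ)

instance : NormedRing (BlockOp A) := inferInstanceAs (NormedRing ((A × ℂ) →L[ℂ] (A × ℂ)))

instance : NormedAlgebra ℂ (BlockOp A) :=
  inferInstanceAs (NormedAlgebra ℂ ((A × ℂ) →L[ℂ] (A × ℂ)))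

instance : FiniteDimensional ℂ (BlockOp A) :=
  inferInstanceAs (FiniteDimensional ℂ ((A × ℂ) →L[ℂ] (A × ℂ)))

variable {A}

/-- The value of an operator at the vector `x`. -/
def blockEval (x : A × ℂ) : BlockOp A →L[ℂ] A × ℂ :=
  LinearMap.toContinuousLinearMap
    { toFun := fun R => (show (A × ℂ) →L[ℂ] (A × ℂ) from R) x
      map_add' := fun _ _ => rfl
      map_smul' := fun _ _ => rfl }

theorem blockEval_one (x : A × ℂ) : blockEval x (1 : BlockOp A) = x := rfl

theorem blockEval_mul (x : A × ℂ) (R S : BlockOp A) :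
    blockEval x (R * S) = blockEval (blockEval x S) R := rfl

theorem BlockOp.ext {R S : BlockOp A} (h : ∀ x, blockEval x R = blockEval x S) : R = S :=
  ContinuousLinearMap.ext h

/-- The operator `(X, c) ↦ ([a, X] + c g, 0)`. -/
def blockGen : (A × A) →L[ℂ] BlockOp A :=
  LinearMap.toContinuousLinearMap
    { toFun := fun p => show (A × ℂ) →L[ℂ] (A × ℂ) from LinearMap.toContinuousLinearMap
        { toFun := fun x => (⁅p.1, x.1⁆ + x.2 • p.2, 0)
          map_add' := fun x y => by
            simp only [Prod.fst_add, Prod.snd_add, Ring.lie_def, add_smul, Prod.mk_add_mk, add_zero]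
            congr 1; noncomm_ring
          map_smul' := fun c x => by
            simp [Ring.lie_def, smul_sub, smul_smul] }
      map_add' := fun p q => by
        refine ContinuousLinearMap.ext fun x => ?_
        change ((⁅(p + q).1, x.1⁆ + x.2 • (p + q).2, 0) : A × ℂ) =
          (⁅p.1, x.1⁆ + x.2 • p.2, 0) + (⁅q.1, x.1⁆ + x.2 • q.2, 0)
        simp only [Prod.fst_add, Prod.snd_add, Ring.lie_def, smul_add, Prod.mk_add_mk, add_zero]
        congr 1; noncomm_ring
      map_smul' := fun c p => by
        refine ContinuousLinearMap.ext fun x => ?_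
        change ((⁅(c • p).1, x.1⁆ + x.2 • (c • p).2, 0) : A × ℂ) =
          c • (⁅p.1, x.1⁆ + x.2 • p.2, 0)
        simp [Ring.lie_def, smul_sub, smul_comm c] }

theorem blockGen_apply (a g X : A) (c : ℂ) :
    blockEval (X, c) (blockGen (a, g)) = (⁅a, X⁆ + c • g, 0) := rfl

/-- The scalar component is conserved and the other solves `X' = [h, X] + c g`. In the Heisenberg
picture `W X U` the commutator cancels and only `c W g U` is left to integrate. -/
theorem blockPropagator_apply {T : ℝ} {h g U W : ℝ → A} (P : IsPropagator T h U W)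
    {U' W' : ℝ → BlockOp A}
    (P' : IsPropagator T (fun s => blockGen (h s, g s)) U' W') (X : A) (c : ℂ) :
    blockEval (X, c) (U' T) = (U T * (X + c • ∫ s in (0 : ℝ)..T, W s * g s * U s) * W T, c) := by
  have := FiniteDimensional.complete ℂ A
  have := FiniteDimensional.complete ℂ (BlockOp A)
  have := isDedekindFiniteMonoid_of_finiteDimensional A
  have hT := P.mem_right
  have he := P'.left.map ((blockEval (X, c)).restrictScalars ℝ)
  have h1 := he.map ((ContinuousLinearMap.fst ℂ A ℂ).restrictScalars ℝ)
  have h2 := he.map ((ContinuousLinearMap.snd ℂ A ℂ).restrictScalars ℝ)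
  simp only [ContinuousLinearMap.coe_restrictScalars',
    ContinuousLinearMap.coe_fst', ContinuousLinearMap.coe_snd', blockEval_mul] at h1 h2
  have hz : ∀ t, (blockEval (X, c) (U' t)) =
      ((blockEval (X, c) (U' t)).1, (blockEval (X, c) (U' t)).2) := fun t => rfl
  have e2 : ∀ t ∈ Icc 0 T, (blockEval (X, c) (U' t)).2 = c := by
    intro t ht
    rw [h2.eq_of_deriv_eq_zero (fun s _ => by rw [hz s, blockGen_apply]) ht, P'.left_zero]
    rfl
  have h3 := (P.conj h1).eq T hT
  have h4 : ∫ s in (0 : ℝ)..T, W s *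
      ((blockEval (blockEval (X, c) (U' s)) (blockGen (h s, g s))).1 -
      ⁅h s, (blockEval (X, c) (U' s)).1⁆) * U s = c • ∫ s in (0 : ℝ)..T, W s * g s * U s := by
    rw [← intervalIntegral.integral_smul]
    refine intervalIntegral.integral_congr fun s hs => ?_
    rw [uIcc_of_le P.nonneg] at hs
    rw [hz s, blockGen_apply, e2 s hs]
    simp
  rw [h4, P.left_zero, P.right_zero, P'.left_zero] at h3
  simp only [blockEval_one, one_mul, mul_one] at h3
  rw [hz T, e2 T hT, ← h3]
  congr 1
  have : U T * (W T * (blockEval (X, c) (U' T)).1 * U T) * W T =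
      (U T * W T) * (blockEval (X, c) (U' T)).1 * (U T * W T) := by
    noncomm_ring
  rw [this, P.left_mul_right hT, one_mul, mul_one]

theorem exp_blockGen_apply (p q X : A) (c : ℂ) :
    blockEval (X, c) (NormedSpace.exp (blockGen (p, q))) =
      (NormedSpace.exp p * (X + c • ∫ s in (0 : ℝ)..1,
        NormedSpace.exp (-(s • p)) * q * NormedSpace.exp (s • p)) * NormedSpace.exp (-p), c) := by
  have := FiniteDimensional.complete ℂ A
  have := FiniteDimensional.complete ℂ (BlockOp A)
  have := blockPropagator_apply (g := fun _ => q) (IsPropagator.exp_smul p)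
    (IsPropagator.exp_smul (blockGen (p, q))) X c
  simpa only [one_smul] using this

theorem blockGen_mul_multiCommutator (n : ℕ) (a : Fin (n + 2) → A) :
    blockEval (multiCommutator n (fun j => a j.castSucc), 0)
      (blockGen (a (Fin.last (n + 1)), a (Fin.last (n + 1)))) = (multiCommutator (n + 1) a, 0) := by
  simp [blockGen_apply, multiCommutator]

end Block

/-! ### Propagators with a complex coupling constant -/

section Coupled

variable {B : Type*} [NormedRing B] [NormedAlgebra ℂ B] [FiniteDimensional ℂ B] {T : ℝ}

/-- The propagator of the generator `y h(t)`. -/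
def coupledExp (h : ℝ → B) (y : ℂ) : ℝ → B :=
  timeOrderedExp (fun s => (Complex.I * y) • h s)

/-- The inverse of the propagator of the generator `y h(t)`. -/
def coupledInv (h : ℝ → B) (y : ℂ) : ℝ → B :=
  inverseTimeOrderedExp (fun s => (Complex.I * y) • h s)

/-- The factor `i y` in the definition cancels the `-i` of the time-ordered exponential. -/
theorem isPropagator_coupledExp {h : ℝ → B} (hT : 0 ≤ T) (hh : IntervalIntegrable h volume 0 T)
    (y : ℂ) : IsPropagator T (fun s => y • h s) (coupledExp h y) (coupledInv h y) := by
  have := FiniteDimensional.complete ℂ B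
  have P := isPropagator_timeOrderedExp hT (H := fun s => (Complex.I * y) • h s)
      (hh.smul (Complex.I * y))
  have e : (fun s => (-Complex.I) • (Complex.I * y) • h s) = fun s => y • h s := by
    funext s
    rw [smul_smul, ← mul_assoc]
    simp
  rwa [e] at P

theorem norm_coupledExp_le {h : ℝ → B} (hT : 0 ≤ T) (hh : IntervalIntegrable h volume 0 T)
    (y : ℂ) {t : ℝ} (ht : t ∈ Icc 0 T) :
    ‖coupledExp h y t‖ ≤ ‖(1 : B)‖ * Real.exp (‖y‖ * ∫ s in (0 : ℝ)..T, ‖h s‖) := by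
  have := FiniteDimensional.complete ℂ B
  have := norm_timeOrderedExp_le hT (H := fun s => (Complex.I * y) • h s)
      (hh.smul (Complex.I * y)) ht
  simpa [coupledExp, norm_smul, intervalIntegral.integral_const_mul] using this

theorem hasDerivAt_coupledExp {h : ℝ → B} (hT : 0 ≤ T) (hh : IntervalIntegrable h volume 0 T)
    (y : ℂ) : HasDerivAt (fun y => coupledExp h y T)
      (coupledExp h y T * ∫ s in (0 : ℝ)..T, coupledInv h y s * h s * coupledExp h y s) y := by
  have := FiniteDimensional.complete ℂ B
  have := isDedekindFiniteMonoid_of_finiteDimensional B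
  refine IsPropagator.hasDerivAt_param (isPropagator_coupledExp hT hh) (g := fun _ => h)
    (g₀ := h) (fun y' s => by simp only [sub_smul])
    (C := ‖(1 : B)‖ * Real.exp ((‖y‖ + 1) * ∫ s in (0 : ℝ)..T, ‖h s‖)) ?_ (κ := fun s => ‖h s‖)
    hh.norm (Eventually.of_forall fun _ s _ => le_rfl)
    (Eventually.of_forall fun _ => hh) (fun s _ => tendsto_const_nhds)
  have : ∀ᶠ y' in 𝓝 y, ‖y'‖ < ‖y‖ + 1 :=
    continuous_norm.continuousAt.eventually (gt_mem_nhds (lt_add_one ‖y‖))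
  filter_upwards [this] with y' hy' s hs
  refine (norm_coupledExp_le hT hh y' hs).trans ?_
  have : 0 ≤ ∫ s in (0 : ℝ)..T, ‖h s‖ :=
    intervalIntegral.integral_nonneg hT fun _ _ => norm_nonneg _
  gcongr

theorem coupledExp_zero_coupling {h : ℝ → B} (hT : 0 ≤ T)
    (hh : IntervalIntegrable h volume 0 T) : coupledExp h 0 T = 1 := by
  have := FiniteDimensional.complete ℂ B
  have P := isPropagator_coupledExp hT hh 0
  rw [P.left.eq_of_deriv_eq_zero (fun s _ => by simp) P.mem_right, P.left_zero]

end Coupled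

/-! ### Expansion of the logarithm of the propagator in the coupling -/

section Cascade

variable {B : Type*} [NormedRing B] [NormedAlgebra ℂ B] [FiniteDimensional ℂ B] {T : ℝ}

/-- The iterated integrals of `(1_{r < s} - x) h(r)`. -/
def cascade (h : ℝ → B) (T x : ℝ) : ℕ → ℝ → B
  | 0, _ => 1
  | n + 1, s => (∫ r in (0 : ℝ)..s, h r * cascade h T x n r) -
      x • ∫ r in (0 : ℝ)..T, h r * cascade h T x n r

/-- The coefficients of the expansion of `Z (1 + x Z)⁻¹`, where `1 + Z` is the propagator. -/
def cascadeCoeff (h : ℝ → B) (T x : ℝ) (n : ℕ) : B :=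
  ∫ r in (0 : ℝ)..T, h r * cascade h T x n r

/-- The coefficients of the expansion of the logarithm of the propagator. -/
def logCoeff (h : ℝ → B) (T : ℝ) (n : ℕ) : B := ∫ x in (0 : ℝ)..1, cascadeCoeff h T x n

variable {h : ℝ → B}

theorem continuousOn_cascade (hT : 0 ≤ T) (hh : IntervalIntegrable h volume 0 T) (x : ℝ) (n : ℕ) :
    ContinuousOn (cascade h T x n) (Icc 0 T) := by
  have := FiniteDimensional.complete ℂ B
  induction n with
  | zero => exact continuousOn_const
  | succ n ih =>
    have hi : IntervalIntegrable (fun r => h r * cascade h T x n r) volume 0 T :=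
      hh.mul_continuousOn (by rwa [uIcc_of_le hT])
    exact ((IsPrimitive.of_integrable hT hi).continuousOn).sub continuousOn_const

theorem integrable_mul_cascade (hT : 0 ≤ T) (hh : IntervalIntegrable h volume 0 T) (x : ℝ)
    (n : ℕ) : IntervalIntegrable (fun r => h r * cascade h T x n r) volume 0 T :=
  hh.mul_continuousOn (by rw [uIcc_of_le hT]; exact continuousOn_cascade hT hh x n)

theorem norm_integral_mul_le (hh : IntervalIntegrable h volume 0 T) {f : ℝ → B}
    {C : ℝ} (hf : ∀ s ∈ Icc 0 T, ‖f s‖ ≤ C) {t : ℝ} (ht : t ∈ Icc 0 T) :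
    ‖∫ r in (0 : ℝ)..t, h r * f r‖ ≤ (∫ r in (0 : ℝ)..T, ‖h r‖) * C := by
  have hC : 0 ≤ C := (norm_nonneg _).trans (hf t ht)
  have hht : IntervalIntegrable h volume 0 t := hh.mono_set (by
    rw [uIcc_of_le ht.1, uIcc_of_le (ht.1.trans ht.2)]; exact Icc_subset_Icc_right ht.2)
  calc ‖∫ r in (0 : ℝ)..t, h r * f r‖ ≤ ∫ r in (0 : ℝ)..t, ‖h r‖ * C := by
        refine intervalIntegral.norm_integral_le_of_norm_le ht.1
          (Eventually.of_forall fun s hs => ?_) (hht.norm.mul_const C)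
        refine (norm_mul_le _ _).trans ?_
        gcongr
        exact hf s ⟨hs.1.le, hs.2.trans ht.2⟩
    _ = (∫ r in (0 : ℝ)..t, ‖h r‖) * C := by rw [intervalIntegral.integral_mul_const]
    _ ≤ _ := by
        gcongr
        exact integral_norm_mono hh ht

theorem norm_integral_sub_smul_integral_le (hh : IntervalIntegrable h volume 0 T) {f : ℝ → B}
    {C : ℝ} (hf : ∀ s ∈ Icc 0 T, ‖f s‖ ≤ C) (x : ℝ) {t : ℝ} (ht : t ∈ Icc 0 T) :
    ‖(∫ r in (0 : ℝ)..t, h r * f r) - x • ∫ r in (0 : ℝ)..T, h r * f r‖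
      ≤ (1 + |x|) * ((∫ r in (0 : ℝ)..T, ‖h r‖) * C) := by
  refine (norm_sub_le _ _).trans ?_
  rw [norm_smul, Real.norm_eq_abs, add_mul, one_mul]
  gcongr
  · exact norm_integral_mul_le hh hf ht
  · exact norm_integral_mul_le hh hf ⟨ht.1.trans ht.2, le_rfl⟩

/-- The growth is geometric, with no `1/n!`: the kernel `1_{r<s} - x` does not vanish above the
diagonal. This is enough because the expansion is used only as `y → 0`. -/
theorem norm_cascade_le (hh : IntervalIntegrable h volume 0 T) (x : ℝ) (n : ℕ) :
    ∀ s ∈ Icc 0 T, ‖cascade h T x n s‖ ≤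
      ((1 + |x|) * ∫ r in (0 : ℝ)..T, ‖h r‖) ^ n * ‖(1 : B)‖ := by
  induction n with
  | zero => intro s _; simp [cascade]
  | succ n ih =>
    intro s hs
    refine (norm_integral_sub_smul_integral_le hh ih x hs).trans (le_of_eq ?_)
    ring

theorem continuous_integral_mul_cascade (hT : 0 ≤ T) (hh : IntervalIntegrable h volume 0 T)
    {n : ℕ} (ih : ∀ s ∈ Icc 0 T, Continuous fun x => cascade h T x n s) {t : ℝ}
    (ht : t ∈ Icc 0 T) :
    Continuous fun x => ∫ r in (0 : ℝ)..t, h r * cascade h T x n r := by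
  rw [continuous_iff_continuousAt]
  intro x₀
  have hsub : uIcc 0 t ⊆ uIcc 0 T := by
    rw [uIcc_of_le ht.1, uIcc_of_le hT]; exact Icc_subset_Icc_right ht.2
  have hκ : 0 ≤ ∫ r in (0 : ℝ)..T, ‖h r‖ :=
    intervalIntegral.integral_nonneg hT fun _ _ => norm_nonneg _
  refine intervalIntegral.continuousAt_of_dominated_interval
    (bound := fun r => ‖h r‖ *
      (((1 + (|x₀| + 1)) * ∫ r in (0 : ℝ)..T, ‖h r‖) ^ n * ‖(1 : B)‖)) ?_ ?_ ?_ ?_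
  · refine Eventually.of_forall fun x => ?_
    rw [uIoc_of_le ht.1]
    exact ((integrable_mul_cascade hT hh x n).mono_set hsub).1.aestronglyMeasurable
  · have : ∀ᶠ x in 𝓝 x₀, |x| < |x₀| + 1 :=
      continuous_abs.continuousAt.eventually (gt_mem_nhds (lt_add_one |x₀|))
    filter_upwards [this] with x hx
    refine Eventually.of_forall fun r hr => ?_
    rw [uIoc_of_le ht.1] at hr
    refine (norm_mul_le _ _).trans ?_
    gcongr
    refine (norm_cascade_le hh x n r ⟨hr.1.le, hr.2.trans ht.2⟩).trans ?_
    gcongr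
  · exact (hh.mono_set hsub).norm.mul_const _
  · refine Eventually.of_forall fun r hr => ?_
    rw [uIoc_of_le ht.1] at hr
    exact continuousAt_const.mul (ih r ⟨hr.1.le, hr.2.trans ht.2⟩).continuousAt

theorem continuous_cascade_param (hT : 0 ≤ T) (hh : IntervalIntegrable h volume 0 T) (n : ℕ) :
    ∀ s ∈ Icc 0 T, Continuous fun x => cascade h T x n s := by
  induction n with
  | zero => intro s _; exact continuous_const
  | succ n ih =>
    intro s hs
    exact (continuous_integral_mul_cascade hT hh ih hs).sub
      (continuous_id.smul (continuous_integral_mul_cascade hT hh ih ⟨hT, le_rfl⟩))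

theorem continuous_cascadeCoeff (hT : 0 ≤ T) (hh : IntervalIntegrable h volume 0 T) (n : ℕ) :
    Continuous fun x => cascadeCoeff h T x n :=
  continuous_integral_mul_cascade hT hh (continuous_cascade_param hT hh n) ⟨hT, le_rfl⟩

/-- Remainder of the expansion of the solution `f` of `f(s) = 1 + y ∫ (1_{r < s} - x) h f`. -/
def cascadeRem (h : ℝ → B) (T x : ℝ) (y : ℂ) (f : ℝ → B) (M : ℕ) (s : ℝ) : B :=
  f s - ∑ n ∈ Finset.range M, y ^ n • cascade h T x n s

theorem integral_mul_cascadeRem (hT : 0 ≤ T) (hh : IntervalIntegrable h volume 0 T) {x : ℝ} {y : ℂ}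
    {f : ℝ → B} (hf : ContinuousOn f (Icc 0 T)) (M : ℕ) {t : ℝ} (ht : t ∈ Icc 0 T) :
    ∫ r in (0 : ℝ)..t, h r * cascadeRem h T x y f M r = (∫ r in (0 : ℝ)..t, h r * f r) -
      ∑ n ∈ Finset.range M, y ^ n • ∫ r in (0 : ℝ)..t, h r * cascade h T x n r := by
  have hsub : uIcc 0 t ⊆ uIcc 0 T := by
    rw [uIcc_of_le ht.1, uIcc_of_le hT]; exact Icc_subset_Icc_right ht.2
  have i1 : IntervalIntegrable (fun r => h r * f r) volume 0 t :=
    (hh.mul_continuousOn (by rwa [uIcc_of_le hT])).mono_set hsub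
  have i2 : ∀ n ∈ Finset.range M,
      IntervalIntegrable (fun r => y ^ n • (h r * cascade h T x n r)) volume 0 t := fun n _ =>
    ((integrable_mul_cascade hT hh x n).mono_set hsub).smul (y ^ n)
  simp_rw [cascadeRem, mul_sub, Finset.mul_sum, mul_smul_comm]
  rw [intervalIntegral.integral_sub i1 (by
      have := IntervalIntegrable.sum (Finset.range M) i2
      simpa only [Finset.sum_fn] using this),
    intervalIntegral.integral_finsetSum i2]
  simp_rw [intervalIntegral.integral_smul]

/-- The integral equation sends the remainder after `M` terms to the remainder after `M + 1` terms,
so each order gains a factor `‖y‖ (1 + |x|) ∫ ‖h‖`, and `1 + |x| ≤ 2`. -/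
theorem norm_cascadeRem_le (hT : 0 ≤ T) (hh : IntervalIntegrable h volume 0 T) {x : ℝ}
    (hx : x ∈ Icc (0 : ℝ) 1) {y : ℂ} {f : ℝ → B} (hf : ContinuousOn f (Icc 0 T))
    (hfe : ∀ s ∈ Icc 0 T, f s = 1 + y • ((∫ r in (0 : ℝ)..s, h r * f r) -
      x • ∫ r in (0 : ℝ)..T, h r * f r)) {C : ℝ} (hC : ∀ s ∈ Icc 0 T, ‖f s‖ ≤ C) (M : ℕ) :
    ∀ s ∈ Icc 0 T, ‖cascadeRem h T x y f M s‖ ≤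
      (‖y‖ * (2 * ∫ r in (0 : ℝ)..T, ‖h r‖)) ^ M * C := by
  induction M with
  | zero => intro s hs; simpa [cascadeRem] using hC s hs
  | succ M ih =>
    intro s hs
    have hT' : T ∈ Icc 0 T := ⟨hT, le_rfl⟩
    have e : cascadeRem h T x y f (M + 1) s =
        y • ((∫ r in (0 : ℝ)..s, h r * cascadeRem h T x y f M r) -
          x • ∫ r in (0 : ℝ)..T, h r * cascadeRem h T x y f M r) := by
      rw [integral_mul_cascadeRem hT hh hf M hs, integral_mul_cascadeRem hT hh hf M hT',
        cascadeRem, hfe s hs, Finset.sum_range_succ']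
      simp only [cascade, pow_zero, one_smul]
      have : ∑ k ∈ Finset.range M, y ^ (k + 1) • ((∫ r in (0 : ℝ)..s, h r * cascade h T x k r) -
          x • ∫ r in (0 : ℝ)..T, h r * cascade h T x k r) =
          y • ((∑ n ∈ Finset.range M, y ^ n • ∫ r in (0 : ℝ)..s, h r * cascade h T x n r) -
            x • ∑ n ∈ Finset.range M, y ^ n • ∫ r in (0 : ℝ)..T, h r * cascade h T x n r) := by
        rw [Finset.smul_sum, ← Finset.sum_sub_distrib, Finset.smul_sum]
        refine Finset.sum_congr rfl fun n _ => ?_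
        rw [smul_comm x (y ^ n), ← smul_sub, smul_smul, pow_succ']
      rw [this]
      simp only [smul_sub]
      abel
    rw [e, norm_smul]
    have hb := norm_integral_sub_smul_integral_le hh ih x hs
    have hx' : 1 + |x| ≤ 2 := by rw [abs_of_nonneg hx.1]; linarith [hx.2]
    have hC0 : 0 ≤ C := (norm_nonneg _).trans (hC s hs)
    have hκ : 0 ≤ ∫ r in (0 : ℝ)..T, ‖h r‖ :=
      intervalIntegral.integral_nonneg hT fun _ _ => norm_nonneg _
    calc _ ≤ ‖y‖ * ((1 + |x|) * ((∫ r in (0 : ℝ)..T, ‖h r‖) *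
          ((‖y‖ * (2 * ∫ r in (0 : ℝ)..T, ‖h r‖)) ^ M * C))) := by gcongr
      _ ≤ ‖y‖ * (2 * ((∫ r in (0 : ℝ)..T, ‖h r‖) *
          ((‖y‖ * (2 * ∫ r in (0 : ℝ)..T, ‖h r‖)) ^ M * C))) := by gcongr
      _ = _ := by ring

/-- With `c = (1 + xZ)⁻¹`, the function `f(s) = U(s) c` solves `f = 1 + y ∫ (1_{r<s} - x) h f`: one
has `y ∫_0^s h f = f(s) - c`, and `c + x (f(T) - c) = 1` is the definition of `c`. Iterating this
equation produces the cascade, and `Z c = f(T) - c` is `y ∫_0^T h f`. -/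
theorem logIntegrand_expansion (hT : 0 ≤ T) (hh : IntervalIntegrable h volume 0 T) {y : ℂ}
    {U W : ℝ → B} (P : IsPropagator T (fun s => y • h s) U W) (hZ : ‖U T - 1‖ < 1 / 2) {C : ℝ}
    (hC : ∀ s ∈ Icc 0 T, ‖U s‖ ≤ C) {x : ℝ} (hx : x ∈ Icc (0 : ℝ) 1) (M : ℕ) :
    ‖logIntegrand (U T - 1) x - ∑ n ∈ Finset.range M, y ^ (n + 1) • cascadeCoeff h T x n‖ ≤
      (‖y‖ * (2 * ∫ r in (0 : ℝ)..T, ‖h r‖)) ^ (M + 1) * (C * (2 * ‖(1 : B)‖)) := by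
  have := FiniteDimensional.complete ℂ B
  have hT' : T ∈ Icc 0 T := ⟨hT, le_rfl⟩
  set Z := U T - 1 with hZdef
  set c := Ring.inverse (1 + x • Z) with hc
  have hxI : x ∈ Ioo (-2 : ℝ) 2 := ⟨by linarith [hx.1], by linarith [hx.2]⟩
  have hcu : (1 + x • Z) * c = 1 := Ring.mul_inverse_cancel _ (isUnit_one_add_smul hZ hxI)
  have hC0 : 0 ≤ C := (norm_nonneg _).trans (hC T hT')
  -- From `c = 1 - x Z c` and `‖Z‖ < 1/2`, half of `‖c‖` is absorbed on the left.
  have hcn : ‖c‖ ≤ 2 * ‖(1 : B)‖ := by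
    have e : c = 1 - x • (Z * c) := by
      rw [← hcu, add_mul, one_mul, smul_mul_assoc]; abel
    have h1 : ‖x • (Z * c)‖ ≤ 1 / 2 * ‖c‖ := by
      rw [norm_smul, Real.norm_of_nonneg hx.1]
      calc x * ‖Z * c‖ ≤ 1 * (‖Z‖ * ‖c‖) := by
            gcongr
            · exact hx.2
            · exact norm_mul_le _ _
        _ ≤ 1 / 2 * ‖c‖ := by rw [one_mul]; gcongr
    have h2 : ‖c‖ ≤ ‖(1 : B)‖ + 1 / 2 * ‖c‖ := by
      calc ‖c‖ = ‖1 - x • (Z * c)‖ := by rw [← e]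
        _ ≤ ‖(1 : B)‖ + ‖x • (Z * c)‖ := norm_sub_le _ _
        _ ≤ _ := by gcongr
    linarith
  set f : ℝ → B := fun s => U s * c with hf
  have hfc : ContinuousOn f (Icc 0 T) := P.left.continuousOn.mul continuousOn_const
  have hfp : ∀ t ∈ Icc 0 T, y • ∫ r in (0 : ℝ)..t, h r * f r = f t - c := by
    intro t ht
    have hp := (P.left.mul (IsPrimitive.const hT c)).eq t ht
    simp only [P.left_zero, one_mul, mul_zero, add_zero] at hp
    rw [hf]
    simp only
    rw [hp, add_sub_cancel_left, ← intervalIntegral.integral_smul]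
    simp only [smul_mul_assoc, mul_assoc]
  have hfe : ∀ s ∈ Icc 0 T, f s = 1 + y • ((∫ r in (0 : ℝ)..s, h r * f r) -
      x • ∫ r in (0 : ℝ)..T, h r * f r) := by
    intro s hs
    rw [smul_sub, smul_comm y x, hfp s hs, hfp T hT']
    have : c + x • (f T - c) = 1 := by
      rw [← hcu, hf, add_mul, one_mul, smul_mul_assoc, hZdef, sub_mul, one_mul]
    rw [← this]; abel
  have hfC : ∀ s ∈ Icc 0 T, ‖f s‖ ≤ C * (2 * ‖(1 : B)‖) := by
    intro s hs
    refine (norm_mul_le _ _).trans ?_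
    gcongr
    exact hC s hs
  have hrem := norm_cascadeRem_le hT hh hx hfc hfe hfC M
  have e : logIntegrand Z x - ∑ n ∈ Finset.range M, y ^ (n + 1) • cascadeCoeff h T x n =
      y • ∫ r in (0 : ℝ)..T, h r * cascadeRem h T x y f M r := by
    rw [integral_mul_cascadeRem hT hh hfc M hT', smul_sub, hfp T hT', Finset.smul_sum]
    simp only [smul_smul, ← pow_succ', cascadeCoeff, logIntegrand, ← hc]
    rw [hf, hZdef, sub_mul, one_mul]
  rw [e, norm_smul]
  have hb := norm_integral_mul_le hh hrem hT'
  have hκ : 0 ≤ ∫ r in (0 : ℝ)..T, ‖h r‖ :=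
    intervalIntegral.integral_nonneg hT fun _ _ => norm_nonneg _
  set κ := ∫ r in (0 : ℝ)..T, ‖h r‖
  calc _ ≤ ‖y‖ * (κ * ((‖y‖ * (2 * κ)) ^ M * (C * (2 * ‖(1 : B)‖)))) := by gcongr
    _ ≤ ‖y‖ * (2 * κ * ((‖y‖ * (2 * κ)) ^ M * (C * (2 * ‖(1 : B)‖)))) := by
        gcongr; linarith
    _ = _ := by ring

theorem tendsto_coupledExp (hT : 0 ≤ T) (hh : IntervalIntegrable h volume 0 T) :
    Tendsto (fun y => coupledExp h y T) (𝓝 0) (𝓝 1) := by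
  have := (hasDerivAt_coupledExp hT hh 0).continuousAt.tendsto
  rwa [coupledExp_zero_coupling hT hh] at this

/-- Expansion of the logarithm of the propagator in powers of the coupling. -/
theorem log_coupledExp_isBigO (hT : 0 ≤ T) (hh : IntervalIntegrable h volume 0 T) (M : ℕ) :
    (fun y : ℂ => (∫ x in (0 : ℝ)..1, logIntegrand (coupledExp h y T - 1) x) -
      ∑ n ∈ Finset.range M, y ^ (n + 1) • logCoeff h T n) =O[𝓝 0] fun y => y ^ (M + 1) := by
  have := FiniteDimensional.complete ℂ B
  have hκ : 0 ≤ ∫ r in (0 : ℝ)..T, ‖h r‖ :=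
    intervalIntegral.integral_nonneg hT fun _ _ => norm_nonneg _
  set κ := ∫ r in (0 : ℝ)..T, ‖h r‖
  set C := ‖(1 : B)‖ * Real.exp (1 * κ)
  refine Asymptotics.IsBigO.of_bound ((2 * κ) ^ (M + 1) * (C * (2 * ‖(1 : B)‖))) ?_
  have h1 : ∀ᶠ y : ℂ in 𝓝 0, ‖y‖ < 1 := by
    have := (continuous_norm (E := ℂ)).tendsto 0
    rw [norm_zero] at this
    exact this.eventually (gt_mem_nhds one_pos)
  have h2 : ∀ᶠ y : ℂ in 𝓝 0, ‖coupledExp h y T - 1‖ < 1 / 2 := by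
    have := ((tendsto_coupledExp hT hh).sub_const 1).norm
    simp only [sub_self, norm_zero] at this
    exact this.eventually (gt_mem_nhds (by norm_num))
  filter_upwards [h1, h2] with y hy1 hy2
  have hi : ContinuousOn (logIntegrand (coupledExp h y T - 1)) (uIcc 0 1) := by
    intro x hx
    rw [uIcc_of_le zero_le_one] at hx
    exact (continuousAt_logIntegrand hy2
      ⟨by linarith [hx.1], by linarith [hx.2]⟩).continuousWithinAt
  have i2 : ∀ n ∈ Finset.range M,
      IntervalIntegrable (fun x => y ^ (n + 1) • cascadeCoeff h T x n) volume 0 1 := fun n _ =>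
    ((continuous_cascadeCoeff hT hh n).intervalIntegrable 0 1).smul (y ^ (n + 1))
  have e : (∫ x in (0 : ℝ)..1, logIntegrand (coupledExp h y T - 1) x) -
      ∑ n ∈ Finset.range M, y ^ (n + 1) • logCoeff h T n =
      ∫ x in (0 : ℝ)..1, (logIntegrand (coupledExp h y T - 1) x -
        ∑ n ∈ Finset.range M, y ^ (n + 1) • cascadeCoeff h T x n) := by
    rw [intervalIntegral.integral_sub hi.intervalIntegrable (by
      have := IntervalIntegrable.sum (Finset.range M) i2
      simpa only [Finset.sum_fn] using this), intervalIntegral.integral_finsetSum i2]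
    simp_rw [intervalIntegral.integral_smul, logCoeff]
  rw [e]
  have := intervalIntegral.norm_integral_le_of_norm_le_const (a := 0) (b := 1)
    (C := (‖y‖ * (2 * κ)) ^ (M + 1) * (C * (2 * ‖(1 : B)‖)))
    (f := fun x => logIntegrand (coupledExp h y T - 1) x -
        ∑ n ∈ Finset.range M, y ^ (n + 1) • cascadeCoeff h T x n) (fun x hx => by
      rw [uIoc_of_le zero_le_one] at hx
      refine logIntegrand_expansion hT hh (isPropagator_coupledExp hT hh y) hy2 (fun s hs => ?_)
        ⟨hx.1.le, hx.2⟩ M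
      refine (norm_coupledExp_le hT hh y hs).trans ?_
      have := hy1.le
      change ‖(1 : B)‖ * Real.exp (‖y‖ * κ) ≤ ‖(1 : B)‖ * Real.exp (1 * κ)
      gcongr)
  refine this.trans (le_of_eq ?_)
  rw [norm_pow, mul_pow]
  norm_num
  ring

end Cascade

/-! ### Integrals over the cube, its simplices and ascents -/

section Cube

/-- Lebesgue measure on the cube `(0, T]^{n+1}`. -/
def cube (n : ℕ) (T : ℝ) : Measure (Fin (n + 1) → ℝ) :=
  Measure.pi fun _ => volume.restrict (Ioc 0 T)

instance (n : ℕ) (T : ℝ) : IsFiniteMeasure (cube n T) := by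
  unfold cube; infer_instance

theorem cube_eq_restrict (n : ℕ) (T : ℝ) :
    cube n T = volume.restrict (Set.pi univ fun _ => Ioc 0 T) := by
  rw [cube, volume_pi, Measure.restrict_pi_pi]

theorem volume_coord_eq {m : ℕ} {i j : Fin m} (hij : i ≠ j) :
    volume {t : Fin m → ℝ | t i = t j} = 0 := by
  let S : Submodule ℝ (Fin m → ℝ) :=
    LinearMap.ker (LinearMap.proj (R := ℝ) (φ := fun _ => ℝ) i - LinearMap.proj j)
  have hS : S ≠ ⊤ := by
    intro h
    have : Pi.single i (1 : ℝ) ∈ S := h ▸ Submodule.mem_top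
    simp [S, LinearMap.mem_ker, hij.symm] at this
  have := Measure.addHaar_submodule volume S hS
  convert this using 2
  ext t; simp [S, LinearMap.mem_ker, sub_eq_zero]

theorem volume_coord_eq_zero {m : ℕ} (i : Fin m) :
    volume {t : Fin m → ℝ | t i = 0} = 0 := by
  let S : Submodule ℝ (Fin m → ℝ) := LinearMap.ker (LinearMap.proj (R := ℝ) (φ := fun _ => ℝ) i)
  have hS : S ≠ ⊤ := by
    intro h
    have : Pi.single i (1 : ℝ) ∈ S := h ▸ Submodule.mem_top
    simp [S, LinearMap.mem_ker] at this
  exact Measure.addHaar_submodule volume S hS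

theorem ae_injective (m : ℕ) : ∀ᵐ t : Fin m → ℝ, Function.Injective t := by
  have : ∀ᵐ t : Fin m → ℝ, ∀ i j, i ≠ j → t i ≠ t j := by
    rw [ae_all_iff]; intro i
    rw [ae_all_iff]; intro j
    by_cases h : i = j
    · exact Eventually.of_forall fun t h' => absurd h h'
    · filter_upwards [(measure_eq_zero_iff_ae_notMem (μ := volume)).1 (volume_coord_eq h)]
        with t ht _ using ht
  filter_upwards [this] with t ht i j hij
  by_contra h
  exact ht i j h hij

theorem ae_ne_zero (m : ℕ) : ∀ᵐ t : Fin m → ℝ, ∀ i, t i ≠ 0 := by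
  rw [ae_all_iff]; intro i
  filter_upwards [(measure_eq_zero_iff_ae_notMem (μ := volume)).1 (volume_coord_eq_zero i)]
    with t ht using ht

theorem measurableSet_strictMono (m : ℕ) : MeasurableSet {t : Fin m → ℝ | StrictMono t} := by
  have : {t : Fin m → ℝ | StrictMono t} = ⋂ i, ⋂ j, ⋂ (_ : i < j), {t | t i < t j} := by
    ext t; simp [StrictMono]
  rw [this]
  exact MeasurableSet.iInter fun i => MeasurableSet.iInter fun j => MeasurableSet.iInter fun _ =>
    measurableSet_lt (measurable_pi_apply i) (measurable_pi_apply j)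

variable {E : Type*} [NormedAddCommGroup E] [NormedSpace ℝ E]

/-- Ties between coordinates and vanishing coordinates lie in hyperplanes, hence form null sets.
Monotone may therefore become strictly monotone and `[0, T]` may become `(0, T]`. -/
theorem setIntegral_orderedSimplex (n : ℕ) (T : ℝ) (f : (Fin (n + 1) → ℝ) → E) :
    ∫ t in orderedSimplex n T, f t = ∫ t in {t | StrictMono t}, f t ∂(cube n T) := by
  rw [cube_eq_restrict, Measure.restrict_restrict (measurableSet_strictMono _)]
  refine setIntegral_congr_set ?_
  filter_upwards [ae_injective (n + 1), ae_ne_zero (n + 1)] with t h1 h2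
  refine propext ⟨fun h => ⟨h.1.strictMono_of_injective h1, fun i _ =>
    ⟨lt_of_le_of_ne (h.2 i).1 (h2 i).symm, (h.2 i).2⟩⟩, fun h => ⟨?_, fun i => ?_⟩⟩
  · exact StrictMono.monotone h.1
  · exact ⟨(h.2 i (mem_univ i)).1.le, (h.2 i (mem_univ i)).2⟩

theorem measurePreserving_comp_perm (n : ℕ) (T : ℝ) (σ : Equiv.Perm (Fin (n + 1))) :
    MeasurePreserving (fun t : Fin (n + 1) → ℝ => t ∘ σ) (cube n T) (cube n T) := by
  have := measurePreserving_piCongrLeft (fun _ : Fin (n + 1) => volume.restrict (Ioc 0 T)) σ.symm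
  have e : (fun t : Fin (n + 1) → ℝ => t ∘ σ) =
      MeasurableEquiv.piCongrLeft (fun _ => ℝ) σ.symm := by
    ext t i
    have := MeasurableEquiv.piCongrLeft_apply_apply (β := fun _ => ℝ) σ.symm t (σ i)
    simp only [Equiv.symm_apply_apply] at this
    exact this.symm
  rw [e]
  exact this

theorem integral_strictMono_perm (n : ℕ) (T : ℝ) (σ : Equiv.Perm (Fin (n + 1)))
    (f : (Fin (n + 1) → ℝ) → E) :
    ∫ t in {t | StrictMono t}, f (t ∘ σ) ∂(cube n T) =
      ∫ t in {t | StrictMono (t ∘ σ.symm)}, f t ∂(cube n T) := by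
  have hm := measurePreserving_comp_perm n T σ
  have hemb : MeasurableEmbedding (fun t : Fin (n + 1) → ℝ => t ∘ σ) := by
    have := (MeasurableEquiv.piCongrLeft (fun _ => ℝ) σ.symm).measurableEmbedding
    convert this using 1
    ext t i
    have := MeasurableEquiv.piCongrLeft_apply_apply (β := fun _ => ℝ) σ.symm t (σ i)
    simp only [Equiv.symm_apply_apply] at this
    exact this.symm
  rw [← hm.setIntegral_preimage_emb hemb f {t | StrictMono (t ∘ σ.symm)}]
  congr 2
  ext t
  simp [Function.comp_assoc]

/-- Distinct times are ordered by exactly one permutation, so almost every point of the cube lies in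
exactly one permuted simplex. -/
theorem exists_unique_sort {m : ℕ} {t : Fin m → ℝ} (ht : Function.Injective t) :
    ∃ σ : Equiv.Perm (Fin m), ∀ τ : Equiv.Perm (Fin m), StrictMono (t ∘ τ.symm) ↔ τ = σ := by
  refine ⟨(Tuple.sort t).symm, fun τ => ⟨fun h => ?_, ?_⟩⟩
  · have := Tuple.unique_monotone h.monotone (Tuple.monotone_sort t)
    have : ∀ i, τ.symm i = Tuple.sort t i := fun i => ht (congrFun this i)
    rw [← Equiv.symm_symm τ, Equiv.ext this]
  · rintro rfl
    exact (Tuple.monotone_sort t).strictMono_of_injective (ht.comp (Equiv.injective _))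

/-- Decomposition of an integral over the cube into integrals over simplices. -/
theorem integral_cube_eq_sum (n : ℕ) (T : ℝ) {g : (Fin (n + 1) → ℝ) → E}
    (hg : Integrable g (cube n T)) :
    ∫ t, g t ∂(cube n T) = ∑ σ : Equiv.Perm (Fin (n + 1)),
      ∫ t in {t | StrictMono (t ∘ σ.symm)}, g t ∂(cube n T) := by
  have hms : ∀ σ : Equiv.Perm (Fin (n + 1)),
      MeasurableSet {t : Fin (n + 1) → ℝ | StrictMono (t ∘ σ.symm)} := fun σ =>
    (measurePreserving_comp_perm n T σ.symm).measurable (measurableSet_strictMono _)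
  have hae : ∀ᵐ t ∂(cube n T), Function.Injective t := by
    rw [cube_eq_restrict]; exact ae_restrict_of_ae (ae_injective _)
  simp_rw [← integral_indicator (hms _)]
  rw [← integral_finsetSum _ (fun σ _ => hg.indicator (hms σ))]
  refine integral_congr_ae ?_
  filter_upwards [hae] with t ht
  obtain ⟨σ, hσ⟩ := exists_unique_sort ht
  rw [Finset.sum_eq_single σ]
  · rw [indicator_of_mem]
    exact (hσ σ).2 rfl
  · intro τ _ hτ
    rw [indicator_of_notMem]
    exact fun h => hτ ((hσ τ).1 h)
  · simp

/-- The number of ascents of a sequence of times. -/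
def ascCount {n : ℕ} (t : Fin (n + 1) → ℝ) : ℕ :=
  (Finset.univ.filter fun i : Fin n => t i.castSucc < t i.succ).card

theorem ascCount_comp {n : ℕ} {t : Fin (n + 1) → ℝ} (ht : StrictMono t)
    (σ : Equiv.Perm (Fin (n + 1))) : ascCount (t ∘ σ) = ascents σ := by
  simp [ascCount, ascents, ht.lt_iff_lt]

theorem ascCount_le {n : ℕ} (t : Fin (n + 1) → ℝ) : ascCount t ≤ n := by
  unfold ascCount
  simpa using Finset.card_filter_le (Finset.univ : Finset (Fin n)) fun i => t i.castSucc < t i.succ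

/-- The weight of a sequence of `n + 1` times with `a` ascents. -/
def ascWeight (n a : ℕ) : ℝ :=
  (-1) ^ (n - a) * ((a.factorial * (n - a).factorial : ℕ) : ℝ) / (n.factorial : ℝ)

theorem abs_ascWeight_le {n a : ℕ} (h : a ≤ n) : |ascWeight n a| ≤ 1 := by
  rw [ascWeight, abs_div, abs_mul, abs_pow, abs_neg, abs_one, one_pow, one_mul, Nat.abs_cast,
    Nat.abs_cast, div_le_one (by positivity)]
  exact_mod_cast Nat.le_of_dvd (Nat.factorial_pos n) (Nat.factorial_mul_factorial_dvd_factorial h)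

theorem measurable_ascCount (n : ℕ) : Measurable (ascCount (n := n)) := by
  have : ascCount (n := n) = fun t => ∑ i : Fin n, if t i.castSucc < t i.succ then 1 else 0 := by
    funext t; simp [ascCount]
  rw [this]
  refine Finset.measurable_sum _ fun i _ => ?_
  exact Measurable.ite (measurableSet_lt (measurable_pi_apply _) (measurable_pi_apply _))
    measurable_const measurable_const

theorem integrable_bdd_smul {α : Type*} [MeasurableSpace α] {μ : Measure α} {f : α → E}
    (hf : Integrable f μ) {φ : α → ℝ} (hφ : AEStronglyMeasurable φ μ) {C : ℝ}
    (hC : ∀ᵐ a ∂μ, |φ a| ≤ C) : Integrable (fun a => φ a • f a) μ :=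
  hf.bdd_smul C hφ hC

theorem integrable_ascWeight_smul {n : ℕ} {T : ℝ} {f : (Fin (n + 1) → ℝ) → E}
    (hf : Integrable f (cube n T)) :
    Integrable (fun t => ascWeight n (ascCount t) • f t) (cube n T) := by
  refine integrable_bdd_smul hf (C := 1) ?_
    (Eventually.of_forall fun t => abs_ascWeight_le (ascCount_le t))
  exact ((measurable_from_nat (f := ascWeight n)).comp
    (measurable_ascCount n)).aestronglyMeasurable

/-- The sum over permutations of weighted integrals over the simplex is one integral over the
cube. -/
theorem sum_perm_integral_orderedSimplex {n : ℕ} {T : ℝ} {f : (Fin (n + 1) → ℝ) → E}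
    (hf : Integrable f (cube n T)) :
    ∑ σ : Equiv.Perm (Fin (n + 1)), ascWeight n (ascents σ) •
      ∫ t in orderedSimplex n T, f (t ∘ σ) =
    ∫ t, ascWeight n (ascCount t) • f t ∂(cube n T) := by
  rw [integral_cube_eq_sum n T (integrable_ascWeight_smul hf)]
  refine Finset.sum_congr rfl fun σ _ => ?_
  rw [← integral_strictMono_perm n T σ (fun t => ascWeight n (ascCount t) • f t),
    setIntegral_orderedSimplex, ← integral_smul]
  refine setIntegral_congr_fun (measurableSet_strictMono _) fun t ht => ?_
  simp only [ascCount_comp ht]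

theorem piFinSuccAbove_last_apply (n : ℕ) (t : Fin (n + 2) → ℝ) :
    MeasurableEquiv.piFinSuccAbove (fun _ => ℝ) (Fin.last (n + 1)) t =
      (t (Fin.last (n + 1)), fun j => t j.castSucc) := by
  refine Prod.ext rfl ?_
  funext j
  simp [MeasurableEquiv.piFinSuccAbove, Fin.init]

/-- Splitting off the last coordinate. -/
theorem integral_cube_succ (n : ℕ) (T : ℝ) {f : (Fin (n + 2) → ℝ) → E}
    {g : ℝ × (Fin (n + 1) → ℝ) → E}
    (hfg : ∀ t, f t = g (t (Fin.last (n + 1)), fun j => t j.castSucc)) :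
    ∫ t, f t ∂(cube (n + 1) T) = ∫ z, g z ∂((volume.restrict (Ioc 0 T)).prod (cube n T)) := by
  have hmp := measurePreserving_piFinSuccAbove
    (fun _ : Fin (n + 2) => (volume : Measure ℝ).restrict (Ioc 0 T)) (Fin.last (n + 1))
  have := hmp.integral_comp' (f := MeasurableEquiv.piFinSuccAbove (fun _ => ℝ) (Fin.last (n + 1))) g
  refine Eq.trans ?_ this
  refine integral_congr_ae (Eventually.of_forall fun t => ?_)
  simp only [hfg]
  rw [piFinSuccAbove_last_apply]

theorem integrable_cube_succ (n : ℕ) (T : ℝ) {f : (Fin (n + 2) → ℝ) → E}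
    {g : ℝ × (Fin (n + 1) → ℝ) → E}
    (hfg : ∀ t, f t = g (t (Fin.last (n + 1)), fun j => t j.castSucc))
    (hg : Integrable g ((volume.restrict (Ioc 0 T)).prod (cube n T))) :
    Integrable f (cube (n + 1) T) := by
  have hmp := measurePreserving_piFinSuccAbove
    (fun _ : Fin (n + 2) => (volume : Measure ℝ).restrict (Ioc 0 T)) (Fin.last (n + 1))
  have := (hmp.integrable_comp_emb (MeasurableEquiv.measurableEmbedding _)).2 hg
  refine this.congr (Eventually.of_forall fun t => ?_)
  simp only [hfg, Function.comp_apply]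
  rw [piFinSuccAbove_last_apply]

theorem measurePreserving_cube_zero (T : ℝ) :
    MeasurePreserving (fun t : Fin 1 → ℝ => t 0) (cube 0 T) (volume.restrict (Ioc 0 T)) :=
  measurePreserving_piUnique (fun _ : Fin 1 => (volume : Measure ℝ).restrict (Ioc 0 T))

theorem integral_cube_zero (T : ℝ) (f : ℝ → E) :
    ∫ t, f (t 0) ∂(cube 0 T) = ∫ r, f r ∂(volume.restrict (Ioc 0 T)) :=
  (measurePreserving_piUnique
    (fun _ : Fin 1 => (volume : Measure ℝ).restrict (Ioc 0 T))).integral_comp' f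

theorem integrable_cube_zero {T : ℝ} {f : ℝ → E} (hf : Integrable f (volume.restrict (Ioc 0 T))) :
    Integrable (fun t => f (t 0)) (cube 0 T) :=
  (measurePreserving_cube_zero T).integrable_comp_of_integrable hf

end Cube

/-! ### The Beta integral behind the Magnus weights -/

section Weights

/-- Integration by parts moves one power from `1 - x` to `x`; hence the induction on `a` with `b`
free. -/
theorem integral_pow_mul_one_sub_pow (a b : ℕ) :
    ∫ x in (0 : ℝ)..1, x ^ b * (1 - x) ^ a =
      (a.factorial * b.factorial : ℝ) / (a + b + 1).factorial := by
  induction a generalizing b with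
  | zero =>
    simp only [pow_zero, mul_one, integral_pow, Nat.factorial_zero, zero_add, Nat.factorial_succ]
    have : (b.factorial : ℝ) ≠ 0 := by positivity
    have : (b : ℝ) + 1 ≠ 0 := by positivity
    push_cast
    field_simp
    simp
  | succ a ih =>
    have hd : ∀ x : ℝ, HasDerivAt (fun x : ℝ => x ^ (b + 1) * (1 - x) ^ (a + 1))
        ((b + 1) * (x ^ b * (1 - x) ^ (a + 1)) - (a + 1) * (x ^ (b + 1) * (1 - x) ^ a)) x := by
      intro x
      have h1 := hasDerivAt_pow (b + 1) x
      have h2 := ((hasDerivAt_id x).const_sub 1).pow (a + 1)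
      refine (h1.mul h2).congr_deriv ?_
      simp only [id, Nat.add_sub_cancel]
      push_cast
      simp only [Pi.pow_apply]
      ring
    have hI := intervalIntegral.integral_eq_sub_of_hasDerivAt (a := 0) (b := 1) (fun x _ => hd x)
      (Continuous.intervalIntegrable (by fun_prop) _ _)
    rw [intervalIntegral.integral_sub (Continuous.intervalIntegrable (by fun_prop) _ _)
      (Continuous.intervalIntegrable (by fun_prop) _ _), intervalIntegral.integral_const_mul,
      intervalIntegral.integral_const_mul, ih (b + 1)] at hI
    have e : a + (b + 1) + 1 = a + 1 + b + 1 := by ring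
    rw [e] at hI
    simp only [one_pow, sub_self, ne_eq, Nat.add_eq_zero_iff, one_ne_zero, and_false,
      not_false_eq_true, zero_pow, mul_zero, zero_mul, sub_zero, Nat.factorial_succ b] at hI
    rw [Nat.factorial_succ a]
    have h0 : ((a + 1 + b + 1).factorial : ℝ) ≠ 0 := by positivity
    have h1 : (b : ℝ) + 1 ≠ 0 := by positivity
    push_cast at hI ⊢
    have h2 : (∫ (x : ℝ) in 0..1, x ^ b * (1 - x) ^ (a + 1)) =
        ((a : ℝ) + 1) * (a.factorial * ((b + 1) * b.factorial) / (a + 1 + b + 1).factorial)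
          / (b + 1) := by
      rw [eq_div_iff h1]; linarith
    rw [h2]
    field_simp

/-- The product over neighbouring times of `1_{t_i < t_{i+1}} - x`. -/
def chainWeight (x : ℝ) (n : ℕ) (t : Fin (n + 1) → ℝ) : ℝ :=
  ∏ i : Fin n, ((if t i.castSucc < t i.succ then 1 else 0) - x)

/-- An ascent contributes `1 - x` and every other neighbouring pair `-x`, so only the number of
ascents matters. -/
theorem chainWeight_eq (x : ℝ) (n : ℕ) (t : Fin (n + 1) → ℝ) :
    chainWeight x n t = (1 - x) ^ ascCount t * (-x) ^ (n - ascCount t) := by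
  have h1 : ∀ i : Fin n, ((if t i.castSucc < t i.succ then (1 : ℝ) else 0) - x) =
      if t i.castSucc < t i.succ then 1 - x else -x := by
    intro i; split_ifs <;> simp
  have h2 : (Finset.univ.filter fun i : Fin n => ¬ t i.castSucc < t i.succ).card =
      n - ascCount t := by
    have := Finset.card_filter_add_card_filter_not (s := (Finset.univ : Finset (Fin n)))
      (fun i : Fin n => t i.castSucc < t i.succ)
    simp only [Finset.card_univ, Fintype.card_fin] at this
    unfold ascCount
    omega
  simp only [chainWeight, h1, Finset.prod_ite, Finset.prod_const, h2]
  rfl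

/-- The Beta integral has denominator `(n+1)!`; writing it as `(n+1) n!` leaves the ascent weight
and a factor `1/(n+1)`. -/
theorem integral_chainWeight (n : ℕ) (t : Fin (n + 1) → ℝ) :
    ∫ x in (0 : ℝ)..1, chainWeight x n t = ascWeight n (ascCount t) / (n + 1) := by
  have h : ascCount t ≤ n := ascCount_le t
  have e : ∀ x : ℝ, chainWeight x n t =
      (-1) ^ (n - ascCount t) * (x ^ (n - ascCount t) * (1 - x) ^ ascCount t) := by
    intro x; rw [chainWeight_eq, neg_pow]; ring
  simp_rw [e]
  rw [intervalIntegral.integral_const_mul, integral_pow_mul_one_sub_pow, ascWeight]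
  have : ascCount t + (n - ascCount t) = n := by omega
  rw [this, Nat.factorial_succ]
  have : (n.factorial : ℝ) ≠ 0 := by positivity
  have : (n : ℝ) + 1 ≠ 0 := by positivity
  push_cast
  field_simp

theorem abs_chainWeight_le {x : ℝ} (hx : x ∈ Icc (0 : ℝ) 1) (n : ℕ) (t : Fin (n + 1) → ℝ) :
    |chainWeight x n t| ≤ 1 := by
  rw [chainWeight, Finset.abs_prod]
  refine Finset.prod_le_one (fun i _ => abs_nonneg _) fun i _ => ?_
  rw [abs_le]
  split_ifs
  · exact ⟨by linarith [hx.2], by linarith [hx.1]⟩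
  · exact ⟨by linarith [hx.2], by linarith [hx.1]⟩

theorem chainWeight_succ (x : ℝ) (n : ℕ) (t : Fin (n + 2) → ℝ) :
    chainWeight x (n + 1) t = chainWeight x n (fun j => t j.castSucc) *
      ((if t (Fin.last n).castSucc < t (Fin.last (n + 1)) then 1 else 0) - x) := by
  rw [chainWeight, Fin.prod_univ_castSucc]
  rfl

theorem measurable_chainWeight (n : ℕ) :
    Measurable fun z : ℝ × (Fin (n + 1) → ℝ) => chainWeight z.1 n z.2 := by
  unfold chainWeight
  refine Finset.measurable_prod _ fun i _ => ?_
  refine Measurable.sub (Measurable.ite (measurableSet_lt ?_ ?_) measurable_const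
    measurable_const) measurable_fst
  · exact (measurable_pi_apply _).comp measurable_snd
  · exact (measurable_pi_apply _).comp measurable_snd

end Weights

/-! ### Logarithm coefficients as weighted integrals of words -/

section Words

variable {B : Type*} [NormedRing B] [NormedAlgebra ℂ B] [FiniteDimensional ℂ B] {T : ℝ}

/-- The word `h(t_n) ⋯ h(t_1) h(t_0)`. -/
def timeWord (h : ℝ → B) : (n : ℕ) → (Fin (n + 1) → ℝ) → B
  | 0, t => h (t 0)
  | n + 1, t => h (t (Fin.last (n + 1))) * timeWord h n (fun j => t j.castSucc)

variable {h : ℝ → B}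

theorem integrable_timeWord (hh : Integrable h (volume.restrict (Ioc 0 T))) (n : ℕ) :
    Integrable (timeWord h n) (cube n T) := by
  induction n with
  | zero => exact integrable_cube_zero hh
  | succ n ih =>
    exact integrable_cube_succ n T (g := fun z => h z.1 * timeWord h n z.2) (fun t => rfl)
      (hh.mul_prod ih)

theorem exists_abs_chainWeight_le (x : ℝ) (n : ℕ) : ∃ C, ∀ t, |chainWeight x n t| ≤ C := by
  refine ⟨(1 + |x|) ^ n, fun t => ?_⟩
  rw [chainWeight, Finset.abs_prod]
  have : ∏ _i : Fin n, (1 + |x|) = (1 + |x|) ^ n := by simp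
  rw [← this]
  refine Finset.prod_le_prod (fun i _ => abs_nonneg _) fun i _ => ?_
  refine (abs_sub _ _).trans ?_
  gcongr
  split_ifs <;> simp

/-- Fubini in the last time unfolds the cascade. The test function `θ` of the last time carries the
induction: the next link `1_{u<r} - x` is itself such a function of the last time `u` of the shorter
word. -/
theorem integral_chainWeight_timeWord (hT : 0 ≤ T) (hh : IntervalIntegrable h volume 0 T) (x : ℝ)
    (n : ℕ) {θ : ℝ → ℝ} (hθ : Measurable θ) {C : ℝ} (hC : ∀ u, |θ u| ≤ C) :
    ∫ t, (θ (t (Fin.last n)) * chainWeight x n t) • timeWord h n t ∂(cube n T) =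
      ∫ r in (0 : ℝ)..T, θ r • (h r * cascade h T x n r) := by
  have := FiniteDimensional.complete ℂ B
  have hh' : Integrable h (volume.restrict (Ioc 0 T)) := hh.1
  induction n generalizing θ C with
  | zero =>
    rw [intervalIntegral.integral_of_le hT, ← integral_cube_zero]
    simp [chainWeight, timeWord, cascade]
  | succ n ih =>
    have hw := integrable_timeWord hh' n
    obtain ⟨C', hC'⟩ := exists_abs_chainWeight_le x n
    set θ' : ℝ → ℝ → ℝ := fun r u => (if u < r then 1 else 0) - x with hθ'
    have hθ'C : ∀ r u, |θ' r u| ≤ 1 + |x| := by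
      intro r u
      refine (abs_sub _ _).trans ?_
      gcongr
      split_ifs <;> simp
    have hθ'm : ∀ r, Measurable (θ' r) := fun r =>
      (Measurable.ite measurableSet_Iio measurable_const measurable_const).sub_const x
    have hjm : Measurable fun z : ℝ × (Fin (n + 1) → ℝ) =>
        θ z.1 * (chainWeight x n z.2 * θ' z.1 (z.2 (Fin.last n))) := by
      refine (hθ.comp measurable_fst).mul (Measurable.mul ?_ ?_)
      · exact (measurable_chainWeight n).comp (measurable_const.prodMk measurable_snd)
      · refine (Measurable.ite (measurableSet_lt ?_ measurable_fst) measurable_const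
          measurable_const).sub_const x
        exact (measurable_pi_apply _).comp measurable_snd
    have h_int : Integrable (fun z : ℝ × (Fin (n + 1) → ℝ) =>
        (θ z.1 * (chainWeight x n z.2 * θ' z.1 (z.2 (Fin.last n)))) • (h z.1 * timeWord h n z.2))
        ((volume.restrict (Ioc 0 T)).prod (cube n T)) := by
      refine integrable_bdd_smul (hh'.mul_prod hw) (C := C * (C' * (1 + |x|)))
        hjm.aestronglyMeasurable
        (Eventually.of_forall fun z => ?_)
      rw [abs_mul, abs_mul]
      have := hC z.1; have := hC' z.2; have := hθ'C z.1 (z.2 (Fin.last n))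
      have : 0 ≤ C := (abs_nonneg _).trans (hC z.1)
      have : 0 ≤ C' := (abs_nonneg _).trans (hC' z.2)
      gcongr
    rw [integral_cube_succ n T (g := fun z => (θ z.1 * (chainWeight x n z.2 *
      θ' z.1 (z.2 (Fin.last n)))) • (h z.1 * timeWord h n z.2)) (fun t => by
        simp only [chainWeight_succ, timeWord, hθ']), integral_prod _ h_int,
      intervalIntegral.integral_of_le hT]
    refine integral_congr_ae ?_
    filter_upwards [ae_restrict_mem measurableSet_Ioc] with r hr
    have e1 : ∀ t : Fin (n + 1) → ℝ, (θ r * (chainWeight x n t * θ' r (t (Fin.last n)))) •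
        (h r * timeWord h n t) =
        θ r • (h r * ((θ' r (t (Fin.last n)) * chainWeight x n t) • timeWord h n t)) := by
      intro t
      rw [mul_smul_comm, smul_smul, mul_comm (chainWeight x n t)]
    simp only [e1]
    rw [integral_smul, integral_const_mul_of_integrable, ih (hθ'm r) (hθ'C r)]
    · congr 2
      have hi := integrable_mul_cascade hT hh x n
      have e2 : ∀ u, θ' r u • (h u * cascade h T x n u) =
          (Iio r).indicator (fun u => h u * cascade h T x n u) u -
            x • (h u * cascade h T x n u) := by
        intro u
        simp only [hθ', indicator, mem_Iio, sub_smul]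
        split_ifs <;> simp
      simp only [e2]
      have hi' : IntegrableOn (fun u => x • (h u * cascade h T x n u)) (Ioc 0 T) := hi.1.smul x
      rw [intervalIntegral.integral_of_le hT, integral_sub (hi.1.indicator measurableSet_Iio)
        hi', integral_smul, integral_indicator measurableSet_Iio,
        Measure.restrict_restrict measurableSet_Iio, cascade,
        intervalIntegral.integral_of_le hr.1.le, intervalIntegral.integral_of_le hT,
        integral_Ioc_eq_integral_Ioo (x := (0 : ℝ)) (y := r)]
      congr 3
      ext u; simp only [mem_inter_iff, mem_Iio, mem_Ioc, mem_Ioo]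
      exact ⟨fun h => ⟨h.2.1, h.1⟩, fun h => ⟨h.2, h.1, h.2.le.trans hr.2⟩⟩
    · refine integrable_bdd_smul hw (C := (1 + |x|) * C') ?_ (Eventually.of_forall fun t => ?_)
      · refine
          (Measurable.mul ((hθ'm r).comp (measurable_pi_apply (Fin.last n))) ?_).aestronglyMeasurable
        exact (measurable_chainWeight n).comp (measurable_const.prodMk measurable_id)
      · rw [abs_mul]
        have := hC' t; have := hθ'C r (t (Fin.last n))
        gcongr

theorem cascadeCoeff_eq (hT : 0 ≤ T) (hh : IntervalIntegrable h volume 0 T) (x : ℝ) (n : ℕ) :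
    cascadeCoeff h T x n = ∫ t, chainWeight x n t • timeWord h n t ∂(cube n T) := by
  have := integral_chainWeight_timeWord hT hh x n (θ := fun _ => 1) measurable_const (C := 1)
    (fun _ => by simp)
  simpa [cascadeCoeff] using this.symm

/-- The coefficients of the logarithm as cube integrals of words. -/
theorem logCoeff_eq (hT : 0 ≤ T) (hh : IntervalIntegrable h volume 0 T) (n : ℕ) :
    logCoeff h T n = (1 / ((n : ℝ) + 1)) •
      ∫ t, ascWeight n (ascCount t) • timeWord h n t ∂(cube n T) := by
  have := FiniteDimensional.complete ℂ B
  have hh' : Integrable h (volume.restrict (Ioc 0 T)) := hh.1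
  have hw := integrable_timeWord hh' n
  have h_int : Integrable (Function.uncurry fun (x : ℝ) (t : Fin (n + 1) → ℝ) =>
      chainWeight x n t • timeWord h n t) ((volume.restrict (Ioc 0 1)).prod (cube n T)) := by
    have h1 : Integrable (fun z : ℝ × (Fin (n + 1) → ℝ) => timeWord h n z.2)
        ((volume.restrict (Ioc (0 : ℝ) 1)).prod (cube n T)) := hw.comp_snd _
    refine integrable_bdd_smul h1 (C := 1) (measurable_chainWeight n).aestronglyMeasurable ?_
    have : ∀ᵐ z ∂((volume.restrict (Ioc (0 : ℝ) 1)).prod (cube n T)), z.1 ∈ Ioc (0 : ℝ) 1 :=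
      Measure.quasiMeasurePreserving_fst.ae (ae_restrict_mem measurableSet_Ioc)
    filter_upwards [this] with z hz
    exact abs_chainWeight_le ⟨hz.1.le, hz.2⟩ n z.2
  rw [logCoeff, intervalIntegral.integral_of_le zero_le_one]
  simp_rw [cascadeCoeff_eq hT hh]
  rw [integral_integral_swap h_int, ← integral_smul]
  refine integral_congr_ae (Eventually.of_forall fun t => ?_)
  simp only
  rw [integral_smul_const, ← intervalIntegral.integral_of_le zero_le_one, integral_chainWeight,
    smul_smul]
  congr 1
  ring

end Words

/-! ### From words to multi-commutators -/

section MagnusCoeff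

variable {A : Type*} [NormedRing A] [NormedAlgebra ℂ A] [FiniteDimensional ℂ A] {T : ℝ}

/-- The `n`-th coefficient of the Magnus expansion for the generator `h(t)`. -/
def magnusCoeff (h : ℝ → A) (T : ℝ) (n : ℕ) : A :=
  (1 / ((n : ℝ) + 1) ^ 2) •
    ∫ t, ascWeight n (ascCount t) • multiCommutator n (fun j => h (t j)) ∂(cube n T)

/-- Starting from `(0, 1)`, the first generator creates `(h(t_0), 0)`. The scalar component is then
zero, so every later generator acts as a pure commutator. -/
theorem timeWord_blockGen_apply (h : ℝ → A) (n : ℕ) (t : Fin (n + 1) → ℝ) :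
    blockEval (0, 1) (timeWord (fun s => blockGen (h s, h s)) n t) =
      (multiCommutator n (fun j => h (t j)), 0) := by
  induction n with
  | zero => simp [timeWord, blockGen_apply, multiCommutator, Ring.lie_def]
  | succ n ih =>
    rw [timeWord, blockEval_mul, ih, ← blockGen_mul_multiCommutator]

theorem integrable_clm_pair {B : Type*} [NormedRing B] [NormedAlgebra ℂ B] (L : A × A →L[ℂ] B)
    {h : ℝ → A} (hh : IntervalIntegrable h volume 0 T) :
    IntervalIntegrable (fun s => L (h s, h s)) volume 0 T :=
  ⟨L.integrable_comp (Integrable.prodMk hh.1 hh.1), L.integrable_comp (Integrable.prodMk hh.2 hh.2)⟩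

theorem clm_smul_integral {B α : Type*} [NormedRing B] [NormedAlgebra ℂ B] [CompleteSpace B]
    [CompleteSpace A] [MeasurableSpace α] {μ : Measure α} (L : B →L[ℂ] A) (c : ℝ) (w : α → ℝ)
    {f : α → B} (hf : Integrable (fun t => w t • f t) μ) :
    L (c • ∫ t, w t • f t ∂μ) = c • ∫ t, w t • L (f t) ∂μ := by
  have h1 := (L.restrictScalars ℝ).integral_comp_comm hf
  simp only [map_smul, ContinuousLinearMap.coe_restrictScalars'] at h1
  have h2 := (L.restrictScalars ℝ).map_smul c (∫ t, w t • f t ∂μ)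
  simp only [ContinuousLinearMap.coe_restrictScalars'] at h2
  rw [h2, h1]

theorem integrable_blockGen {h : ℝ → A} (hh : IntervalIntegrable h volume 0 T) :
    IntervalIntegrable (fun s => blockGen (h s, h s)) volume 0 T :=
  integrable_clm_pair blockGen hh

theorem integrable_multiCommutator {h : ℝ → A} (hh : IntervalIntegrable h volume 0 T) (n : ℕ) :
    Integrable (fun t => multiCommutator n (fun j => h (t j))) (cube n T) := by
  have h1 := integrable_timeWord (integrable_blockGen hh).1 n
  have h2 :=
      ((ContinuousLinearMap.fst ℂ A ℂ).comp (blockEval ((0 : A), (1 : ℂ)))).integrable_comp h1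
  refine h2.congr (Eventually.of_forall fun t => ?_)
  simp [timeWord_blockGen_apply]

/-- The block logarithm carries `1/(n+1)` and the Magnus coefficient `1/(n+1)²`. The remaining `n+1`
is what `y d/dy` produces on the power `y^(n+1)`. -/
theorem logCoeff_blockGen_apply {h : ℝ → A} (hT : 0 ≤ T) (hh : IntervalIntegrable h volume 0 T)
    (n : ℕ) : (blockEval (0, 1) (logCoeff (fun s => blockGen (h s, h s)) T n)).1 =
      ((n : ℝ) + 1) • magnusCoeff h T n := by
  have := FiniteDimensional.complete ℂ A
  have := FiniteDimensional.complete ℂ (BlockOp A)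
  have h1 := integrable_ascWeight_smul (integrable_timeWord (integrable_blockGen hh).1 n)
  rw [logCoeff_eq hT (integrable_blockGen hh)]
  have e := clm_smul_integral ((ContinuousLinearMap.fst ℂ A ℂ).comp (blockEval ((0 : A), (1 : ℂ))))
    (1 / ((n : ℝ) + 1)) _ h1
  refine e.trans ?_
  rw [magnusCoeff, smul_smul]
  congr 1
  · have : (n : ℝ) + 1 ≠ 0 := by positivity
    field_simp
  · refine integral_congr_ae (Eventually.of_forall fun t => ?_)
    simp [timeWord_blockGen_apply]

end MagnusCoeff

/-! ### The Magnus polynomial approximates the logarithm of the propagator -/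

section MagnusExpansion

variable {A : Type*} [NormedRing A] [NormedAlgebra ℂ A] [FiniteDimensional ℂ A] {T : ℝ}

/-- Dividing by `y` bounds the derivative by `C ‖z‖ ^ M` away from `0`, and continuity of the
derivative covers `0`. The mean value inequality on the closed disc of radius `‖y‖` then restores
the lost power. -/
theorem isBigO_pow_of_smul_deriv {E : Type*} [NormedAddCommGroup E] [NormedSpace ℂ E]
    [CompleteSpace E] {D : ℂ → E} (hD : AnalyticAt ℂ D 0) (h0 : D 0 = 0) {M : ℕ}
    (h : (fun y => y • deriv D y) =O[𝓝 0] fun y : ℂ => y ^ (M + 1)) :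
    D =O[𝓝 0] fun y : ℂ => y ^ (M + 1) := by
  obtain ⟨C, hCpos, hC⟩ := h.exists_pos
  rw [Asymptotics.isBigOWith_iff] at hC
  obtain ⟨ε, hε, hball⟩ := Metric.eventually_nhds_iff_ball.1
    (hC.and (hD.eventually_analyticAt))
  have hb : ∀ z ∈ Metric.ball (0 : ℂ) ε, z ≠ 0 → ‖deriv D z‖ ≤ C * ‖z‖ ^ M := by
    intro z hz hz0
    have h1 := (hball z hz).1
    rw [norm_smul, norm_pow, pow_succ] at h1
    have hpos : 0 < ‖z‖ := norm_pos_iff.2 hz0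
    refine le_of_mul_le_mul_left ?_ hpos
    linarith
  refine Asymptotics.IsBigO.of_bound C ?_
  filter_upwards [Metric.ball_mem_nhds (0 : ℂ) hε] with y hy
  by_cases hy0 : y = 0
  · rw [hy0, h0]; simp
  have hypos : 0 < ‖y‖ := norm_pos_iff.2 hy0
  have hyε : ‖y‖ < ε := by simpa using hy
  have hsub : Metric.closedBall (0 : ℂ) ‖y‖ ⊆ Metric.ball 0 ε :=
    Metric.closedBall_subset_ball hyε
  have hb' : ∀ z ∈ Metric.closedBall (0 : ℂ) ‖y‖, ‖deriv D z‖ ≤ C * ‖y‖ ^ M := by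
    intro z hz
    have hz' : ‖z‖ ≤ ‖y‖ := by simpa using hz
    by_cases hz0 : z = 0
    · rw [hz0]
      have hcont : Tendsto (fun z => ‖deriv D z‖) (𝓝[≠] 0) (𝓝 ‖deriv D 0‖) :=
        (hD.deriv.continuousAt.norm.tendsto).mono_left nhdsWithin_le_nhds
      refine le_of_tendsto hcont ?_
      filter_upwards [self_mem_nhdsWithin,
        nhdsWithin_le_nhds (Metric.closedBall_mem_nhds (0 : ℂ) hypos)] with w hw hw'
      refine (hb w (hsub hw') hw).trans ?_
      have : ‖w‖ ≤ ‖y‖ := by simpa using hw'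
      gcongr
    · refine (hb z (hsub hz) hz0).trans ?_
      gcongr
  have := Convex.norm_image_sub_le_of_norm_hasDerivWithin_le (f := D) (f' := deriv D)
    (s := Metric.closedBall (0 : ℂ) ‖y‖) (x := 0) (y := y)
    (fun z hz => ((hball z (hsub hz)).2.differentiableAt.hasDerivAt).hasDerivWithinAt) hb'
    (convex_closedBall 0 ‖y‖) (by simp) (by simp)
  rw [h0, sub_zero, sub_zero] at this
  rw [norm_pow, pow_succ]
  linarith

/-- A local logarithm at the identity. -/
theorem exists_local_log : ∃ ℓ : A → A, ContDiffAt ℂ 1 ℓ 1 ∧ ℓ 1 = 0 ∧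
    (∀ᶠ x in 𝓝 (1 : A), NormedSpace.exp (ℓ x) = x) ∧
    ∀ᶠ x in 𝓝 (0 : A), ℓ (NormedSpace.exp x) = x := by
  have := FiniteDimensional.complete ℂ A
  have hcd : ContDiffAt ℂ 1 (NormedSpace.exp : A → A) 0 :=
    (NormedSpace.exp_analytic (𝕂 := ℂ) (0 : A)).contDiffAt
  have hf' : HasFDerivAt (NormedSpace.exp : A → A)
      ((ContinuousLinearEquiv.refl ℂ A : A ≃L[ℂ] A) : A →L[ℂ] A) 0 := hasFDerivAt_exp_zero
  have e : NormedSpace.exp (0 : A) = 1 := NormedSpace.exp_zero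
  have hs := hcd.hasStrictFDerivAt' hf' one_ne_zero
  refine ⟨hcd.localInverse hf' one_ne_zero, ?_, ?_, ?_, ?_⟩
  · have := hcd.to_localInverse hf' one_ne_zero
    rwa [e] at this
  · have := hcd.localInverse_apply_image hf' one_ne_zero
    rwa [e] at this
  · have := hs.eventually_right_inverse
    rwa [e] at this
  · exact hs.eventually_left_inverse

theorem exp_injective_near_zero {α : Type*} {l : Filter α} {f g : α → A}
    (hf : Tendsto f l (𝓝 0)) (hg : Tendsto g l (𝓝 0))
    (h : ∀ᶠ a in l, NormedSpace.exp (f a) = NormedSpace.exp (g a)) : ∀ᶠ a in l, f a = g a := by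
  obtain ⟨ℓ, -, -, -, hℓ⟩ := exists_local_log (A := A)
  filter_upwards [hf.eventually hℓ, hg.eventually hℓ, h] with a h1 h2 h3
  rw [← h1, ← h2, h3]

theorem differentiable_coupledExp {h : ℝ → A} (hT : 0 ≤ T)
    (hh : IntervalIntegrable h volume 0 T) : Differentiable ℂ fun y => coupledExp h y T :=
  fun y => (hasDerivAt_coupledExp hT hh y).differentiableAt

/-- A logarithm `L(y)` of the propagator for small coupling. -/
theorem exists_log_coupledExp {h : ℝ → A} (hT : 0 ≤ T) (hh : IntervalIntegrable h volume 0 T) :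
    ∃ L : ℂ → A, AnalyticAt ℂ L 0 ∧ L 0 = 0 ∧
      ∀ᶠ y in 𝓝 0, NormedSpace.exp (L y) = coupledExp h y T := by
  have := FiniteDimensional.complete ℂ A
  obtain ⟨ℓ, h1, h2, h3, -⟩ := exists_local_log (A := A)
  have hU0 := coupledExp_zero_coupling hT hh
  have hUc : ContDiffAt ℂ 1 (fun y => coupledExp h y T) 0 :=
    (differentiable_coupledExp hT hh).contDiff.contDiffAt
  have hL : ContDiffAt ℂ 1 (fun y => ℓ (coupledExp h y T)) 0 := by
    refine ContDiffAt.comp (g := ℓ) (0 : ℂ) ?_ hUc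
    rwa [hU0]
  refine ⟨fun y => ℓ (coupledExp h y T), ?_, by simp only [hU0, h2],
    (tendsto_coupledExp hT hh).eventually h3⟩
  rw [Complex.analyticAt_iff_eventually_differentiableAt]
  filter_upwards [hL.eventually (by simp)] with y hy
  exact hy.differentiableAt one_ne_zero

theorem exp_neg_eq_of_exp_eq {p W : A} (h : NormedSpace.exp p * W = 1) :
    NormedSpace.exp (-p) = W := by
  have := FiniteDimensional.complete ℂ A
  let : NormedAlgebra ℚ A := NormedAlgebra.restrictScalars ℚ ℂ A
  calc NormedSpace.exp (-p) = NormedSpace.exp (-p) * (NormedSpace.exp p * W) := by rw [h, mul_one]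
    _ = W := by
      rw [← mul_assoc, ← NormedSpace.exp_add_of_commute (Commute.neg_left (Commute.refl _)),
        neg_add_cancel, NormedSpace.exp_zero, one_mul]

/-- The logarithm of the block propagator in terms of the logarithm of the propagator. -/
theorem exp_blockGen_log {h : ℝ → A} (hT : 0 ≤ T) (hh : IntervalIntegrable h volume 0 T)
    {L : ℂ → A} {y : ℂ} (hL : DifferentiableAt ℂ L y)
    (he : ∀ᶠ y' in 𝓝 y, NormedSpace.exp (L y') = coupledExp h y' T) :
    NormedSpace.exp (blockGen (L y, y • deriv L y)) =
      coupledExp (fun s => blockGen (h s, h s)) y T := by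
  have := FiniteDimensional.complete ℂ A
  have := isDedekindFiniteMonoid_of_finiteDimensional A
  have hy := he.self_of_nhds
  have P := isPropagator_coupledExp hT hh y
  have hUW := P.left_mul_right P.mem_right
  have d1 := (hasDerivAt_exp_comp hL.hasDerivAt).congr_of_eventuallyEq
    (he.mono fun _ h => h.symm)
  have d2 := d1.unique (hasDerivAt_coupledExp hT hh y)
  -- Two expressions for `U⁻¹ U'`: Duhamel's formula for `exp L`, and the parameter derivative of
  -- the propagator.
  have hI : ∫ s in (0 : ℝ)..1, NormedSpace.exp (-(s • L y)) * deriv L y *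
      NormedSpace.exp (s • L y) =
      ∫ s in (0 : ℝ)..T, coupledInv h y s * h s * coupledExp h y s := by
    have hWU := P.right_mul_left P.mem_right
    rw [hy] at d2
    have := congrArg (fun z => coupledInv h y T * z) d2
    simpa only [← mul_assoc, hWU, one_mul] using this
  have hW : NormedSpace.exp (-L y) = coupledInv h y T := exp_neg_eq_of_exp_eq (by rw [hy, hUW])
  have P' : IsPropagator T (fun s => blockGen (y • h s, y • h s))
      (coupledExp (fun s => blockGen (h s, h s)) y)
      (coupledInv (fun s => blockGen (h s, h s)) y) := by
    have e : (fun s => blockGen (y • h s, y • h s)) = fun s => y • blockGen (h s, h s) := by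
      funext s
      rw [← map_smul]; rfl
    rw [e]
    exact isPropagator_coupledExp hT (integrable_blockGen hh) y
  refine BlockOp.ext fun x => ?_
  obtain ⟨X, c⟩ := x
  rw [exp_blockGen_apply, blockPropagator_apply P P', hy, hW]
  simp only [mul_smul_comm, smul_mul_assoc, intervalIntegral.integral_smul, hI]

/-- The exponential of the truncated Magnus expansion agrees with the propagator up to terms of
higher order in the coupling. -/
theorem exp_magnus_sub_coupledExp_isBigO {h : ℝ → A} (hT : 0 ≤ T)
    (hh : IntervalIntegrable h volume 0 T) (M : ℕ) :
    (fun y : ℂ => NormedSpace.exp (∑ m ∈ Finset.range M, y ^ (m + 1) • magnusCoeff h T m) -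
      coupledExp h y T) =O[𝓝 0] fun y : ℂ => y ^ (M + 1) := by
  have := FiniteDimensional.complete ℂ A
  obtain ⟨L, hLan, hL0, hLe⟩ := exists_log_coupledExp hT hh
  set hb : ℝ → BlockOp A := fun s => blockGen (h s, h s) with hhb
  have hbi : IntervalIntegrable hb volume 0 T := integrable_blockGen hh
  set P : ℂ → A := fun y => ∑ m ∈ Finset.range M, y ^ (m + 1) • magnusCoeff h T m with hP
  set Lb : ℂ → BlockOp A := fun y => ∫ x in (0 : ℝ)..1, logIntegrand (coupledExp hb y T - 1) x
  have hLb0 : Tendsto Lb (𝓝 0) (𝓝 0) := by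
    have h1 := log_coupledExp_isBigO hT hbi 0
    simp only [Finset.range_zero, Finset.sum_empty, sub_zero, zero_add, pow_one] at h1
    exact h1.trans_tendsto tendsto_id
  have hG0 : Tendsto (fun y => blockGen (L y, y • deriv L y)) (𝓝 0) (𝓝 0) := by
    have h1 : Tendsto (fun y => (L y, y • deriv L y)) (𝓝 0) (𝓝 (0 : A × A)) := by
      have a := hLan.continuousAt.tendsto
      have b := (continuousAt_id (x := (0 : ℂ))).smul hLan.deriv.continuousAt
      rw [hL0] at a
      have b' := b.tendsto
      simp only [Pi.smul_apply', id, zero_smul] at b'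
      exact a.prodMk_nhds b'
    have h2 := (blockGen (A := A)).continuous.tendsto 0
    rw [map_zero] at h2
    exact h2.comp h1
  have hZ : ∀ᶠ y : ℂ in 𝓝 0, ‖coupledExp hb y T - 1‖ < 1 / 2 := by
    have := ((tendsto_coupledExp hT hbi).sub_const 1).norm
    simp only [sub_self, norm_zero] at this
    exact this.eventually (gt_mem_nhds (by norm_num))
  -- Both sides tend to `0` and have the block propagator as exponential, so they coincide near the
  -- origin by local injectivity of `exp`.
  have hEq : ∀ᶠ y in 𝓝 0, Lb y = blockGen (L y, y • deriv L y) := by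
    refine exp_injective_near_zero hLb0 hG0 ?_
    filter_upwards [hZ, hLe.eventually_nhds, hLan.eventually_analyticAt] with y h1 h2 h3
    rw [exp_integral_logIntegrand h1, add_sub_cancel, exp_blockGen_log hT hh h3.differentiableAt h2]
  have hPd : ∀ y, HasDerivAt P
      (∑ m ∈ Finset.range M, (((m : ℂ) + 1) * y ^ m) • magnusCoeff h T m) y := by
    intro y
    have : ∀ m ∈ Finset.range M, HasDerivAt (fun y : ℂ => y ^ (m + 1) • magnusCoeff h T m)
        ((((m : ℂ) + 1) * y ^ m) • magnusCoeff h T m) y := by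
      intro m _
      have := (hasDerivAt_pow (m + 1) y).smul_const (magnusCoeff h T m)
      simpa using this
    simpa only [hP, Finset.sum_fn] using HasDerivAt.fun_sum this
  have hPan : AnalyticAt ℂ P 0 := by
    rw [Complex.analyticAt_iff_eventually_differentiableAt]
    exact Eventually.of_forall fun y => (hPd y).differentiableAt
  have hP0 : P 0 = 0 := by simp [hP]
  have hlog := log_coupledExp_isBigO hT hbi M
  set F : BlockOp A →L[ℂ] A := (ContinuousLinearMap.fst ℂ A ℂ).comp (blockEval ((0 : A), (1 : ℂ)))
  have hF := (F.isBigO_comp _ (𝓝 (0 : ℂ))).trans hlog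
  -- Evaluated at `(0, 1)`, the block logarithm is `y L'`, and its expansion is `y P'` through order
  -- `M`.
  have hkey : (fun y => y • deriv (fun y => L y - P y) y) =O[𝓝 0] fun y : ℂ => y ^ (M + 1) := by
    refine hF.congr' ?_ EventuallyEq.rfl
    filter_upwards [hEq, hLan.eventually_analyticAt] with y h1 h2
    change F (Lb y - _) = _
    rw [((h2.differentiableAt.hasDerivAt).fun_sub (hPd y)).deriv, map_sub, h1, map_sum, smul_sub,
      Finset.smul_sum]
    congr 1
    · change (blockEval (0, 1) (blockGen (L y, y • deriv L y))).1 = _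
      rw [blockGen_apply]
      simp [Ring.lie_def]
    · refine Finset.sum_congr rfl fun m _ => ?_
      rw [map_smul]
      change y ^ (m + 1) • (blockEval (0, 1) (logCoeff hb T m)).1 = _
      rw [logCoeff_blockGen_apply hT hh, smul_smul, ← Complex.coe_smul, smul_smul]
      congr 1
      push_cast
      ring
  have hD := isBigO_pow_of_smul_deriv (D := fun y => L y - P y) (hLan.sub hPan)
    (by simp [hL0, hP0]) hkey
  have hexp : (fun y => NormedSpace.exp (P y) - NormedSpace.exp (L y)) =O[𝓝 0]
      fun y => P y - L y := by
    have h1 := (hasStrictFDerivAt_exp_zero (𝕂 := ℂ) (𝔸 := A)).isBigO_sub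
    have h2 : Tendsto (fun y => (P y, L y)) (𝓝 0) (𝓝 ((0 : A), (0 : A))) := by
      have a := hPan.continuousAt.tendsto
      have b := hLan.continuousAt.tendsto
      rw [hP0] at a
      rw [hL0] at b
      exact a.prodMk_nhds b
    exact h1.comp_tendsto h2
  have hD' : (fun y => P y - L y) =O[𝓝 0] fun y : ℂ => y ^ (M + 1) := by
    refine hD.neg_left.congr_left fun y => ?_
    abel
  refine (hexp.trans hD').congr' ?_ EventuallyEq.rfl
  filter_upwards [hLe] with y hy
  rw [hy]

theorem multiCommutator_smul (c : ℂ) (n : ℕ) (a : Fin (n + 1) → A) :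
    multiCommutator n (fun j => c • a j) = c ^ (n + 1) • multiCommutator n a := by
  induction n with
  | zero => simp [multiCommutator]
  | succ n ih =>
    rw [multiCommutator, multiCommutator, ih (fun j => a j.castSucc)]
    simp only [Ring.lie_def, smul_mul_assoc, mul_smul_comm, smul_smul, smul_sub]
    congr 2; ring

/-- The Floquet–Magnus terms are the Magnus coefficients of `-i H(t)`. -/
theorem smul_magnusTerm {H : ℝ → A} (hT : 0 < T) (hH : IntervalIntegrable H volume 0 T) (n : ℕ) :
    (-Complex.I * (T : ℂ)) • ((T : ℂ) ^ n • magnusTerm H T n) =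
      magnusCoeff (fun s => (-Complex.I) • H s) T n := by
  have hsum := sum_perm_integral_orderedSimplex (integrable_multiCommutator hH n)
  have hTC : (T : ℂ) ≠ 0 := by exact_mod_cast hT.ne'
  have hI : Complex.I ≠ 0 := Complex.I_ne_zero
  rw [magnusTerm, magnusCoeff]
  have e1 : ∀ t : Fin (n + 1) → ℝ, ascWeight n (ascCount t) •
      multiCommutator n (fun j => (-Complex.I) • H (t j)) =
      (-Complex.I) ^ (n + 1) •
        (ascWeight n (ascCount t) • multiCommutator n (fun j => H (t j))) := by
    intro t
    rw [multiCommutator_smul (-Complex.I) n (fun j => H (t j)), smul_comm]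
  simp_rw [e1]
  rw [integral_smul, ← hsum]
  have e2 : ∀ σ : Equiv.Perm (Fin (n + 1)), ((-1 : ℂ) ^ (n - ascents σ) *
      (((ascents σ).factorial * (n - ascents σ).factorial : ℕ) : ℂ) / (n.factorial : ℂ)) •
      (1 / (Complex.I ^ n * (T : ℂ) ^ (n + 1))) •
        ∫ t in orderedSimplex n T, multiCommutator n (fun j => H (t (σ j))) =
      (1 / (Complex.I ^ n * (T : ℂ) ^ (n + 1))) • (ascWeight n (ascents σ) •
        ∫ t in orderedSimplex n T, multiCommutator n (fun j => H ((t ∘ σ) j))) := by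
    intro σ
    rw [smul_comm, ← Complex.coe_smul (ascWeight n (ascents σ))]
    congr 2
    simp [ascWeight]
  simp_rw [e2]
  rw [← Finset.smul_sum, ← Complex.coe_smul (1 / ((n : ℝ) + 1) ^ 2)]
  simp only [smul_smul]
  congr 1
  push_cast
  -- The `n+1` factors `-i` of the generators against the prefactor `1/i^n` leave the single `-i` of
  -- `-i T`.
  have h3 : (-Complex.I) ^ (n + 1) * Complex.I ^ n = -Complex.I := by
    rw [pow_succ, mul_right_comm, ← mul_pow]; simp
  have h4 : (n : ℂ) + 1 ≠ 0 := by exact_mod_cast Nat.succ_ne_zero n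
  rw [← mul_right_inj' (pow_ne_zero n hI)]
  calc _ = (-Complex.I) * (1 / ((n : ℂ) + 1) ^ 2) := by rw [pow_succ (T : ℂ)]; field_simp
    _ = _ := by linear_combination (-(1 / ((n : ℂ) + 1) ^ 2)) * h3

end MagnusExpansion

/-! ### Interactions, their brackets and local norms -/

section Interaction

variable {ι A : Type*} [Fintype ι] [DecidableEq ι] [NormedRing A] [NormedAlgebra ℂ A]
  [FiniteDimensional ℂ A]

/-- A net of local algebras: increasing in the region, and commuting for disjoint regions. -/
structure IsLocalNet (L : Finset ι → Subalgebra ℂ A) : Prop where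
  mono : ∀ {X Y}, X ⊆ Y → L X ≤ L Y
  comm : ∀ {X Y}, Disjoint X Y → ∀ a ∈ L X, ∀ b ∈ L Y, a * b = b * a

/-- Sum of the norms of the terms of an interaction over a family of regions. -/
def normSum (s : Finset (Finset ι)) (Φ : Finset ι → A) : ℝ := ∑ X ∈ s, ‖Φ X‖

/-- The regions containing a given site. -/
def regionsAt (i : ι) : Finset (Finset ι) := Finset.univ.filter fun X => i ∈ X

/-- The operator defined by an interaction. -/
def total (Φ : Finset ι → A) : A := ∑ X, Φ X

/-- The terms of the interaction lie in the local algebras and vanish on regions with more than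
`m` sites. -/
structure IsLocalInteraction (L : Finset ι → Subalgebra ℂ A) (m : ℕ) (Φ : Finset ι → A) :
    Prop where
  mem : ∀ X, Φ X ∈ L X
  eq_zero : ∀ X, m < X.card → Φ X = 0

/-- The commutator of two interactions. -/
def interBracket (Φ Ψ : Finset ι → A) (Z : Finset ι) : A :=
  ∑ X, ∑ Y, if X ∪ Y = Z ∧ ¬ Disjoint X Y then ⁅Φ X, Ψ Y⁆ else 0

variable {L : Finset ι → Subalgebra ℂ A} {Φ Ψ : Finset ι → A}

theorem normSum_nonneg (s : Finset (Finset ι)) (Φ : Finset ι → A) : 0 ≤ normSum s Φ :=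
  Finset.sum_nonneg fun _ _ => norm_nonneg _

theorem norm_total_le (Φ : Finset ι → A) : ‖total Φ‖ ≤ normSum Finset.univ Φ :=
  norm_sum_le _ _

theorem normSum_add_le (s : Finset (Finset ι)) (Φ Ψ : Finset ι → A) :
    normSum s (Φ + Ψ) ≤ normSum s Φ + normSum s Ψ := by
  rw [normSum, normSum, normSum, ← Finset.sum_add_distrib]
  exact Finset.sum_le_sum fun X _ => norm_add_le _ _

theorem normSum_sub_le (s : Finset (Finset ι)) (Φ Ψ : Finset ι → A) :
    normSum s (Φ - Ψ) ≤ normSum s Φ + normSum s Ψ := by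
  rw [normSum, normSum, normSum, ← Finset.sum_add_distrib]
  exact Finset.sum_le_sum fun X _ => norm_sub_le _ _

theorem normSum_smul {𝕜 : Type*} [NormedField 𝕜] [NormedSpace 𝕜 A] (s : Finset (Finset ι))
    (c : 𝕜) (Φ : Finset ι → A) : normSum s (c • Φ) = ‖c‖ * normSum s Φ := by
  simp [normSum, norm_smul, Finset.mul_sum]

theorem normSum_sum_le {κ : Type*} (s : Finset (Finset ι)) (t : Finset κ) (Φ : κ → Finset ι → A) :
    normSum s (∑ k ∈ t, Φ k) ≤ ∑ k ∈ t, normSum s (Φ k) := by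
  simp only [normSum]
  rw [Finset.sum_comm]
  refine Finset.sum_le_sum fun X _ => ?_
  rw [Finset.sum_apply]
  exact norm_sum_le _ _

theorem total_add (Φ Ψ : Finset ι → A) : total (Φ + Ψ) = total Φ + total Ψ := by
  simp [total, Finset.sum_add_distrib]

theorem total_smul (c : ℂ) (Φ : Finset ι → A) : total (c • Φ) = c • total Φ := by
  simp [total, Finset.smul_sum]

theorem total_sum {κ : Type*} (t : Finset κ) (Φ : κ → Finset ι → A) :
    total (∑ k ∈ t, Φ k) = ∑ k ∈ t, total (Φ k) := by
  simp only [total, Finset.sum_apply]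
  exact Finset.sum_comm

namespace IsLocalInteraction

theorem mono_card {m m' : ℕ} (h : IsLocalInteraction L m Φ) (hm : m ≤ m') :
    IsLocalInteraction L m' Φ :=
  ⟨h.mem, fun X hX => h.eq_zero X (hm.trans_lt hX)⟩

theorem smul {m : ℕ} (h : IsLocalInteraction L m Φ) (c : ℂ) : IsLocalInteraction L m (c • Φ) :=
  ⟨fun X => (L X).smul_mem (h.mem X) c, fun X hX => by simp [h.eq_zero X hX]⟩

theorem sum {κ : Type*} {t : Finset κ} {Φ : κ → Finset ι → A} {m : ℕ}
    (h : ∀ k ∈ t, IsLocalInteraction L m (Φ k)) : IsLocalInteraction L m (∑ k ∈ t, Φ k) :=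
  ⟨fun X => by rw [Finset.sum_apply]; exact sum_mem fun k hk => (h k hk).mem X,
    fun X hX => by
      rw [Finset.sum_apply]; exact Finset.sum_eq_zero fun k hk => (h k hk).eq_zero X hX⟩

theorem add {m : ℕ} (hΦ : IsLocalInteraction L m Φ) (hΨ : IsLocalInteraction L m Ψ) :
    IsLocalInteraction L m (Φ + Ψ) :=
  ⟨fun X => add_mem (hΦ.mem X) (hΨ.mem X), fun X hX => by
    simp [hΦ.eq_zero X hX, hΨ.eq_zero X hX]⟩

/-- The cardinality of a union is bounded by the sum; the site saved by overlapping regions is not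
needed. -/
theorem bracket (hL : IsLocalNet L) {m m' : ℕ} (hΦ : IsLocalInteraction L m Φ)
    (hΨ : IsLocalInteraction L m' Ψ) : IsLocalInteraction L (m + m') (interBracket Φ Ψ) := by
  refine ⟨fun Z => ?_, fun Z hZ => ?_⟩
  · refine sum_mem fun X _ => sum_mem fun Y _ => ?_
    split_ifs with h
    · have hX := hL.mono (h.1 ▸ Finset.subset_union_left) (hΦ.mem X)
      have hY := hL.mono (h.1 ▸ Finset.subset_union_right) (hΨ.mem Y)
      rw [Ring.lie_def]
      exact sub_mem (mul_mem hX hY) (mul_mem hY hX)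
    · exact zero_mem _
  · refine Finset.sum_eq_zero fun X _ => Finset.sum_eq_zero fun Y _ => ?_
    split_ifs with h
    · have hc := Finset.card_union_le X Y
      rw [h.1] at hc
      rcases lt_or_ge m X.card with h1 | h1
      · simp [hΦ.eq_zero X h1, Ring.lie_def]
      · rw [hΨ.eq_zero Y (by omega)]; simp [Ring.lie_def]
    · rfl

end IsLocalInteraction

/-- Pairs with disjoint regions, which the bracket omits, commute by locality; each remaining pair
is counted once, at its union. -/
theorem total_interBracket (hL : IsLocalNet L) (hΦ : ∀ X, Φ X ∈ L X) (hΨ : ∀ X, Ψ X ∈ L X) :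
    total (interBracket Φ Ψ) = ⁅total Φ, total Ψ⁆ := by
  have h1 : total (interBracket Φ Ψ) = ∑ X, ∑ Y, ⁅Φ X, Ψ Y⁆ := by
    simp only [total, interBracket]
    rw [Finset.sum_comm]
    refine Finset.sum_congr rfl fun X _ => ?_
    rw [Finset.sum_comm]
    refine Finset.sum_congr rfl fun Y _ => ?_
    rw [Finset.sum_eq_single (X ∪ Y)]
    · by_cases h : Disjoint X Y
      · simp [h, Ring.lie_def, hL.comm h _ (hΦ X) _ (hΨ Y)]
      · simp [h]
    · intro Z _ hZ
      rw [if_neg]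
      exact fun h => hZ h.1.symm
    · simp
  rw [h1]
  simp only [total, Ring.lie_def, Finset.sum_mul_sum, Finset.sum_sub_distrib]
  congr 1
  exact Finset.sum_comm

theorem norm_lie_le (a b : A) : ‖⁅a, b⁆‖ ≤ 2 * (‖a‖ * ‖b‖) := by
  rw [Ring.lie_def]
  refine (norm_sub_le _ _).trans ?_
  have := norm_mul_le a b
  have := norm_mul_le b a
  linarith

theorem normSum_interBracket_le (s : Finset (Finset ι)) (Φ Ψ : Finset ι → A) :
    normSum s (interBracket Φ Ψ) ≤
      ∑ X, ∑ Y, if X ∪ Y ∈ s ∧ ¬ Disjoint X Y then 2 * (‖Φ X‖ * ‖Ψ Y‖) else 0 := by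
  calc normSum s (interBracket Φ Ψ)
      ≤ ∑ Z ∈ s, ∑ X, ∑ Y, if X ∪ Y = Z ∧ ¬ Disjoint X Y then 2 * (‖Φ X‖ * ‖Ψ Y‖) else 0 := by
        refine Finset.sum_le_sum fun Z _ => ?_
        refine (norm_sum_le _ _).trans (Finset.sum_le_sum fun X _ => ?_)
        refine (norm_sum_le _ _).trans (Finset.sum_le_sum fun Y _ => ?_)
        split_ifs
        · exact norm_lie_le _ _
        · simp
    _ = _ := by
        rw [Finset.sum_comm]
        refine Finset.sum_congr rfl fun X _ => ?_
        rw [Finset.sum_comm]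
        refine Finset.sum_congr rfl fun Y _ => ?_
        by_cases h : X ∪ Y ∈ s
        · rw [Finset.sum_eq_single_of_mem (X ∪ Y) h]
          · simp [h]
          · intro Z _ hZ
            rw [if_neg]
            exact fun h => hZ h.1.symm
        · rw [if_neg (fun h' => h h'.1)]
          refine Finset.sum_eq_zero fun Z hZ => ?_
          rw [if_neg]
          rintro ⟨rfl, -⟩
          exact h hZ

/-- A region that meets `Y` contains a site of `Y`: a union bound over those sites. -/
theorem sum_meeting_le {J : ℝ} (hJ : ∀ i, normSum (regionsAt i) Φ ≤ J) (Y : Finset ι) :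
    (∑ X, if ¬ Disjoint X Y then ‖Φ X‖ else 0) ≤ Y.card * J := by
  calc (∑ X, if ¬ Disjoint X Y then ‖Φ X‖ else 0)
      ≤ ∑ X, ∑ i ∈ Y, if i ∈ X then ‖Φ X‖ else 0 := by
        refine Finset.sum_le_sum fun X _ => ?_
        have hnn : ∀ i ∈ Y, 0 ≤ if i ∈ X then ‖Φ X‖ else 0 := by
          intro i _; split_ifs <;> simp
        split_ifs with h
        · exact Finset.sum_nonneg hnn
        · obtain ⟨i, hiX, hiY⟩ := Finset.not_disjoint_iff.1 h
          refine le_trans ?_ (Finset.single_le_sum hnn hiY)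
          simp [hiX]
    _ = ∑ i ∈ Y, normSum (regionsAt i) Φ := by
        rw [Finset.sum_comm]
        refine Finset.sum_congr rfl fun i _ => ?_
        rw [normSum, regionsAt, Finset.sum_filter]
    _ ≤ ∑ _i ∈ Y, J := Finset.sum_le_sum fun i _ => hJ i
    _ = Y.card * J := by simp

/-- For fixed `Y` only the terms of `Φ` meeting `Y` contribute, with total norm at most `m J`; the
`2` comes from the two orders in a commutator. -/
theorem normSum_univ_interBracket_le {m : ℕ} {J : ℝ} (hJ0 : 0 ≤ J)
    (hJ : ∀ i, normSum (regionsAt i) Φ ≤ J) (hΨ : ∀ Y : Finset ι, m < Y.card → Ψ Y = 0) :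
    normSum Finset.univ (interBracket Φ Ψ) ≤ 2 * m * J * normSum Finset.univ Ψ := by
  refine (normSum_interBracket_le _ Φ Ψ).trans ?_
  rw [Finset.sum_comm, normSum, Finset.mul_sum]
  refine Finset.sum_le_sum fun Y _ => ?_
  have e : (∑ X, if X ∪ Y ∈ (Finset.univ : Finset (Finset ι)) ∧ ¬ Disjoint X Y
      then 2 * (‖Φ X‖ * ‖Ψ Y‖) else 0) =
      (∑ X, if ¬ Disjoint X Y then ‖Φ X‖ else 0) * (2 * ‖Ψ Y‖) := by
    rw [Finset.sum_mul]
    refine Finset.sum_congr rfl fun X _ => ?_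
    simp only [Finset.mem_univ, true_and]
    split_ifs <;> ring
  rw [e]
  rcases lt_or_ge m Y.card with h | h
  · simp [hΨ Y h]
  · have h1 := sum_meeting_le hJ Y
    have h2 : (Y.card : ℝ) * J ≤ m * J := by gcongr
    calc _ ≤ (m * J) * (2 * ‖Ψ Y‖) := by gcongr; exact h1.trans h2
      _ = _ := by ring

/-- A site of `X ∪ Y` lies in `X` or in `Y`. Anchor the region containing it there and sum over the
other region, which must meet the anchored one; the two cases give `m` and `m'`. -/
theorem normSum_regionsAt_interBracket_le {m m' : ℕ} {J J' : ℝ} (hJ0 : 0 ≤ J) (hJ0' : 0 ≤ J')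
    (hΦ : ∀ X : Finset ι, m < X.card → Φ X = 0) (hΨ : ∀ Y : Finset ι, m' < Y.card → Ψ Y = 0)
    (hJ : ∀ i, normSum (regionsAt i) Φ ≤ J) (hJ' : ∀ i, normSum (regionsAt i) Ψ ≤ J') (i : ι) :
    normSum (regionsAt i) (interBracket Φ Ψ) ≤ 2 * (m + m' : ℕ) * J * J' := by
  refine (normSum_interBracket_le _ Φ Ψ).trans ?_
  have split : ∀ X Y : Finset ι,
      (if X ∪ Y ∈ regionsAt i ∧ ¬ Disjoint X Y then 2 * (‖Φ X‖ * ‖Ψ Y‖) else 0) ≤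
      (if i ∈ X then (if ¬ Disjoint Y X then ‖Ψ Y‖ else 0) * (2 * ‖Φ X‖) else 0) +
      (if i ∈ Y then (if ¬ Disjoint X Y then ‖Φ X‖ else 0) * (2 * ‖Ψ Y‖) else 0) := by
    intro X Y
    have hnn : 0 ≤ ‖Φ X‖ * ‖Ψ Y‖ := by positivity
    simp only [regionsAt, Finset.mem_filter, Finset.mem_univ, true_and, Finset.mem_union,
      disjoint_comm (a := Y) (b := X)]
    by_cases h1 : i ∈ X <;> by_cases h2 : i ∈ Y <;> by_cases h3 : Disjoint X Y <;>
      simp [h1, h2, h3] <;> nlinarith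
  calc _ ≤ ∑ X, ∑ Y,
        ((if i ∈ X then (if ¬ Disjoint Y X then ‖Ψ Y‖ else 0) * (2 * ‖Φ X‖) else 0) +
        (if i ∈ Y then (if ¬ Disjoint X Y then ‖Φ X‖ else 0) * (2 * ‖Ψ Y‖) else 0)) :=
        Finset.sum_le_sum fun X _ => Finset.sum_le_sum fun Y _ => split X Y
    _ = (∑ X, if i ∈ X then (∑ Y, if ¬ Disjoint Y X then ‖Ψ Y‖ else 0) * (2 * ‖Φ X‖) else 0) +
        ∑ Y, if i ∈ Y then (∑ X, if ¬ Disjoint X Y then ‖Φ X‖ else 0) * (2 * ‖Ψ Y‖) else 0 := by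
        simp only [Finset.sum_add_distrib]
        congr 1
        · refine Finset.sum_congr rfl fun X _ => ?_
          split_ifs
          · rw [Finset.sum_mul]
          · simp
        · rw [Finset.sum_comm]
          refine Finset.sum_congr rfl fun Y _ => ?_
          split_ifs
          · rw [Finset.sum_mul]
          · simp
    _ ≤ (∑ X, if i ∈ X then (m * J') * (2 * ‖Φ X‖) else 0) +
        ∑ Y, if i ∈ Y then (m' * J) * (2 * ‖Ψ Y‖) else 0 := by
        gcongr with X _ Y _
        · split_ifs
          · rcases lt_or_ge m X.card with h | h
            · simp [hΦ X h]
            · have h1 := sum_meeting_le hJ' X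
              have h2 : (X.card : ℝ) * J' ≤ m * J' := by gcongr
              gcongr; exact h1.trans h2
          · exact le_rfl
        · split_ifs
          · rcases lt_or_ge m' Y.card with h | h
            · simp [hΨ Y h]
            · have h1 := sum_meeting_le hJ Y
              have h2 : (Y.card : ℝ) * J ≤ m' * J := by gcongr
              gcongr; exact h1.trans h2
          · exact le_rfl
    _ = (m * J') * (2 * normSum (regionsAt i) Φ) + (m' * J) * (2 * normSum (regionsAt i) Ψ) := by
        simp only [normSum, regionsAt, Finset.sum_filter, Finset.mul_sum, mul_ite, mul_zero]
    _ ≤ (m * J') * (2 * J) + (m' * J) * (2 * J') := by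
        have := hJ i; have := hJ' i
        gcongr
    _ = _ := by push_cast; ring

theorem interBracket_antisymm (Φ Ψ : Finset ι → A) : interBracket Φ Ψ = -interBracket Ψ Φ := by
  funext Z
  rw [Pi.neg_apply, interBracket, interBracket, Finset.sum_comm, ← Finset.sum_neg_distrib]
  refine Finset.sum_congr rfl fun X _ => ?_
  rw [← Finset.sum_neg_distrib]
  refine Finset.sum_congr rfl fun Y _ => ?_
  have hiff : (Y ∪ X = Z ∧ ¬ Disjoint Y X) ↔ (X ∪ Y = Z ∧ ¬ Disjoint X Y) := by
    rw [Finset.union_comm, disjoint_comm]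
  simp only [hiff]
  split_ifs
  · rw [Ring.lie_def, Ring.lie_def]; abel
  · simp

theorem interBracket_self (Φ : Finset ι → A) : interBracket Φ Φ = 0 := by
  have h := interBracket_antisymm Φ Φ
  have : (2 : ℂ) • interBracket Φ Φ = 0 := by
    rw [two_smul]; nth_rewrite 1 [h]; exact neg_add_cancel _
  exact (smul_eq_zero.1 this).resolve_left two_ne_zero

theorem interBracket_add_left (Φ Φ' Ψ : Finset ι → A) :
    interBracket (Φ + Φ') Ψ = interBracket Φ Ψ + interBracket Φ' Ψ := by
  funext Z
  simp only [Pi.add_apply, interBracket, ← Finset.sum_add_distrib]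
  refine Finset.sum_congr rfl fun X _ => Finset.sum_congr rfl fun Y _ => ?_
  split_ifs
  · simp only [Ring.lie_def]; noncomm_ring
  · simp

theorem interBracket_add_right (Φ Ψ Ψ' : Finset ι → A) :
    interBracket Φ (Ψ + Ψ') = interBracket Φ Ψ + interBracket Φ Ψ' := by
  rw [interBracket_antisymm, interBracket_add_left, interBracket_antisymm Φ Ψ,
    interBracket_antisymm Φ Ψ']
  abel

theorem continuous_interBracket :
    Continuous (Function.uncurry fun Φ Ψ : Finset ι → A => interBracket Φ Ψ) := by
  refine continuous_pi fun Z => continuous_finsetSum _ fun X _ =>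
    continuous_finsetSum _ fun Y _ => ?_
  by_cases h : X ∪ Y = Z ∧ ¬ Disjoint X Y
  · simp only [h]
    simp only [not_false_eq_true, and_self, if_true, Ring.lie_def]
    fun_prop
  · simp only [h, if_false]
    exact continuous_const

theorem norm_interBracket_le : ∃ C : ℝ, ∀ Φ Ψ : Finset ι → A,
    ‖interBracket Φ Ψ‖ ≤ C * ‖Φ‖ * ‖Ψ‖ := by
  refine ⟨(Fintype.card (Finset ι)) * ((Fintype.card (Finset ι)) * 2), fun Φ Ψ => ?_⟩
  rw [pi_norm_le_iff_of_nonneg (by positivity)]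
  intro Z
  have hb : ∀ X Y, ‖(if X ∪ Y = Z ∧ ¬ Disjoint X Y then ⁅Φ X, Ψ Y⁆ else 0)‖ ≤
      2 * (‖Φ‖ * ‖Ψ‖) := by
    intro X Y
    split_ifs
    · refine (norm_lie_le _ _).trans ?_
      have := norm_le_pi_norm Φ X
      have := norm_le_pi_norm Ψ Y
      gcongr
    · rw [norm_zero]; positivity
  refine (norm_sum_le_of_le _ fun X _ => norm_sum_le_of_le _ fun Y _ => hb X Y).trans (le_of_eq ?_)
  simp only [Finset.sum_const, Finset.card_univ, nsmul_eq_mul]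
  ring

/-- The multi-commutator of interactions. -/
def interCommutator : (n : ℕ) → (Fin (n + 1) → Finset ι → A) → Finset ι → A
  | 0, a => a 0
  | n + 1, a => interBracket (a (Fin.last (n + 1))) (interCommutator n fun j => a j.castSucc)

theorem isLocalInteraction_interCommutator (hL : IsLocalNet L) {k : ℕ} (n : ℕ)
    {a : Fin (n + 1) → Finset ι → A} (ha : ∀ j, IsLocalInteraction L k (a j)) :
    IsLocalInteraction L ((n + 1) * k) (interCommutator n a) := by
  induction n with
  | zero => simpa [interCommutator] using ha 0
  | succ n ih =>
    have := (ha (Fin.last (n + 1))).bracket hL (ih fun j => ha j.castSucc)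
    have e : (n + 1 + 1) * k = k + (n + 1) * k := by ring
    rw [e]; exact this

theorem total_interCommutator (hL : IsLocalNet L) {k : ℕ} (n : ℕ)
    {a : Fin (n + 1) → Finset ι → A} (ha : ∀ j, IsLocalInteraction L k (a j)) :
    total (interCommutator n a) = multiCommutator n (fun j => total (a j)) := by
  induction n with
  | zero => rfl
  | succ n ih =>
    rw [interCommutator, multiCommutator, total_interBracket hL (ha _).mem
      (isLocalInteraction_interCommutator hL n fun j => ha j.castSucc).mem,
        ih fun j => ha j.castSucc]

/-- Passing to level `n + 1` brackets a `k`-site term with an `(n+1)k`-site term, at cost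
`2(n+2)kJ`; the product of these costs makes the factorial. -/
theorem normSum_regionsAt_interCommutator_le (hL : IsLocalNet L) {k : ℕ} {J : ℝ} (hJ0 : 0 ≤ J)
    (n : ℕ) {a : Fin (n + 1) → Finset ι → A} (ha : ∀ j, IsLocalInteraction L k (a j))
    (hJ : ∀ j i, normSum (regionsAt i) (a j) ≤ J) (i : ι) :
    normSum (regionsAt i) (interCommutator n a) ≤ (2 * k * J) ^ n * (n + 1).factorial * J := by
  induction n generalizing i with
  | zero => simpa [interCommutator] using hJ 0 i
  | succ n ih =>
    have h1 := normSum_regionsAt_interBracket_le hJ0 (by positivity)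
      (ha (Fin.last (n + 1))).eq_zero
      (isLocalInteraction_interCommutator hL n fun j => ha j.castSucc).eq_zero
      (hJ (Fin.last (n + 1)))
      (fun i => ih (fun j => ha j.castSucc) (fun j i => hJ j.castSucc i) i) i
    refine h1.trans (le_of_eq ?_)
    rw [Nat.factorial_succ (n + 1)]
    push_cast
    ring

/-- In the innermost commutator the static part drops out: `[φ + ν₁, φ + ν₀] = [φ + ν₁, ν₀] - [φ,
ν₁]`. Thus the total norm is controlled by the drive at the two innermost times, and each outer
commutator only adds a locality factor. -/
theorem normSum_univ_interCommutator_le (hL : IsLocalNet L) {k : ℕ} {J : ℝ} (hJ0 : 0 ≤ J)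
    (n : ℕ) {φ : Finset ι → A} {ν : Fin (n + 2) → Finset ι → A}
    (hφ : IsLocalInteraction L k φ) (hν : ∀ j, IsLocalInteraction L k (ν j))
    (hJφ : ∀ i, normSum (regionsAt i) φ ≤ J)
    (hJ : ∀ j i, normSum (regionsAt i) (φ + ν j) ≤ J) :
    normSum Finset.univ (interCommutator (n + 1) fun j => φ + ν j) ≤
      (2 * k * J) ^ (n + 1) * (n + 1).factorial *
        (normSum Finset.univ (ν 0) + normSum Finset.univ (ν 1)) := by
  induction n with
  | zero =>
    have e : interCommutator 1 (fun j => φ + ν j) =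
        interBracket (φ + ν 1) (ν 0) - interBracket φ (ν 1) := by
      change interBracket (φ + ν 1) (φ + ν 0) = _
      rw [interBracket_add_right, interBracket_add_left φ (ν 1) φ, interBracket_self, zero_add,
        interBracket_antisymm (ν 1) φ]
      abel
    rw [e]
    refine (normSum_sub_le _ _ _).trans ?_
    have h1 := normSum_univ_interBracket_le hJ0 (hJ 1) (hν 0).eq_zero
    have h2 := normSum_univ_interBracket_le hJ0 hJφ (hν 1).eq_zero
    simp only [zero_add, pow_one, Nat.factorial_one, Nat.cast_one, mul_one]
    linarith
  | succ n ih =>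
    have h1 := ih (ν := fun j => ν j.castSucc) (fun j => hν j.castSucc)
      (fun j i => hJ j.castSucc i)
    have hloc := isLocalInteraction_interCommutator hL (n + 1) (k := k)
      (a := fun j => φ + ν j.castSucc) (fun j => hφ.add (hν _))
    have h2 := normSum_univ_interBracket_le hJ0 (hJ (Fin.last (n + 1 + 1))) hloc.eq_zero
    refine h2.trans ?_
    have e0 : (Fin.castSucc (0 : Fin (n + 2))) = (0 : Fin (n + 3)) := rfl
    have e1 : (Fin.castSucc (1 : Fin (n + 2))) = (1 : Fin (n + 3)) := rfl
    rw [e0, e1] at h1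
    calc _ ≤ 2 * ((n + 1 + 1) * k : ℕ) * J * ((2 * k * J) ^ (n + 1) * (n + 1).factorial *
        (normSum Finset.univ (ν 0) + normSum Finset.univ (ν 1))) := by gcongr
      _ = _ := by
        rw [Nat.factorial_succ (n + 1)]
        push_cast
        ring

end Interaction

/-! ### Magnus coefficients as local interactions -/

section MagnusInteraction

variable {ι A : Type*} [Fintype ι] [DecidableEq ι] [NormedRing A] [NormedAlgebra ℂ A]
  [FiniteDimensional ℂ A] {L : Finset ι → Subalgebra ℂ A}

/-- The operator defined by an interaction, as a continuous linear map. -/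
def totalCLM (ι A : Type*) [Fintype ι] [NormedRing A] [NormedAlgebra ℂ A] :
    (Finset ι → A) →L[ℝ] A :=
  ∑ X, ContinuousLinearMap.proj X

theorem totalCLM_apply (Φ : Finset ι → A) : totalCLM ι A Φ = total Φ := by
  simp [totalCLM, total]

theorem integrable_normSum {α : Type*} [MeasurableSpace α] {μ : Measure α} (s : Finset (Finset ι))
    {f : α → Finset ι → A} (hf : Integrable f μ) : Integrable (fun a => normSum s (f a)) μ :=
  integrable_finsetSum _ fun X _ => (hf.eval X).norm

theorem normSum_integral_le {α : Type*} [MeasurableSpace α] {μ : Measure α}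
    (s : Finset (Finset ι)) {f : α → Finset ι → A} (hf : Integrable f μ) :
    normSum s (∫ a, f a ∂μ) ≤ ∫ a, normSum s (f a) ∂μ := by
  have := FiniteDimensional.complete ℂ A
  unfold normSum
  rw [integral_finsetSum _ fun X _ => (hf.eval X).norm]
  refine Finset.sum_le_sum fun X _ => ?_
  rw [eval_integral fun X => hf.eval X]
  exact norm_integral_le_integral_norm _

/-- Were the integral outside `S`, some functional would vanish on `S` but not on the integral; yet
functionals pass under the integral. -/
theorem integral_mem_submodule {α : Type*} [MeasurableSpace α] {μ : Measure α}
    (S : Submodule ℂ A) {f : α → A} (hf : Integrable f μ) (h : ∀ a, f a ∈ S) :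
    ∫ a, f a ∂μ ∈ S := by
  have := FiniteDimensional.complete ℂ A
  by_contra hn
  obtain ⟨g, hg, hS⟩ := Submodule.exists_le_ker_of_notMem hn
  refine hg ?_
  have e := (LinearMap.toContinuousLinearMap g).integral_comp_comm hf
  simp only [LinearMap.coe_toContinuousLinearMap'] at e
  rw [← e]
  refine (integral_congr_ae (Eventually.of_forall fun a => ?_)).trans (integral_zero _ _)
  exact hS (h a)

theorem IsLocalInteraction.integral {α : Type*} [MeasurableSpace α] {μ : Measure α} {m : ℕ}
    {f : α → Finset ι → A} (hf : Integrable f μ) (h : ∀ a, IsLocalInteraction L m (f a)) :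
    IsLocalInteraction L m (∫ a, f a ∂μ) := by
  have := FiniteDimensional.complete ℂ A
  refine ⟨fun X => ?_, fun X hX => ?_⟩
  · rw [eval_integral fun X => hf.eval X]
    exact integral_mem_submodule (Subalgebra.toSubmodule (L X)) (hf.eval X) fun a => (h a).mem X
  · rw [eval_integral fun X => hf.eval X]
    simp [fun a => (h a).eq_zero X hX]

theorem IsLocalInteraction.real_smul {m : ℕ} {Φ : Finset ι → A} (h : IsLocalInteraction L m Φ)
    (c : ℝ) : IsLocalInteraction L m (c • Φ) := by
  have : c • Φ = (c : ℂ) • Φ := by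
    funext X; simp
  rw [this]
  exact h.smul c

/-- The Magnus coefficients as interactions. -/
def magnusInter (Φ : ℝ → Finset ι → A) (T : ℝ) (n : ℕ) : Finset ι → A :=
  (1 / ((n : ℝ) + 1) ^ 2) •
    ∫ t, ascWeight n (ascCount t) • interCommutator n (fun j => Φ (t j)) ∂(cube n T)

variable {Φ : ℝ → Finset ι → A} {T : ℝ}

theorem integrable_interCommutator (hΦ : IntervalIntegrable Φ volume 0 T) (n : ℕ) :
    Integrable (fun t => interCommutator n (fun j => Φ (t j))) (cube n T) := by
  induction n with
  | zero => exact integrable_cube_zero hΦ.1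
  | succ n ih =>
    have h := Integrable.op_fst_snd (op := fun Φ Ψ : Finset ι → A => interBracket Φ Ψ)
      continuous_interBracket norm_interBracket_le hΦ.1 ih
    exact integrable_cube_succ n T (fun t => rfl) h

theorem isLocalInteraction_magnusInter (hL : IsLocalNet L) {k : ℕ}
    (hΦ : IntervalIntegrable Φ volume 0 T) (hloc : ∀ t, IsLocalInteraction L k (Φ t)) (n : ℕ) :
    IsLocalInteraction L ((n + 1) * k) (magnusInter Φ T n) :=
  (IsLocalInteraction.integral (integrable_ascWeight_smul (integrable_interCommutator hΦ n))
    fun _ => (isLocalInteraction_interCommutator hL n fun _ => hloc _).real_smul _).real_smul _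

theorem total_magnusInter (hL : IsLocalNet L) {k : ℕ}
    (hΦ : IntervalIntegrable Φ volume 0 T) (hloc : ∀ t, IsLocalInteraction L k (Φ t)) (n : ℕ) :
    total (magnusInter Φ T n) = magnusCoeff (fun t => total (Φ t)) T n := by
  have := FiniteDimensional.complete ℂ A
  rw [← totalCLM_apply, magnusInter, map_smul, ← ContinuousLinearMap.integral_comp_comm _
    (integrable_ascWeight_smul (integrable_interCommutator hΦ n)), magnusCoeff]
  congr 2
  funext t
  rw [map_smul, totalCLM_apply, total_interCommutator hL n fun _ => hloc _]

/-- The ascent weights are inverse binomial coefficients up to sign, so they have modulus at most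
`1`. -/
theorem normSum_magnusInter_le (s : Finset (Finset ι)) (hΦ : IntervalIntegrable Φ volume 0 T)
    (n : ℕ) : normSum s (magnusInter Φ T n) ≤ (1 / ((n : ℝ) + 1) ^ 2) *
      ∫ t, normSum s (interCommutator n (fun j => Φ (t j))) ∂(cube n T) := by
  have hi := integrable_interCommutator hΦ n
  rw [magnusInter, normSum_smul, Real.norm_of_nonneg (by positivity)]
  gcongr
  refine (normSum_integral_le s (integrable_ascWeight_smul hi)).trans ?_
  refine integral_mono (integrable_normSum s (integrable_ascWeight_smul hi))
    (integrable_normSum s hi) fun t => ?_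
  simp only [normSum_smul]
  exact mul_le_of_le_one_left (normSum_nonneg _ _) (abs_ascWeight_le (ascCount_le t))

theorem measureReal_cube_univ (hT : 0 ≤ T) (n : ℕ) : (cube n T).real univ = T ^ (n + 1) := by
  simp [cube, Measure.real, Measure.pi_univ, hT]

theorem integral_cube_coord (hT : 0 ≤ T) (n : ℕ) (j : Fin (n + 1)) (f : ℝ → ℝ) :
    ∫ t, f (t j) ∂(cube n T) = T ^ n * ∫ s in (0 : ℝ)..T, f s := by
  have h := integral_fintype_prod_eq_prod (𝕜 := ℝ)
    (fun i : Fin (n + 1) => if i = j then f else fun _ => 1)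
    (μ := fun _ => volume.restrict (Ioc 0 T))
  have e : ∀ t : Fin (n + 1) → ℝ,
      ∏ i, (if i = j then f else fun _ => (1 : ℝ)) (t i) = f (t j) := by
    intro t
    rw [Finset.prod_eq_single j]
    · simp
    · intro i _ hi; simp [hi]
    · simp
  simp only [e] at h
  rw [cube, h, ← Finset.mul_prod_erase _ _ (Finset.mem_univ j), if_pos rfl,
    intervalIntegral.integral_of_le hT, mul_comm]
  congr 1
  rw [Finset.prod_congr rfl (g := fun _ => T)]
  · simp
  · intro i hi
    rw [if_neg (Finset.ne_of_mem_erase hi)]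
    simp [hT]

theorem integrable_cube_coord (n : ℕ) (j : Fin (n + 1)) {f : ℝ → ℝ}
    (hf : IntervalIntegrable f volume 0 T) : Integrable (fun t => f (t j)) (cube n T) := by
  have h := Integrable.fintype_prod (𝕜 := ℝ)
    (f := fun i : Fin (n + 1) => if i = j then f else fun _ => 1)
    (μ := fun _ => volume.restrict (Ioc 0 T)) (fun i => by
      by_cases hi : i = j
      · rw [if_pos hi]; exact hf.1
      · simp [hi])
  refine h.congr (Eventually.of_forall fun t => ?_)
  simp only
  rw [Finset.prod_eq_single j]
  · simp
  · intro i _ hi; simp [hi]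
  · simp

theorem normSum_regionsAt_magnusInter_le (hL : IsLocalNet L) (hT : 0 ≤ T) {k : ℕ} {J : ℝ}
    (hJ0 : 0 ≤ J) (hΦ : IntervalIntegrable Φ volume 0 T)
    (hloc : ∀ t, IsLocalInteraction L k (Φ t))
    (hJ : ∀ t i, normSum (regionsAt i) (Φ t) ≤ J) (n : ℕ) (i : ι) :
    normSum (regionsAt i) (magnusInter Φ T n) ≤
      (1 / ((n : ℝ) + 1) ^ 2) * (T ^ (n + 1) * ((2 * k * J) ^ n * (n + 1).factorial * J)) := by
  refine (normSum_magnusInter_le _ hΦ n).trans ?_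
  gcongr
  have : IsFiniteMeasure (cube n T) := by unfold cube; infer_instance
  refine (integral_mono (integrable_normSum _ (integrable_interCommutator hΦ n))
    (integrable_const ((2 * k * J) ^ n * (n + 1).factorial * J)) fun t => ?_).trans ?_
  · exact normSum_regionsAt_interCommutator_le hL hJ0 n (fun _ => hloc _) (fun _ _ => hJ _ _) i
  · rw [integral_const, measureReal_cube_univ hT, smul_eq_mul]

/-- Only the coordinates `0` and `1` carry the drive; each gives its integral times `T^(n+1)` from
the other coordinates, hence the `2`. -/
theorem normSum_univ_magnusInter_le (hL : IsLocalNet L) (hT : 0 ≤ T) {k : ℕ} {J : ℝ}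
    (hJ0 : 0 ≤ J) {φ : Finset ι → A} {ν : ℝ → Finset ι → A}
    (hν : IntervalIntegrable ν volume 0 T)
    (hφloc : IsLocalInteraction L k φ) (hνloc : ∀ t, IsLocalInteraction L k (ν t))
    (hJφ : ∀ i, normSum (regionsAt i) φ ≤ J)
    (hJ : ∀ t i, normSum (regionsAt i) (φ + ν t) ≤ J) (n : ℕ) :
    normSum Finset.univ (magnusInter (fun t => φ + ν t) T (n + 1)) ≤
      (1 / ((n : ℝ) + 2) ^ 2) * ((2 * k * J) ^ (n + 1) * (n + 1).factorial *
        (2 * T ^ (n + 1) * ∫ s in (0 : ℝ)..T, normSum Finset.univ (ν s))) := by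
  have hΦ : IntervalIntegrable (fun t => φ + ν t) volume 0 T :=
    (intervalIntegrable_const (c := φ)).add hν
  have hS : IntervalIntegrable (fun t => normSum Finset.univ (ν t)) volume 0 T :=
    ⟨integrable_normSum _ hν.1, integrable_normSum _ hν.2⟩
  refine (normSum_magnusInter_le _ hΦ (n + 1)).trans ?_
  have e : ((n + 1 : ℕ) : ℝ) + 1 = n + 2 := by push_cast; ring
  rw [e]
  gcongr
  have i0 := integrable_cube_coord (n + 1) 0 hS
  have i1 := integrable_cube_coord (n + 1) 1 hS
  refine (integral_mono (integrable_normSum _ (integrable_interCommutator hΦ (n + 1)))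
    ((i0.add i1).const_mul ((2 * k * J) ^ (n + 1) * (n + 1).factorial)) fun t => ?_).trans ?_
  · exact normSum_univ_interCommutator_le hL hJ0 n hφloc (fun _ => hνloc _) hJφ fun _ _ => hJ _ _
  · rw [integral_const_mul]
    simp only [Pi.add_apply]
    rw [integral_add i0 i1, integral_cube_coord hT (n + 1) 0 fun s => normSum Finset.univ (ν s),
      integral_cube_coord hT (n + 1) 1 fun s => normSum Finset.univ (ν s)]
    refine le_of_eq ?_
    ring

end MagnusInteraction

/-! ### Conjugation of local operators by local dynamics -/

section Conjugation

variable {ι A : Type*} [Fintype ι] [DecidableEq ι] [NormedRing A] [NormedAlgebra ℂ A]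
  [FiniteDimensional ℂ A] {L : Finset ι → Subalgebra ℂ A}

/-- Partial sums of the series of `(1 - x)⁻¹ ^ (l + 1)`, with a multiple of the next term. -/
def negBinomialSum (C : ℝ) (j l : ℕ) (x : ℝ) : ℝ :=
  (∑ i ∈ Finset.range j, ((i + l).choose l : ℝ) * x ^ i) + C * ((j + l).choose l * x ^ j)

/-- Differentiation trades one order `j` for one unit of `l`, with factor `l + 1`. This mirrors a
commutator enlarging `K(l+1)` sites to `K(l+2)` at a cost proportional to `l + 1`. -/
theorem hasDerivAt_negBinomialSum (C : ℝ) (j l : ℕ) (x : ℝ) :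
    HasDerivAt (negBinomialSum C (j + 1) l) ((l + 1) * negBinomialSum C j (l + 1) x) x := by
  have hc : ∀ i : ℕ, ((i + 1 + l).choose l : ℝ) * ((i + 1 : ℕ) * x ^ i) =
      (l + 1) * ((i + (l + 1)).choose (l + 1) * x ^ i) := by
    intro i
    have := Nat.choose_succ_right_eq (i + (l + 1)) l
    have h2 : i + (l + 1) - l = i + 1 := by omega
    rw [h2] at this
    have h3 : ((i + (l + 1)).choose (l + 1) : ℝ) * (l + 1 : ℕ) =
      (i + (l + 1)).choose l * (i + 1 : ℕ) := by exact_mod_cast this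
    have h4 : i + 1 + l = i + (l + 1) := by ring
    rw [h4]
    push_cast at h3 ⊢
    linear_combination (-x ^ i) * h3
  have h : ∀ i : ℕ, HasDerivAt (fun x : ℝ => ((i + 1 + l).choose l : ℝ) * x ^ (i + 1))
      ((l + 1) * ((i + (l + 1)).choose (l + 1) * x ^ i)) x := by
    intro i
    rw [← hc i]
    simpa using (hasDerivAt_pow (i + 1) x).const_mul ((i + 1 + l).choose l : ℝ)
  have e : negBinomialSum C (j + 1) l = fun x => ((∑ i ∈ Finset.range j,
      ((i + 1 + l).choose l : ℝ) * x ^ (i + 1)) + 1) +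
      C * (((j + 1 + l).choose l : ℝ) * x ^ (j + 1)) := by
    funext x
    simp [negBinomialSum, Finset.sum_range_succ']
  rw [e]
  have := ((HasDerivAt.fun_sum fun i (_ : i ∈ Finset.range j) => h i).add_const 1).add
    ((h j).const_mul C)
  refine this.congr_deriv ?_
  rw [negBinomialSum, mul_add, Finset.mul_sum]
  ring

theorem negBinomialSum_nonneg {C : ℝ} (hC : 0 ≤ C) (j l : ℕ) {x : ℝ} (hx : 0 ≤ x) :
    0 ≤ negBinomialSum C j l x := by
  unfold negBinomialSum
  positivity

theorem continuous_negBinomialSum (C : ℝ) (j l : ℕ) : Continuous (negBinomialSum C j l) := by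
  unfold negBinomialSum
  fun_prop

theorem negBinomialSum_eq_integral (C b : ℝ) (j l : ℕ) (s : ℝ) :
    negBinomialSum C (j + 1) l (b * s) =
      1 + ∫ r in (0 : ℝ)..s, b * (l + 1) * negBinomialSum C j (l + 1) (b * r) := by
  have hd : ∀ r ∈ uIcc 0 s, HasDerivAt (fun r => negBinomialSum C (j + 1) l (b * r))
      (b * (l + 1) * negBinomialSum C j (l + 1) (b * r)) r := by
    intro r _
    have h1 : HasDerivAt (fun r : ℝ => b * r) b r := by
      simpa using (hasDerivAt_id r).const_mul b
    exact ((hasDerivAt_negBinomialSum C j l (b * r)).comp r h1).congr_deriv (by ring)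
  have hc : Continuous fun r => b * (l + 1) * negBinomialSum C j (l + 1) (b * r) :=
    continuous_const.mul ((continuous_negBinomialSum _ _ _).comp (by fun_prop))
  rw [intervalIntegral.integral_eq_sub_of_hasDerivAt hd (hc.intervalIntegrable _ _)]
  have h0 : negBinomialSum C (j + 1) l (b * 0) = 1 := by
    simp [negBinomialSum, Finset.sum_range_succ']
  rw [h0]
  ring

theorem tendsto_negBinomialSum (C : ℝ) (l : ℕ) {x : ℝ} (h0 : 0 ≤ x) (h1 : x < 1) :
    Tendsto (fun j => negBinomialSum C j l x) atTop (𝓝 ((1 - x) ^ (l + 1))⁻¹) := by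
  have hs := hasSum_choose_mul_geometric_of_norm_lt_one l
    (r := x) (by rwa [Real.norm_of_nonneg h0])
  have := hs.tendsto_sum_nat.add (hs.summable.tendsto_atTop_zero.const_mul C)
  simpa [negBinomialSum] using this

variable {Φ : ℝ → Finset ι → A} {τ : ℝ} {U W : ℝ → A} {K : ℕ} {J : ℝ}

/-- Heisenberg's equation gives `W O U = O + ∫ W [O, Φ] U`, whose bracket has index `l + 1`; so the
induction on `j` keeps `l` and `O` free. The crude constant `C` is used only at `j = 0`, to close
the truncated series. -/
theorem norm_conj_le_negBinomialSum (hL : IsLocalNet L)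
    (P : IsPropagator τ (fun r => total (Φ r)) U W) (hloc : ∀ r, IsLocalInteraction L K (Φ r))
    (hJ0 : 0 ≤ J) (hJ : ∀ r i, normSum (regionsAt i) (Φ r) ≤ J) {C : ℝ} (hC : 0 ≤ C)
    (hCb : ∀ a, ∀ s ∈ Icc 0 τ, ‖W s * a * U s‖ ≤ C * ‖a‖) (j : ℕ) :
    ∀ (l : ℕ) (O : Finset ι → A), IsLocalInteraction L (K * (l + 1)) O → ∀ s ∈ Icc 0 τ,
      ‖W s * total O * U s‖ ≤
        normSum Finset.univ O * negBinomialSum C j l (2 * K * J * s) := by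
  have := FiniteDimensional.complete ℂ A
  induction j with
  | zero =>
    intro l O _ s hs
    refine (hCb _ s hs).trans ?_
    have := norm_total_le O
    have hn := normSum_nonneg Finset.univ O
    simp only [negBinomialSum, Finset.range_zero, Finset.sum_empty, zero_add, Nat.choose_self,
      Nat.cast_one, pow_zero, mul_one]
    rw [mul_comm]
    gcongr
  | succ j ih =>
    intro l O hO s hs
    have hS := normSum_nonneg Finset.univ O
    have e := (P.conj (IsPrimitive.const P.nonneg (total O))).eq s hs
    simp only [P.left_zero, P.right_zero, one_mul, mul_one] at e
    rw [e, negBinomialSum_eq_integral, mul_add, mul_one, ← intervalIntegral.integral_const_mul]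
    refine (norm_add_le _ _).trans (add_le_add (norm_total_le O) ?_)
    refine intervalIntegral.norm_integral_le_of_norm_le hs.1
      (Eventually.of_forall fun r hr => ?_) ?_
    · have hr' : r ∈ Icc 0 τ := ⟨hr.1.le, hr.2.trans hs.2⟩
      have hb := (hloc r).bracket hL hO
      have hcard : K + K * (l + 1) = K * (l + 1 + 1) := by ring
      rw [hcard] at hb
      have h1 := ih (l + 1) _ hb r hr'
      rw [total_interBracket hL (hloc r).mem hO.mem] at h1
      have h2 := normSum_univ_interBracket_le hJ0 (hJ r) hO.eq_zero
      have hnn : 0 ≤ negBinomialSum C j (l + 1) (2 * K * J * r) :=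
        negBinomialSum_nonneg hC _ _ (mul_nonneg (by positivity) hr.1.le)
      rw [zero_sub, mul_neg, neg_mul, norm_neg]
      refine h1.trans ((mul_le_mul_of_nonneg_right h2 hnn).trans (le_of_eq ?_))
      push_cast
      ring
    · exact (continuous_const.mul (continuous_const.mul
        ((continuous_negBinomialSum _ _ _).comp (by fun_prop)))).intervalIntegrable _ _

/-- Conjugation of a local operator with the propagator of a local generator. -/
theorem norm_conj_le (hL : IsLocalNet L)
    (P : IsPropagator τ (fun r => total (Φ r)) U W) (hloc : ∀ r, IsLocalInteraction L K (Φ r))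
    (hJ0 : 0 ≤ J) (hJ : ∀ r i, normSum (regionsAt i) (Φ r) ≤ J) {l : ℕ} {O : Finset ι → A}
    (hO : IsLocalInteraction L (K * (l + 1)) O) {s : ℝ} (hs : s ∈ Icc 0 τ)
    (hb : 2 * K * J * s < 1) :
    ‖W s * total O * U s‖ ≤ normSum Finset.univ O * ((1 - 2 * K * J * s) ^ (l + 1))⁻¹ := by
  have := FiniteDimensional.complete ℂ A
  obtain ⟨C1, hC1, hU⟩ := P.exists_bound_left
  obtain ⟨C2, hC2, hW⟩ := P.exists_bound_right
  -- As `j → ∞` the term carrying the crude constant vanishes, since it multiplies the general term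
  -- of a convergent series.
  have hlim := (tendsto_negBinomialSum (C2 * C1) l
    (x := 2 * K * J * s) (mul_nonneg (by positivity) hs.1) hb).const_mul (normSum Finset.univ O)
  refine ge_of_tendsto' hlim fun j => ?_
  refine norm_conj_le_negBinomialSum hL P hloc hJ0 hJ (mul_nonneg hC2 hC1) (fun a s hs => ?_) j l O
    hO s hs
  calc ‖W s * a * U s‖ ≤ ‖W s‖ * ‖a‖ * ‖U s‖ :=
        (norm_mul_le _ _).trans (mul_le_mul_of_nonneg_right (norm_mul_le _ _) (norm_nonneg _))
    _ ≤ C2 * ‖a‖ * C1 := by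
        have := hU s hs; have := hW s hs
        gcongr
    _ = _ := by ring

end Conjugation

/-! ### Locality for spin systems -/

section Spins

variable {N d : ℕ}

theorem op_ext {A B : Op N d} (h : ∀ s t : Fin N → Fin d,
    A (EuclideanSpace.single t 1) s = B (EuclideanSpace.single t 1) s) : A = B := by
  apply ContinuousLinearMap.coe_injective
  refine (EuclideanSpace.basisFun (Fin N → Fin d) ℂ).toBasis.ext fun t => ?_
  ext s
  simpa using h s t

theorem op_apply_eq_sum (A : Op N d) (x : SpinSpace N d) (s : Fin N → Fin d) :
    A x s = ∑ u, x u * A (EuclideanSpace.single u 1) s := by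
  have hx : x = ∑ u, x u • EuclideanSpace.single u (1 : ℂ) := by
    ext s
    simp [Finset.sum_apply, Pi.single_apply]
  conv_lhs => rw [hx]
  simp [map_sum]

/-- Only one intermediate configuration survives: it agrees with `t` on `X` and with `s` elsewhere.
The result is a product of scalars symmetric in the two factors, which is why disjoint supports
commute. -/
theorem SupportedOn.mul_apply {X Y : Finset (Fin N)} (hXY : Disjoint X Y) {A B : Op N d}
    {a : Matrix (X → Fin d) (X → Fin d) ℂ} {b : Matrix (Y → Fin d) (Y → Fin d) ℂ}
    (hA : ∀ s t : Fin N → Fin d, A (EuclideanSpace.single t 1) s =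
      if ∀ i, i ∉ X → s i = t i then a (fun i => s i) (fun i => t i) else 0)
    (hB : ∀ s t : Fin N → Fin d, B (EuclideanSpace.single t 1) s =
      if ∀ i, i ∉ Y → s i = t i then b (fun i => s i) (fun i => t i) else 0)
    (s t : Fin N → Fin d) : (A * B) (EuclideanSpace.single t 1) s =
      if ∀ i, i ∉ X → i ∉ Y → s i = t i then
        a (fun i => s i) (fun i => t i) * b (fun i => s i) (fun i => t i) else 0 := by
  rw [mul_apply_eq_comp, op_apply_eq_sum, Finset.sum_eq_single (X.piecewise t s)]
  · rw [hA, hB]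
    have h1 : ∀ i, i ∉ X → s i = X.piecewise t s i := fun i hi => by simp [hi]
    have h2 : (∀ i, i ∉ Y → X.piecewise t s i = t i) ↔ ∀ i, i ∉ X → i ∉ Y → s i = t i := by
      constructor
      · intro h i hX hY
        simpa [hX] using h i hY
      · intro h i hY
        by_cases hX : i ∈ X
        · simp [hX]
        · simpa [hX] using h i hX hY
    have h3 : (fun i : X => X.piecewise t s i) = fun i : X => t i := by
      funext i; simp
    have h4 : (fun i : Y => X.piecewise t s i) = fun i : Y => s i := by
      funext i
      have : (i : Fin N) ∉ X := fun h => Finset.disjoint_left.1 hXY h i.2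
      simp [this]
    rw [if_pos h1, h3, h4]
    simp only [h2]
    split_ifs <;> ring
  · intro u _ hu
    rw [hA, hB]
    by_contra hne
    refine hu ?_
    have h1 : ∀ i, i ∉ X → s i = u i := by
      by_contra hc; exact hne (by rw [if_neg hc, mul_zero])
    have h2 : ∀ i, i ∉ Y → u i = t i := by
      by_contra hc; exact hne (by rw [if_neg hc, zero_mul])
    funext i
    by_cases hX : i ∈ X
    · simp [hX, h2 i (Finset.disjoint_left.1 hXY hX)]
    · simp [hX, h1 i hX]
  · simp

theorem SupportedOn.commute {X Y : Finset (Fin N)} (hXY : Disjoint X Y) {A B : Op N d}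
    (hA : SupportedOn X A) (hB : SupportedOn Y B) : A * B = B * A := by
  obtain ⟨a, ha⟩ := hA
  obtain ⟨b, hb⟩ := hB
  refine op_ext fun s t => ?_
  rw [SupportedOn.mul_apply hXY ha hb, SupportedOn.mul_apply hXY.symm hb ha]
  have : (∀ i, i ∉ X → i ∉ Y → s i = t i) ↔ ∀ i, i ∉ Y → i ∉ X → s i = t i :=
    ⟨fun h i h1 h2 => h i h2 h1, fun h i h1 h2 => h i h2 h1⟩
  simp only [this]
  split_ifs <;> ring

/-- The algebra generated by the operators that act on some of the spins in `X` only. -/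
def localAlgebra (N d : ℕ) (X : Finset (Fin N)) : Subalgebra ℂ (Op N d) :=
  Algebra.adjoin ℂ {a | ∃ Y ⊆ X, SupportedOn Y a}

theorem SupportedOn.mem_localAlgebra {X : Finset (Fin N)} {A : Op N d} (h : SupportedOn X A) :
    A ∈ localAlgebra N d X :=
  Algebra.subset_adjoin ⟨X, subset_rfl, h⟩

/-- Commutation of generators extends to the generated algebras by taking centralizers twice.
Allowing generators supported on subsets of `X` makes monotonicity immediate. -/
theorem isLocalNet_localAlgebra (N d : ℕ) : IsLocalNet (localAlgebra N d) where
  mono h := Algebra.adjoin_mono fun _ ⟨Z, hZ, ha⟩ => ⟨Z, hZ.trans h, ha⟩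
  comm {X Y} hXY a ha b hb := by
    have h1 : localAlgebra N d X ≤
        Subalgebra.centralizer ℂ {b : Op N d | ∃ Z ⊆ Y, SupportedOn Z b} := by
      refine Algebra.adjoin_le ?_
      rintro a ⟨Z, hZ, ha⟩
      rw [SetLike.mem_coe, Subalgebra.mem_centralizer_iff]
      rintro b ⟨Z', hZ', hb⟩
      exact (SupportedOn.commute (hXY.mono hZ hZ') ha hb).symm
    have h2 : localAlgebra N d Y ≤
        Subalgebra.centralizer ℂ (localAlgebra N d X : Set (Op N d)) := by
      refine Algebra.adjoin_le fun b hb => ?_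
      rw [SetLike.mem_coe, Subalgebra.mem_centralizer_iff]
      intro a ha
      exact ((Subalgebra.mem_centralizer_iff _).1 (h1 ha) b hb).symm
    exact (Subalgebra.mem_centralizer_iff _).1 (h2 hb) a ha

end Spins

/-! ### Logarithmic derivative of the propagator compared with the static term -/

section Driven

variable {ι A : Type*} [Fintype ι] [DecidableEq ι] [NormedRing A] [NormedAlgebra ℂ A]
  [FiniteDimensional ℂ A]

/-- A few-body interaction `φ + ν(t)` on `[0, T]` with local strength at most `J`. -/
structure IsDrivenInteraction (L : Finset ι → Subalgebra ℂ A) (k : ℕ) (J T : ℝ)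
    (φ : Finset ι → A) (ν : ℝ → Finset ι → A) : Prop where
  net : IsLocalNet L
  strength_nonneg : 0 ≤ J
  time_nonneg : 0 ≤ T
  integrable : IntervalIntegrable ν volume 0 T
  local_static : IsLocalInteraction L k φ
  local_drive : ∀ t, IsLocalInteraction L k (ν t)
  static_le : ∀ i, normSum (regionsAt i) φ ≤ J
  strength_le : ∀ t i, normSum (regionsAt i) (φ + ν t) ≤ J

namespace IsDrivenInteraction

variable {L : Finset ι → Subalgebra ℂ A} {k : ℕ} {J T : ℝ} {φ : Finset ι → A}
  {ν : ℝ → Finset ι → A}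

theorem integrable_add (D : IsDrivenInteraction L k J T φ ν) :
    IntervalIntegrable (fun t => φ + ν t) volume 0 T :=
  (intervalIntegrable_const (c := φ)).add D.integrable

theorem integrable_normSum_drive (D : IsDrivenInteraction L k J T φ ν) :
    IntervalIntegrable (fun t => normSum Finset.univ (ν t)) volume 0 T :=
  ⟨integrable_normSum _ D.integrable.1, integrable_normSum _ D.integrable.2⟩

theorem integrable_total_drive (D : IsDrivenInteraction L k J T φ ν) :
    IntervalIntegrable (fun t => total (ν t)) volume 0 T := by
  simp only [← totalCLM_apply]
  exact ⟨(totalCLM ι A).integrable_comp D.integrable.1,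
    (totalCLM ι A).integrable_comp D.integrable.2⟩

theorem integrable_total (D : IsDrivenInteraction L k J T φ ν) :
    IntervalIntegrable (fun t => total (φ + ν t)) volume 0 T := by
  simp only [total_add]
  exact (intervalIntegrable_const (c := total φ)).add D.integrable_total_drive

theorem local_add (D : IsDrivenInteraction L k J T φ ν) (t : ℝ) :
    IsLocalInteraction L k (φ + ν t) := D.local_static.add (D.local_drive t)

/-- The driving strength. -/
def drive (ν : ℝ → Finset ι → A) (T : ℝ) : ℝ := ∫ t in (0 : ℝ)..T, normSum Finset.univ (ν t)

theorem drive_nonneg (D : IsDrivenInteraction L k J T φ ν) : 0 ≤ drive ν T :=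
  intervalIntegral.integral_nonneg D.time_nonneg fun _ _ => normSum_nonneg _ _

theorem norm_coupled_conj_le (D : IsDrivenInteraction L k J T φ ν) {y : ℂ} {ρ : ℝ}
    (hρ : 2 * k * J * T * ‖y‖ ≤ ρ) (hρ1 : ρ < 1) {l : ℕ} {O : Finset ι → A}
    (hO : IsLocalInteraction L (k * (l + 1)) O) {s : ℝ} (hs : s ∈ Icc 0 T) :
    ‖coupledInv (fun t => total (φ + ν t)) y s * total O *
      coupledExp (fun t => total (φ + ν t)) y s‖ ≤
      normSum Finset.univ O * ((1 - ρ) ^ (l + 1))⁻¹ := by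
  have P := isPropagator_coupledExp D.time_nonneg D.integrable_total y
  have e : (fun s => y • total (φ + ν s)) = fun s => total (y • (φ + ν s)) := by
    funext s; rw [total_smul]
  rw [e] at P
  have hJ := D.strength_nonneg
  have hle : 2 * k * (‖y‖ * J) * s ≤ ρ := by
    refine le_trans ?_ hρ
    calc 2 * k * (‖y‖ * J) * s ≤ 2 * k * (‖y‖ * J) * T := by
          gcongr; exact hs.2
      _ = _ := by ring
  refine (norm_conj_le D.net P (fun r => (D.local_add r).smul y) (J := ‖y‖ * J) (by positivity)
    (fun r i => ?_) hO hs (hle.trans_lt hρ1)).trans ?_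
  · rw [normSum_smul]
    exact mul_le_mul_of_nonneg_left (D.strength_le r i) (norm_nonneg _)
  · have h1 : 0 < 1 - ρ := by linarith
    have := normSum_nonneg Finset.univ O
    gcongr

/-- Since `φ` commutes with itself, the derivative of `W φ U` is `y W [φ, ν] U`, proportional to the
drive. The bracket occupies `2k` sites, whence the square. -/
theorem norm_coupled_static_sub_le (D : IsDrivenInteraction L k J T φ ν) {y : ℂ} {ρ : ℝ}
    (hρ : 2 * k * J * T * ‖y‖ ≤ ρ) (hρ1 : ρ < 1) {s : ℝ} (hs : s ∈ Icc 0 T) :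
    ‖coupledInv (fun t => total (φ + ν t)) y s * total φ *
      coupledExp (fun t => total (φ + ν t)) y s - total φ‖ ≤
      ‖y‖ * (2 * k * J) * ((1 - ρ) ^ 2)⁻¹ * drive ν T := by
  have := FiniteDimensional.complete ℂ A
  have P := isPropagator_coupledExp D.time_nonneg D.integrable_total y
  have hJ := D.strength_nonneg
  have e := (P.conj (IsPrimitive.const P.nonneg (total φ))).eq s hs
  simp only [P.left_zero, P.right_zero, one_mul, mul_one] at e
  rw [e, add_sub_cancel_left]
  have hmono : ∫ r in (0 : ℝ)..s, normSum Finset.univ (ν r) ≤ drive ν T :=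
    intervalIntegral.integral_mono_interval le_rfl hs.1 hs.2
      (Eventually.of_forall fun _ => normSum_nonneg _ _) D.integrable_normSum_drive
  have hsub : uIcc 0 s ⊆ uIcc 0 T := by
    rw [uIcc_of_le hs.1, uIcc_of_le D.time_nonneg]; exact Icc_subset_Icc_right hs.2
  have hpos : 0 < 1 - ρ := by linarith
  refine (intervalIntegral.norm_integral_le_of_norm_le hs.1
    (g := fun r => ‖y‖ * (2 * k * J) * ((1 - ρ) ^ 2)⁻¹ * normSum Finset.univ (ν r))
    (Eventually.of_forall fun r hr => ?_)
    ((D.integrable_normSum_drive.mono_set hsub).const_mul _)).trans ?_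
  · have hr' : r ∈ Icc 0 T := ⟨hr.1.le, hr.2.trans hs.2⟩
    have hO : IsLocalInteraction L (k * (1 + 1)) (interBracket φ (ν r)) := by
      have h2 : k * (1 + 1) = k + k := by ring
      rw [h2]
      exact D.local_static.bracket D.net (D.local_drive r)
    have h1 := D.norm_coupled_conj_le hρ hρ1 hO hr'
    rw [total_interBracket D.net D.local_static.mem (D.local_drive r).mem] at h1
    have h2 := normSum_univ_interBracket_le D.strength_nonneg D.static_le (D.local_drive r).eq_zero
    have e1 : (0 : A) - ⁅y • total (φ + ν r), total φ⁆ = y • ⁅total φ, total (ν r)⁆ := by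
      rw [total_add, Ring.lie_def, Ring.lie_def]
      simp only [smul_add, add_mul, mul_add, smul_mul_assoc, mul_smul_comm, smul_sub]
      abel
    rw [e1, mul_smul_comm, smul_mul_assoc, norm_smul]
    calc _ ≤ ‖y‖ * ((2 * k * J * normSum Finset.univ (ν r)) * ((1 - ρ) ^ 2)⁻¹) := by
          gcongr
          exact h1.trans (mul_le_mul_of_nonneg_right h2 (by positivity))
      _ = _ := by ring
  · rw [intervalIntegral.integral_const_mul]
    gcongr

/-- The drive part of the integrand contributes `(1 - ρ)⁻¹`; the evolution of the static part away
from `φ`, integrated over `[0, T]`, contributes `ρ (1 - ρ)⁻²`. -/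
theorem norm_coupled_logDeriv_sub_le (D : IsDrivenInteraction L k J T φ ν) {y : ℂ} {ρ : ℝ}
    (hρ : 2 * k * J * T * ‖y‖ ≤ ρ) (hρ1 : ρ < 1) :
    ‖(∫ s in (0 : ℝ)..T, coupledInv (fun t => total (φ + ν t)) y s * total (φ + ν s) *
      coupledExp (fun t => total (φ + ν t)) y s) - T • total φ‖ ≤
      drive ν T * ((1 - ρ)⁻¹ + ρ * ((1 - ρ) ^ 2)⁻¹) := by
  have := FiniteDimensional.complete ℂ A
  have P := isPropagator_coupledExp D.time_nonneg D.integrable_total y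
  have hJ := D.strength_nonneg
  have hT := D.time_nonneg
  have hV := D.drive_nonneg
  have hpos : 0 < 1 - ρ := by linarith
  set U := coupledExp (fun t => total (φ + ν t)) y with hU
  set W := coupledInv (fun t => total (φ + ν t)) y with hW
  have i1 : IntervalIntegrable (fun s => W s * total φ * U s - total φ) volume 0 T :=
    ((((P.continuousOn_right.mul continuousOn_const).mul P.continuousOn_left).sub
      continuousOn_const)).intervalIntegrable
  have i2 : IntervalIntegrable (fun s => W s * total (ν s) * U s) volume 0 T :=
    (D.integrable_total_drive.continuousOn_mul P.continuousOn_right).mul_continuousOn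
      P.continuousOn_left
  have e : (∫ s in (0 : ℝ)..T, W s * total (φ + ν s) * U s) - T • total φ =
      (∫ s in (0 : ℝ)..T, (W s * total φ * U s - total φ)) +
        ∫ s in (0 : ℝ)..T, W s * total (ν s) * U s := by
    rw [← intervalIntegral.integral_add i1 i2]
    have h3 : T • total φ = ∫ _s in (0 : ℝ)..T, total φ := by simp
    have i4 : IntervalIntegrable (fun s => W s * total (φ + ν s) * U s) volume 0 T :=
      (D.integrable_total.continuousOn_mul P.continuousOn_right).mul_continuousOn
        P.continuousOn_left
    rw [h3, ← intervalIntegral.integral_sub i4 intervalIntegrable_const]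
    refine intervalIntegral.integral_congr fun s _ => ?_
    simp only [total_add, mul_add, add_mul]
    abel
  rw [e]
  have b1 : ‖∫ s in (0 : ℝ)..T, (W s * total φ * U s - total φ)‖ ≤
      ρ * ((1 - ρ) ^ 2)⁻¹ * drive ν T := by
    refine (intervalIntegral.norm_integral_le_of_norm_le_const
      (C := ‖y‖ * (2 * k * J) * ((1 - ρ) ^ 2)⁻¹ * drive ν T) fun s hs => ?_).trans ?_
    · rw [uIoc_of_le hT] at hs
      exact D.norm_coupled_static_sub_le hρ hρ1 ⟨hs.1.le, hs.2⟩
    · rw [sub_zero, abs_of_nonneg hT]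
      calc _ = (2 * k * J * T * ‖y‖) * ((1 - ρ) ^ 2)⁻¹ * drive ν T := by ring
        _ ≤ _ := by gcongr
  have b2 : ‖∫ s in (0 : ℝ)..T, W s * total (ν s) * U s‖ ≤ (1 - ρ)⁻¹ * drive ν T := by
    rw [drive, ← intervalIntegral.integral_const_mul]
    refine intervalIntegral.norm_integral_le_of_norm_le hT (Eventually.of_forall fun r hr => ?_)
      (D.integrable_normSum_drive.const_mul _)
    have hO : IsLocalInteraction L (k * (0 + 1)) (ν r) := by simpa using D.local_drive r
    have := D.norm_coupled_conj_le hρ hρ1 hO ⟨hr.1.le, hr.2⟩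
    rw [zero_add, pow_one] at this
    rw [mul_comm (1 - ρ)⁻¹]
    exact this
  calc _ ≤ _ := norm_add_le _ _
    _ ≤ _ := add_le_add b1 b2
    _ = _ := by ring

end IsDrivenInteraction

end Driven

/-! ### Logarithmic derivative of the Magnus exponential -/

section MagnusSide

variable {ι A : Type*} [Fintype ι] [DecidableEq ι] [NormedRing A] [NormedAlgebra ℂ A]
  [FiniteDimensional ℂ A]

/-- The truncated Magnus generator with coupling `y`. -/
def magnusGen (h : ℝ → A) (T : ℝ) (n : ℕ) (y : ℂ) : A :=
  ∑ m ∈ Finset.range (n + 1), y ^ (m + 1) • magnusCoeff h T m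

/-- The derivative of the truncated Magnus generator with respect to the coupling. -/
def magnusGenDeriv (h : ℝ → A) (T : ℝ) (n : ℕ) (y : ℂ) : A :=
  ∑ m ∈ Finset.range (n + 1), (((m : ℂ) + 1) * y ^ m) • magnusCoeff h T m

theorem hasDerivAt_magnusGen (h : ℝ → A) (T : ℝ) (n : ℕ) (y : ℂ) :
    HasDerivAt (magnusGen h T n) (magnusGenDeriv h T n y) y := by
  unfold magnusGen magnusGenDeriv
  refine HasDerivAt.fun_sum fun m _ => ?_
  have := (hasDerivAt_pow (m + 1) y).smul_const (magnusCoeff h T m)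
  simpa using this

theorem magnusGen_zero (h : ℝ → A) (T : ℝ) (n : ℕ) : magnusGen h T n 0 = 0 := by
  simp [magnusGen]

theorem magnusCoeff_zero {h : ℝ → A} {T : ℝ} (hT : 0 ≤ T) :
    magnusCoeff h T 0 = ∫ s in (0 : ℝ)..T, h s := by
  rw [magnusCoeff, intervalIntegral.integral_of_le hT, ← integral_cube_zero]
  have hw : ∀ t : Fin 1 → ℝ, ascWeight 0 (ascCount (n := 0) t) = 1 := by
    intro t
    simp [ascWeight, ascCount]
  simp [hw, multiCommutator]

/-- The part of `magnusGenDeriv` that commutes with the generator. -/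
def magnusMean (h : ℝ → A) (T : ℝ) (n : ℕ) (y : ℂ) : A :=
  ∑ m ∈ Finset.range (n + 1), y ^ m • magnusCoeff h T m

/-- The remaining part of `magnusGenDeriv`. -/
def magnusExcess (h : ℝ → A) (T : ℝ) (n : ℕ) (y : ℂ) : A :=
  ∑ m ∈ Finset.range n, (((m : ℂ) + 1) * y ^ (m + 1)) • magnusCoeff h T (m + 1)

theorem magnusGenDeriv_eq (h : ℝ → A) (T : ℝ) (n : ℕ) (y : ℂ) :
    magnusGenDeriv h T n y = magnusMean h T n y + magnusExcess h T n y := by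
  have e : magnusExcess h T n y =
      ∑ m ∈ Finset.range (n + 1), ((m : ℂ) * y ^ m) • magnusCoeff h T m := by
    rw [Finset.sum_range_succ', magnusExcess]
    simp
  rw [e, magnusGenDeriv, magnusMean, ← Finset.sum_add_distrib]
  refine Finset.sum_congr rfl fun m _ => ?_
  rw [← add_smul]
  congr 1
  ring

theorem magnusGen_eq_smul (h : ℝ → A) (T : ℝ) (n : ℕ) (y : ℂ) :
    magnusGen h T n y = y • magnusMean h T n y := by
  rw [magnusGen, magnusMean, Finset.smul_sum]
  refine Finset.sum_congr rfl fun m _ => ?_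
  rw [smul_smul, pow_succ']

theorem exp_conj_of_commute {P R : A} (h : Commute P R) (s : ℝ) :
    NormedSpace.exp (-(s • P)) * R * NormedSpace.exp (s • P) = R := by
  have := FiniteDimensional.complete ℂ A
  let : NormedAlgebra ℚ A := NormedAlgebra.restrictScalars ℚ ℂ A
  have hc : Commute R (NormedSpace.exp (s • P)) := (h.symm.smul_right s).exp_right
  have hi : NormedSpace.exp (-(s • P)) * NormedSpace.exp (s • P) = 1 := by
    rw [← NormedSpace.exp_add_of_commute (Commute.neg_left (Commute.refl _)), neg_add_cancel,
      NormedSpace.exp_zero]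
  rw [mul_assoc, hc.eq, ← mul_assoc, hi, one_mul]

/-- The generator is `y` times the mean, so conjugation leaves the mean fixed; only the excess,
which starts at first order in `y`, needs a conjugation bound. -/
theorem integral_exp_conj_magnusGenDeriv (h : ℝ → A) (T : ℝ) (n : ℕ) (y : ℂ) :
    ∫ s in (0 : ℝ)..1, NormedSpace.exp (-(s • magnusGen h T n y)) * magnusGenDeriv h T n y *
      NormedSpace.exp (s • magnusGen h T n y) =
    magnusMean h T n y + ∫ s in (0 : ℝ)..1, NormedSpace.exp (-(s • magnusGen h T n y)) *
      magnusExcess h T n y * NormedSpace.exp (s • magnusGen h T n y) := by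
  have := FiniteDimensional.complete ℂ A
  have hc : Commute (magnusGen h T n y) (magnusMean h T n y) := by
    rw [magnusGen_eq_smul]
    exact (Commute.refl _).smul_left y
  have P := IsPropagator.exp_smul (magnusGen h T n y)
  have hi : IntervalIntegrable (fun s : ℝ => NormedSpace.exp (-(s • magnusGen h T n y)) *
      magnusExcess h T n y * NormedSpace.exp (s • magnusGen h T n y)) volume 0 1 :=
    ((P.continuousOn_right.mul continuousOn_const).mul P.continuousOn_left).intervalIntegrable
  have h1 : magnusMean h T n y = ∫ _s in (0 : ℝ)..1, magnusMean h T n y := by simp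
  conv_rhs => rw [h1]
  rw [← intervalIntegral.integral_add intervalIntegrable_const hi]
  refine intervalIntegral.integral_congr fun s _ => ?_
  simp only [magnusGenDeriv_eq, mul_add, add_mul, exp_conj_of_commute hc]

theorem sum_range_pow_le {x : ℝ} (h0 : 0 ≤ x) (h1 : x ≤ 1 / 8) (n : ℕ) :
    ∑ m ∈ Finset.range n, x ^ m ≤ 8 / 7 := by
  have h : ∑ m ∈ Finset.range n, x ^ m ≤ (1 - x)⁻¹ := by
    rw [← tsum_geometric_of_lt_one h0 (by linarith)]
    exact (summable_geometric_of_lt_one h0 (by linarith)).sum_le_tsum _ fun i _ => by positivity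
  refine h.trans ?_
  rw [inv_le_comm₀ (by linarith) (by norm_num)]
  linarith

theorem factorial_le_pow_of_le {m n : ℕ} (h : m ≤ n) : (m.factorial : ℝ) ≤ (n : ℝ) ^ m := by
  have h1 : m.factorial ≤ n ^ m := (Nat.factorial_le_pow m).trans (Nat.pow_le_pow_left h m)
  exact_mod_cast h1

namespace IsDrivenInteraction

variable {L : Finset ι → Subalgebra ℂ A} {k : ℕ} {J T : ℝ} {φ : Finset ι → A}
  {ν : ℝ → Finset ι → A}

/-- For `m < n` the factorial is beaten by `(m+1)! ≤ n^(m+1)`, so `ρ^(m+1) (m+1)! ≤ (nρ)^(m+1) ≤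
8^{-(m+1)}`. -/
theorem normSum_magnusInter_le (D : IsDrivenInteraction L k J T φ ν) {y : ℂ} {ρ : ℝ}
    (hρ : 2 * k * J * T * ‖y‖ = ρ) {n m : ℕ} (hnρ : n * ρ ≤ 1 / 8) (hm : m < n) :
    ‖y‖ ^ (m + 1) * normSum Finset.univ (magnusInter (fun t => φ + ν t) T (m + 1)) ≤
      2 / ((m : ℝ) + 2) ^ 2 * (1 / 8) ^ (m + 1) * drive ν T := by
  have hJ := D.strength_nonneg
  have hT := D.time_nonneg
  have hV := D.drive_nonneg
  have hρ0 : 0 ≤ ρ := by rw [← hρ]; positivity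
  have h := normSum_univ_magnusInter_le D.net hT hJ D.integrable D.local_static D.local_drive
    D.static_le D.strength_le m
  have hf := factorial_le_pow_of_le (Nat.succ_le_of_lt hm)
  calc _ ≤ ‖y‖ ^ (m + 1) * ((1 / ((m : ℝ) + 2) ^ 2) * ((2 * k * J) ^ (m + 1) *
        (m + 1).factorial * (2 * T ^ (m + 1) * drive ν T))) := by
        gcongr; exact h
    _ = 2 / ((m : ℝ) + 2) ^ 2 * (ρ ^ (m + 1) * (m + 1).factorial) * drive ν T := by
        rw [← hρ]; ring
    _ ≤ 2 / ((m : ℝ) + 2) ^ 2 * (1 / 8) ^ (m + 1) * drive ν T := by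
        gcongr
        calc ρ ^ (m + 1) * (m + 1).factorial ≤ ρ ^ (m + 1) * (n : ℝ) ^ (m + 1) := by
              gcongr
          _ = (n * ρ) ^ (m + 1) := by rw [mul_pow]; ring
          _ ≤ _ := by gcongr

/-- The zeroth term is `T φ` plus the integrated drive, which costs `1`; higher terms sum to at most
`1/16 · 8/7 = 1/14`. -/
theorem norm_magnusMean_sub_le (D : IsDrivenInteraction L k J T φ ν) {y : ℂ} {ρ : ℝ}
    (hρ : 2 * k * J * T * ‖y‖ = ρ) {n : ℕ} (hnρ : n * ρ ≤ 1 / 8) :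
    ‖magnusMean (fun t => total (φ + ν t)) T n y - T • total φ‖ ≤ 15 / 14 * drive ν T := by
  have := FiniteDimensional.complete ℂ A
  have hV := D.drive_nonneg
  have hT := D.time_nonneg
  have e0 : magnusCoeff (fun t => total (φ + ν t)) T 0 =
      T • total φ + ∫ s in (0 : ℝ)..T, total (ν s) := by
    rw [magnusCoeff_zero hT]
    simp only [total_add]
    rw [intervalIntegral.integral_add intervalIntegrable_const D.integrable_total_drive]
    simp
  have e : magnusMean (fun t => total (φ + ν t)) T n y - T • total φ =
      (∑ m ∈ Finset.range n, y ^ (m + 1) • magnusCoeff (fun t => total (φ + ν t)) T (m + 1)) +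
        ∫ s in (0 : ℝ)..T, total (ν s) := by
    rw [magnusMean, Finset.sum_range_succ', e0, pow_zero, one_smul]
    abel
  have b0 : ‖∫ s in (0 : ℝ)..T, total (ν s)‖ ≤ drive ν T :=
    intervalIntegral.norm_integral_le_of_norm_le hT
      (Eventually.of_forall fun r _ => norm_total_le _) D.integrable_normSum_drive
  have b1 : ∀ m ∈ Finset.range n,
      ‖y ^ (m + 1) • magnusCoeff (fun t => total (φ + ν t)) T (m + 1)‖ ≤
        (1 / 16 * drive ν T) * (1 / 8) ^ m := by
    intro m hm
    have h1 := D.normSum_magnusInter_le hρ hnρ (Finset.mem_range.1 hm)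
    rw [← total_magnusInter D.net D.integrable_add D.local_add, norm_smul, norm_pow]
    refine (mul_le_mul_of_nonneg_left (norm_total_le _) (by positivity)).trans (h1.trans ?_)
    have h2 : 2 / ((m : ℝ) + 2) ^ 2 ≤ 1 / 2 := by
      rw [div_le_div_iff₀ (by positivity) (by norm_num)]
      nlinarith [(Nat.cast_nonneg m : (0 : ℝ) ≤ m)]
    calc _ ≤ 1 / 2 * (1 / 8) ^ (m + 1) * drive ν T := by gcongr
      _ = _ := by ring
  rw [e]
  refine (norm_add_le _ _).trans ?_
  have b2 := norm_sum_le_of_le _ b1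
  rw [← Finset.mul_sum] at b2
  have b3 := sum_range_pow_le (x := 1 / 8) (by norm_num) le_rfl n
  have b4 : (1 / 16 * drive ν T) * ∑ m ∈ Finset.range n, ((1 : ℝ) / 8) ^ m ≤
      (1 / 16 * drive ν T) * (8 / 7) := by gcongr
  linarith

/-- The Magnus generator is an interaction on at most `(n+1)k` sites with local strength `J'`. The
excess has norm at most `1/14` of the drive, and conjugation costs `(1 - 2/7)⁻¹ = 7/5`. -/
theorem norm_exp_conj_magnusExcess_le (D : IsDrivenInteraction L k J T φ ν) {y : ℂ} {ρ : ℝ}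
    (hρ : 2 * k * J * T * ‖y‖ = ρ) {n : ℕ} (hnρ : n * ρ ≤ 1 / 8) (hnρ' : (n + 1) * ρ ≤ 1 / 4)
    {s : ℝ} (hs : s ∈ Icc (0 : ℝ) 1) :
    ‖NormedSpace.exp (-(s • magnusGen (fun t => total (φ + ν t)) T n y)) *
      magnusExcess (fun t => total (φ + ν t)) T n y *
      NormedSpace.exp (s • magnusGen (fun t => total (φ + ν t)) T n y)‖ ≤
      1 / 10 * drive ν T := by
  have := FiniteDimensional.complete ℂ A
  have hV := D.drive_nonneg
  have hT := D.time_nonneg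
  have hJ := D.strength_nonneg
  have hρ0 : 0 ≤ ρ := by rw [← hρ]; positivity
  have htot := total_magnusInter D.net D.integrable_add D.local_add
  have hloc := isLocalInteraction_magnusInter D.net D.integrable_add D.local_add
  set p : ℕ → Finset ι → A := magnusInter (fun t => φ + ν t) T with hp
  set Ψ : Finset ι → A := ∑ m ∈ Finset.range (n + 1), y ^ (m + 1) • p m with hΨ
  set O : Finset ι → A := ∑ m ∈ Finset.range n, (((m : ℂ) + 1) * y ^ (m + 1)) • p (m + 1) with hO
  have eΨ : magnusGen (fun t => total (φ + ν t)) T n y = total Ψ := by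
    rw [hΨ, total_sum, magnusGen]
    exact Finset.sum_congr rfl fun m _ => by rw [total_smul, htot]
  have eO : magnusExcess (fun t => total (φ + ν t)) T n y = total O := by
    rw [hO, total_sum, magnusExcess]
    exact Finset.sum_congr rfl fun m _ => by rw [total_smul, htot]
  have lΨ : IsLocalInteraction L ((n + 1) * k) Ψ := IsLocalInteraction.sum fun m hm =>
    ((hloc m).mono_card (Nat.mul_le_mul_right k (by
      have := Finset.mem_range.1 hm; omega))).smul _
  have lO : IsLocalInteraction L (((n + 1) * k) * (0 + 1)) O := by
    rw [zero_add, mul_one]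
    exact IsLocalInteraction.sum fun m hm => ((hloc (m + 1)).mono_card (Nat.mul_le_mul_right k (by
      have := Finset.mem_range.1 hm; omega))).smul _
  set J' : ℝ := ∑ m ∈ Finset.range (n + 1), ‖y‖ ^ (m + 1) * ((1 / ((m : ℝ) + 1) ^ 2) *
    (T ^ (m + 1) * ((2 * k * J) ^ m * (m + 1).factorial * J))) with hJ'
  have hJ'0 : 0 ≤ J' := Finset.sum_nonneg fun m _ => by positivity
  have bΨ : ∀ i, normSum (regionsAt i) Ψ ≤ J' := by
    intro i
    refine (normSum_sum_le _ _ _).trans (Finset.sum_le_sum fun m _ => ?_)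
    rw [normSum_smul, norm_pow]
    gcongr
    exact normSum_regionsAt_magnusInter_le D.net hT hJ D.integrable_add D.local_add
      D.strength_le m i
  -- Here `(m+1)!/(m+1)² = m!/(m+1) ≤ n^m`, so the strengths sum like a geometric series of ratio
  -- `nρ ≤ 1/8`; the range factor `n + 1` is paid for by `(n+1)ρ ≤ 1/4`.
  have bJ' : 2 * ((n + 1) * k : ℕ) * J' ≤ 2 / 7 := by
    have h1 : 2 * k * J' ≤ ∑ m ∈ Finset.range (n + 1), ρ * (n * ρ) ^ m := by
      rw [hJ', Finset.mul_sum]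
      refine Finset.sum_le_sum fun m hm => ?_
      have hf := factorial_le_pow_of_le (Nat.lt_succ_iff.1 (Finset.mem_range.1 hm))
      have hm1 : (0 : ℝ) < (m : ℝ) + 1 := by positivity
      calc _ = ρ ^ (m + 1) * (m.factorial / ((m : ℝ) + 1)) := by
            rw [← hρ, Nat.factorial_succ]
            push_cast
            field_simp
            ring
        _ ≤ ρ ^ (m + 1) * (n : ℝ) ^ m := by
            gcongr
            refine (div_le_self (by positivity)
              (by linarith [(Nat.cast_nonneg m : (0 : ℝ) ≤ m)])).trans hf
        _ = ρ * (n * ρ) ^ m := by rw [mul_pow]; ring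
    rw [← Finset.mul_sum] at h1
    have h2 := sum_range_pow_le (x := n * ρ) (by positivity) hnρ (n + 1)
    calc 2 * ((n + 1) * k : ℕ) * J' = (n + 1) * (2 * k * J') := by push_cast; ring
      _ ≤ (n + 1) * (ρ * (8 / 7)) := by
          refine mul_le_mul_of_nonneg_left (h1.trans ?_) (by positivity)
          gcongr
      _ = ((n + 1) * ρ) * (8 / 7) := by ring
      _ ≤ 1 / 4 * (8 / 7) := by gcongr
      _ = 2 / 7 := by norm_num
  have bO : normSum Finset.univ O ≤ 1 / 14 * drive ν T := by
    refine (normSum_sum_le _ _ _).trans ?_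
    have b1 : ∀ m ∈ Finset.range n,
        normSum Finset.univ ((((m : ℂ) + 1) * y ^ (m + 1)) • p (m + 1)) ≤
        (1 / 16 * drive ν T) * (1 / 8) ^ m := by
      intro m hm
      have h1 := D.normSum_magnusInter_le hρ hnρ (Finset.mem_range.1 hm)
      have e1 : ‖((m : ℂ) + 1) * y ^ (m + 1)‖ = ((m : ℝ) + 1) * ‖y‖ ^ (m + 1) := by
        rw [norm_mul, norm_pow]
        congr 1
        have : ((m : ℂ) + 1) = ((m + 1 : ℕ) : ℂ) := by push_cast; ring
        rw [this, Complex.norm_natCast]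
        push_cast; ring
      rw [normSum_smul, e1]
      have h2 : ((m : ℝ) + 1) * (2 / ((m : ℝ) + 2) ^ 2) ≤ 1 / 2 := by
        rw [← mul_div_assoc, div_le_div_iff₀ (by positivity) (by norm_num)]
        nlinarith [(Nat.cast_nonneg m : (0 : ℝ) ≤ m)]
      calc _ = ((m : ℝ) + 1) * (‖y‖ ^ (m + 1) * normSum Finset.univ (p (m + 1))) := by ring
        _ ≤ ((m : ℝ) + 1) * (2 / ((m : ℝ) + 2) ^ 2 * (1 / 8) ^ (m + 1) * drive ν T) := by
            gcongr
        _ = ((m : ℝ) + 1) * (2 / ((m : ℝ) + 2) ^ 2) * ((1 / 8) ^ (m + 1) * drive ν T) := by ring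
        _ ≤ 1 / 2 * ((1 / 8) ^ (m + 1) * drive ν T) := by gcongr
        _ = _ := by ring
    refine (Finset.sum_le_sum b1).trans ?_
    rw [← Finset.mul_sum]
    have b3 := sum_range_pow_le (x := 1 / 8) (by norm_num) le_rfl n
    have b4 : (1 / 16 * drive ν T) * ∑ m ∈ Finset.range n, ((1 : ℝ) / 8) ^ m ≤
        (1 / 16 * drive ν T) * (8 / 7) := by gcongr
    linarith
  rw [eΨ, eO]
  have hle : 2 * ((n + 1) * k : ℕ) * J' * s ≤ 2 / 7 := by
    refine le_trans ?_ bJ'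
    exact mul_le_of_le_one_right (by positivity) hs.2
  refine (norm_conj_le D.net (IsPropagator.exp_smul (total Ψ)) (fun _ => lΨ)
    hJ'0 (fun _ => bΨ) lO hs
    (hle.trans_lt (by norm_num))).trans ?_
  rw [zero_add, pow_one]
  calc _ ≤ (1 / 14 * drive ν T) * (1 - 2 / 7)⁻¹ := by
        have h1 : (0 : ℝ) < 1 - 2 / 7 := by norm_num
        have h2 : 1 - 2 / 7 ≤ 1 - 2 * ((n + 1) * k : ℕ) * J' * s := by linarith
        exact mul_le_mul bO (inv_anti₀ h1 h2) (inv_nonneg.2 (h1.le.trans h2)) (by positivity)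
    _ = _ := by ring

theorem norm_magnus_logDeriv_sub_le (D : IsDrivenInteraction L k J T φ ν) {y : ℂ} {ρ : ℝ}
    (hρ : 2 * k * J * T * ‖y‖ = ρ) {n : ℕ} (hnρ : n * ρ ≤ 1 / 8) (hnρ' : (n + 1) * ρ ≤ 1 / 4) :
    ‖(∫ s in (0 : ℝ)..1, NormedSpace.exp (-(s • magnusGen (fun t => total (φ + ν t)) T n y)) *
      magnusGenDeriv (fun t => total (φ + ν t)) T n y *
      NormedSpace.exp (s • magnusGen (fun t => total (φ + ν t)) T n y)) - T • total φ‖ ≤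
      (15 / 14 + 1 / 10) * drive ν T := by
  rw [integral_exp_conj_magnusGenDeriv, add_sub_right_comm]
  refine (norm_add_le _ _).trans ?_
  have h1 := D.norm_magnusMean_sub_le hρ hnρ
  have hs : ∀ s ∈ uIoc (0 : ℝ) 1,
      ‖NormedSpace.exp (-(s • magnusGen (fun t => total (φ + ν t)) T n y)) *
        magnusExcess (fun t => total (φ + ν t)) T n y *
        NormedSpace.exp (s • magnusGen (fun t => total (φ + ν t)) T n y)‖ ≤
      1 / 10 * drive ν T := by
    intro s hs
    rw [uIoc_of_le zero_le_one] at hs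
    exact D.norm_exp_conj_magnusExcess_le hρ hnρ hnρ' ⟨hs.1.le, hs.2⟩
  have h2 := intervalIntegral.norm_integral_le_of_norm_le_const hs
  rw [sub_zero, abs_one, mul_one] at h2
  linarith

/-- The difference of the logarithmic derivatives of the propagator and of its Magnus
approximation. -/
theorem norm_logDeriv_sub_le (D : IsDrivenInteraction L k J T φ ν) {y : ℂ} {ρ : ℝ}
    (hρ : 2 * k * J * T * ‖y‖ = ρ) {n : ℕ} (hnρ : n * ρ ≤ 1 / 8) (hnρ' : (n + 1) * ρ ≤ 1 / 4) :
    ‖(∫ s in (0 : ℝ)..T, coupledInv (fun t => total (φ + ν t)) y s * total (φ + ν s) *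
        coupledExp (fun t => total (φ + ν t)) y s) -
      ∫ s in (0 : ℝ)..1, NormedSpace.exp (-(s • magnusGen (fun t => total (φ + ν t)) T n y)) *
        magnusGenDeriv (fun t => total (φ + ν t)) T n y *
        NormedSpace.exp (s • magnusGen (fun t => total (φ + ν t)) T n y)‖ ≤ 3 * drive ν T := by
  have hV := D.drive_nonneg
  have hJ := D.strength_nonneg
  have hT := D.time_nonneg
  have hρ0 : 0 ≤ ρ := by rw [← hρ]; positivity
  have hρ1 : ρ ≤ 1 / 4 := by
    have : (n : ℝ) * ρ ≥ 0 := by positivity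
    linarith
  have h1 := D.norm_coupled_logDeriv_sub_le (y := y) (ρ := 1 / 4) (hρ.le.trans hρ1) (by norm_num)
  have h2 := D.norm_magnus_logDeriv_sub_le hρ hnρ hnρ'
  -- At `ρ = 1/4` the propagator side is `4/3 + 4/9 = 16/9`; adding `15/14 + 1/10` stays below `3`.
  refine (norm_sub_le_norm_sub_add_norm_sub _ (T • total φ) _).trans ?_
  rw [norm_sub_rev (T • total φ)]
  refine (add_le_add h1 h2).trans ?_
  norm_num
  linarith

end IsDrivenInteraction

end MagnusSide

/-! ### Schwarz lemma for the difference of logarithmic derivatives -/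

section LogDeriv

variable {A : Type*} [NormedRing A] [NormedAlgebra ℂ A] [FiniteDimensional ℂ A]

/-- Cauchy's estimate on the circle of radius `‖y‖` about `y`, where `‖z‖ ≤ 2‖y‖`, loses exactly one
power. -/
theorem deriv_isBigO_pow {D : ℂ → A} (hd : Differentiable ℂ D) {n : ℕ}
    (hO : D =O[𝓝 0] fun y => y ^ (n + 2)) : deriv D =O[𝓝 0] fun y => y ^ (n + 1) := by
  obtain ⟨C, hC⟩ := hO.bound
  obtain ⟨r, hr, hball⟩ := Metric.eventually_nhds_iff.1 hC
  refine Asymptotics.IsBigO.of_bound (C * 2 ^ (n + 2)) ?_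
  have h0 : deriv D 0 = 0 := by
    have h1 : D =O[𝓝 0] fun y : ℂ => ‖y - 0‖ ^ (n + 2) := by
      simpa using hO.norm_right
    have := (h1.hasFDerivAt (𝕜 := ℂ) (by omega)).hasDerivAt
    simpa using this.deriv
  filter_upwards [Metric.ball_mem_nhds (0 : ℂ) (half_pos hr)] with y hy
  rw [mem_ball_zero_iff] at hy
  rcases eq_or_ne y 0 with rfl | hne
  · simp [h0]
  have hy0 : 0 < ‖y‖ := norm_pos_iff.2 hne
  have hCnn : 0 ≤ C := by
    have h := (norm_nonneg _).trans (hball (y := y) (by rw [dist_zero_right]; linarith))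
    have h2 : 0 < ‖y ^ (n + 2)‖ := by rw [norm_pow]; positivity
    exact nonneg_of_mul_nonneg_left h h2
  have hb : ∀ z ∈ Metric.sphere y ‖y‖, ‖D z‖ ≤ C * (2 * ‖y‖) ^ (n + 2) := by
    intro z hz
    rw [mem_sphere_iff_norm] at hz
    have hz2 : ‖z‖ ≤ 2 * ‖y‖ := by
      have := norm_add_le (z - y) y
      rw [sub_add_cancel] at this
      linarith
    refine (hball (y := z) (by rw [dist_zero_right]; linarith)).trans ?_
    rw [norm_pow]
    gcongr
  refine (Complex.norm_deriv_le_of_forall_mem_sphere_norm_le hy0 hd.diffContOnCl hb).trans ?_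
  refine le_of_eq ?_
  rw [norm_pow]
  field_simp
  ring

variable {U W Ui Wi G K : ℂ → A}

theorem differentiable_inverse (hU : Differentiable ℂ U) (h : ∀ y, Ui y * U y = 1) :
    Differentiable ℂ Ui := by
  have := FiniteDimensional.complete ℂ A
  have := isDedekindFiniteMonoid_of_finiteDimensional A
  have e : Ui = fun y => Ring.inverse (U y) := by
    funext y
    let u : Aˣ := ⟨U y, Ui y, mul_eq_one_symm (h y), h y⟩
    exact (Ring.inverse_unit u).symm
  rw [e]
  intro y
  have hu : IsUnit (U y) := ⟨⟨U y, Ui y, mul_eq_one_symm (h y), h y⟩, rfl⟩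
  exact (differentiableAt_inverse (𝕜 := ℂ) hu).comp y (hU y)

/-- If two entire families of invertible elements agree to high order at the origin, then their
logarithmic derivatives are close. -/
theorem norm_logDeriv_sub_le_of_isBigO (hU : ∀ y, HasDerivAt U (U y * G y) y)
    (hW : ∀ y, HasDerivAt W (W y * K y) y) (hUi : ∀ y, Ui y * U y = 1) (hWi : ∀ y, Wi y * W y = 1)
    {n : ℕ} (hO : (fun y => W y - U y) =O[𝓝 0] fun y => y ^ (n + 2)) {M : ℝ}
    (hM : ∀ y ∈ Metric.ball (0 : ℂ) 2, ‖G y - K y‖ ≤ M) {y : ℂ} (hy : ‖y‖ ≤ 1) :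
    ‖G y - K y‖ ≤ M * (1 / 2) ^ (n + 1) := by
  have := FiniteDimensional.complete ℂ A
  have := isDedekindFiniteMonoid_of_finiteDimensional A
  have dU : Differentiable ℂ U := fun y => (hU y).differentiableAt
  have dW : Differentiable ℂ W := fun y => (hW y).differentiableAt
  have dU' : Differentiable ℂ (deriv U) := by
    have := (dU.differentiableOn (s := univ)).deriv isOpen_univ
    rwa [differentiableOn_univ] at this
  have dW' : Differentiable ℂ (deriv W) := by
    have := (dW.differentiableOn (s := univ)).deriv isOpen_univ
    rwa [differentiableOn_univ] at this
  have dUi := differentiable_inverse dU hUi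
  have dWi := differentiable_inverse dW hWi
  have eG : ∀ y, G y = Ui y * deriv U y := fun y => by
    rw [(hU y).deriv, ← mul_assoc, hUi, one_mul]
  have eK : ∀ y, K y = Wi y * deriv W y := fun y => by
    rw [(hW y).deriv, ← mul_assoc, hWi, one_mul]
  have dF : Differentiable ℂ fun y => G y - K y := by
    simp only [eG, eK]
    exact (dUi.mul dU').sub (dWi.mul dW')
  -- Writing `G - K` through `W - U` and its derivative exposes the order of vanishing: the
  -- derivative costs one power, all other factors stay bounded.
  have hF : ∀ y, G y - K y =
      -(Ui y * deriv (fun y => W y - U y) y) + Ui y * (W y - U y) * (Wi y * deriv W y) := by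
    intro y
    have h1 : deriv (fun y => W y - U y) y = deriv W y - deriv U y := deriv_fun_sub (dW y) (dU y)
    have h2 : W y * Wi y = 1 := mul_eq_one_symm (hWi y)
    rw [eG, eK, h1]
    have h3 : Ui y * (W y - U y) * (Wi y * deriv W y) =
        Ui y * (W y * Wi y) * deriv W y - (Ui y * U y) * (Wi y * deriv W y) := by noncomm_ring
    rw [h3, h2, hUi]
    noncomm_ring
  have bdd : ∀ {f : ℂ → A}, Differentiable ℂ f → f =O[𝓝 0] fun _ => (1 : ℂ) := fun hf =>
    (hf.continuous.tendsto 0).isBigO_one ℂ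
  have hFO : (fun y => G y - K y) =O[𝓝 0] fun y => y ^ (n + 1) := by
    simp only [hF]
    refine Asymptotics.IsBigO.add ?_ ?_
    · have := (bdd dUi).mul (deriv_isBigO_pow (D := fun y => W y - U y) (dW.sub dU) hO)
      simp only [one_mul] at this
      exact this.neg_left
    · have h2 : (fun y : ℂ => y ^ (n + 2)) =O[𝓝 0] fun y => y ^ (n + 1) := by
        have h3 : (fun y : ℂ => y) =O[𝓝 0] fun _ => (1 : ℂ) :=
          (continuous_id.tendsto (0 : ℂ)).isBigO_one ℂ
        have := (Asymptotics.isBigO_refl (fun y : ℂ => y ^ (n + 1)) (𝓝 0)).mul h3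
        simpa [← pow_succ] using this
      have := ((bdd dUi).mul (hO.trans h2)).mul (bdd (dWi.mul dW'))
      simpa using this
  have hF0 : G 0 - K 0 = 0 := by
    obtain ⟨C, hC⟩ := hFO.bound
    have := hC.self_of_nhds
    simpa using this
  -- The Schwarz lemma used here takes little-o of order `n` and returns the factor `(‖y‖/2)^(n+1)`.
  have hlit : (fun y => (G y - K y) - (G 0 - K 0)) =o[𝓝 (0 : ℂ)] fun y : ℂ => ‖y - 0‖ ^ n := by
    simp only [hF0, sub_zero]
    refine hFO.trans_isLittleO ?_
    have := (Asymptotics.isLittleO_pow_pow (𝕜 := ℂ) (Nat.lt_succ_self n)).norm_right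
    simpa using this
  have hmaps : MapsTo (fun y => G y - K y) (Metric.ball 0 2)
      (Metric.closedBall (G 0 - K 0) M) := by
    intro z hz
    rw [hF0, mem_closedBall_zero_iff]
    exact hM z hz
  have hyb : y ∈ Metric.ball (0 : ℂ) 2 := by
    rw [mem_ball_zero_iff]; linarith
  have key := Complex.dist_le_mul_div_pow_of_mapsTo_ball_of_isLittleO dF.differentiableOn hmaps hlit
    hyb
  rw [hF0, dist_zero_right, dist_zero_right] at key
  have hM0 : 0 ≤ M := (norm_nonneg _).trans (hM y hyb)
  refine key.trans ?_
  gcongr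

/-- Comparison of two families of contractions through their logarithmic derivatives. -/
theorem norm_sub_le_of_logDeriv (hU : ∀ y, HasDerivAt U (U y * G y) y)
    (hW : ∀ y, HasDerivAt W (W y * K y) y) (hWi : ∀ y, Wi y * W y = 1)
    (hU0 : U 0 = 1) (hW0 : W 0 = 1)
    (hUn : ∀ x : ℝ, ‖U x‖ ≤ 1) (hWn : ∀ x : ℝ, ‖W x‖ ≤ 1) (hWin : ∀ x : ℝ, ‖Wi x‖ ≤ 1) {M : ℝ}
    (hM : ∀ x ∈ Icc (0 : ℝ) 1, ‖G x - K x‖ ≤ M) : ‖U 1 - W 1‖ ≤ M := by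
  have := FiniteDimensional.complete ℂ A
  have := isDedekindFiniteMonoid_of_finiteDimensional A
  have hWi' : ∀ y, W y * Wi y = 1 := fun y => mul_eq_one_symm (hWi y)
  have dWi : Differentiable ℂ Wi := differentiable_inverse (fun y => (hW y).differentiableAt) hWi
  have hWid : ∀ y, HasDerivAt Wi (-(K y * Wi y)) y := by
    intro y
    have h1 := (hW y).mul (dWi y).hasDerivAt
    have h2 : HasDerivAt (fun y => W y * Wi y) 0 y := by
      simp only [hWi']; exact hasDerivAt_const y 1
    have h3 := h1.unique h2
    have h4 : deriv Wi y = -(K y * Wi y) := by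
      have : Wi y * (W y * K y * Wi y + W y * deriv Wi y) = 0 := by rw [h3, mul_zero]
      have e : Wi y * (W y * K y * Wi y + W y * deriv Wi y) =
          (Wi y * W y) * (K y * Wi y) + (Wi y * W y) * deriv Wi y := by noncomm_ring
      rw [e, hWi, one_mul, one_mul] at this
      exact eq_neg_of_add_eq_zero_right this
    rw [← h4]
    exact (dWi y).hasDerivAt
  have hWi0 : Wi 0 = 1 := by
    have := hWi 0; rwa [hW0, mul_one] at this
  -- `(U W⁻¹)' = U (G - K) W⁻¹`: the outer factors are contractions at real coupling, so only `G -
  -- K` counts.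
  have hd : ∀ x : ℝ, HasDerivAt (fun x : ℝ => U x * Wi x) (U x * (G x - K x) * Wi x) x := by
    intro x
    have := ((hU x).mul (hWid x)).scomp x Complex.ofRealCLM.hasDerivAt
    refine this.congr_deriv ?_
    simp only [Complex.ofRealCLM_apply, Complex.ofReal_one, one_smul]
    noncomm_ring
  have h1 : ‖U ((1 : ℝ) : ℂ) * Wi ((1 : ℝ) : ℂ) - U ((0 : ℝ) : ℂ) * Wi ((0 : ℝ) : ℂ)‖ ≤ M := by
    refine norm_image_sub_le_of_norm_deriv_le_segment_01' (f := fun x : ℝ => U x * Wi x)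
      (fun x _ => (hd x).hasDerivWithinAt) fun x hx => ?_
    calc ‖U x * (G x - K x) * Wi x‖ ≤ ‖U x‖ * ‖G x - K x‖ * ‖Wi x‖ :=
          (norm_mul_le _ _).trans (mul_le_mul_of_nonneg_right (norm_mul_le _ _) (norm_nonneg _))
      _ ≤ 1 * M * 1 := by
          have := hM x ⟨hx.1, hx.2.le⟩
          have hM0 : 0 ≤ M := (norm_nonneg _).trans this
          gcongr
          · exact hUn x
          · exact hWin x
      _ = M := by ring
  simp only [Complex.ofReal_one, Complex.ofReal_zero, hU0, hWi0, mul_one] at h1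
  have e : U 1 - W 1 = (U 1 * Wi 1 - 1) * W 1 := by
    rw [sub_mul, mul_assoc, hWi, mul_one, one_mul]
  rw [e]
  have hW1 : ‖W 1‖ ≤ 1 := by simpa using hWn 1
  calc _ ≤ ‖U 1 * Wi 1 - 1‖ * ‖W 1‖ := norm_mul_le _ _
    _ ≤ M * 1 := mul_le_mul h1 hW1 (norm_nonneg _) ((norm_nonneg _).trans h1)
    _ = M := mul_one M

end LogDeriv

/-! ### Unitarity for skew-adjoint generators -/

section Unitarity

variable {A : Type*} [NormedRing A] [NormedAlgebra ℂ A] [FiniteDimensional ℂ A] [StarRing A]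
  [CStarRing A] [StarModule ℂ A]

/-- The C*-identity gives `‖1‖² = ‖1‖`, hence only `‖1‖ ≤ 1`; this form also covers the zero
algebra. -/
theorem norm_le_one_of_star_mul_self {u : A} (h : star u * u = 1) : ‖u‖ ≤ 1 := by
  have h1 : ‖(1 : A)‖ = ‖(1 : A)‖ * ‖(1 : A)‖ := by
    have := CStarRing.norm_star_mul_self (x := (1 : A))
    rwa [star_one, one_mul] at this
  have h2 : ‖(1 : A)‖ ≤ 1 := by nlinarith [norm_nonneg (1 : A)]
  have h3 := CStarRing.norm_star_mul_self (x := u)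
  rw [h] at h3
  nlinarith [norm_nonneg u]

theorem IsPropagator.star_mul_self {T : ℝ} {h U W : ℝ → A} (P : IsPropagator T h U W)
    (hh : ∀ t, star (h t) = -h t) {t : ℝ} (ht : t ∈ Icc 0 T) : star (U t) * U t = 1 := by
  have := FiniteDimensional.complete ℂ A
  have hs := P.left.map ((starL' ℝ : A ≃L[ℝ] A) : A →L[ℝ] A)
  simp only [ContinuousLinearEquiv.coe_coe, starL'_apply, star_mul, hh] at hs
  rw [(hs.mul P.left).eq_of_deriv_eq_zero (fun s _ => by noncomm_ring) ht, P.left_zero, star_one,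
    one_mul]

theorem star_exp_mul_exp {P : A} (hP : star P = -P) :
    star (NormedSpace.exp P) * NormedSpace.exp P = 1 := by
  have := FiniteDimensional.complete ℂ A
  have h := (IsPropagator.exp_smul P).star_mul_self (fun _ => hP) (t := 1) ⟨zero_le_one, le_rfl⟩
  simpa using h

theorem norm_exp_le_one {P : A} (hP : star P = -P) : ‖NormedSpace.exp P‖ ≤ 1 :=
  norm_le_one_of_star_mul_self (star_exp_mul_exp hP)

theorem star_multiCommutator (n : ℕ) {a : Fin (n + 1) → A} (ha : ∀ j, star (a j) = -a j) :
    star (multiCommutator n a) = -multiCommutator n a := by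
  induction n with
  | zero => exact ha 0
  | succ n ih =>
    rw [multiCommutator, Ring.lie_def, star_sub, star_mul, star_mul, ha,
      ih fun j => ha j.castSucc]
    noncomm_ring

theorem star_magnusCoeff {h : ℝ → A} {T : ℝ} (hi : IntervalIntegrable h volume 0 T)
    (hh : ∀ t, star (h t) = -h t) (n : ℕ) :
    star (magnusCoeff h T n) = -magnusCoeff h T n := by
  have := FiniteDimensional.complete ℂ A
  have e := ((starL' ℝ : A ≃L[ℝ] A) : A →L[ℝ] A).integral_comp_comm
    (integrable_ascWeight_smul (integrable_multiCommutator hi n))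
  simp only [ContinuousLinearEquiv.coe_coe, starL'_apply, star_smul, star_trivial,
    star_multiCommutator n (fun _ => hh _), smul_neg, integral_neg] at e
  rw [magnusCoeff, star_smul, star_trivial, ← e, smul_neg]

theorem star_magnusGen {h : ℝ → A} {T : ℝ} (hi : IntervalIntegrable h volume 0 T)
    (hh : ∀ t, star (h t) = -h t) (n : ℕ) (x : ℝ) :
    star (magnusGen h T n x) = -magnusGen h T n x := by
  simp only [magnusGen, star_sum, star_smul, star_magnusCoeff hi hh, smul_neg,
    Finset.sum_neg_distrib, star_pow]
  simp

end Unitarity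

/-! ### The one-period comparison -/

section Comparison

variable {ι A : Type*} [Fintype ι] [DecidableEq ι] [NormedRing A] [NormedAlgebra ℂ A]
  [FiniteDimensional ℂ A] [StarRing A] [CStarRing A] [StarModule ℂ A]
  {L : Finset ι → Subalgebra ℂ A} {k : ℕ} {J T : ℝ} {φ : Finset ι → A}
  {ν : ℝ → Finset ι → A}

/-- The propagator and the exponential of the truncated Magnus series are close. -/
theorem IsDrivenInteraction.norm_coupledExp_sub_exp_le (D : IsDrivenInteraction L k J T φ ν)
    (hskew : ∀ t, star (total (φ + ν t)) = -total (φ + ν t)) (h4 : 2 * k * J * T ≤ 1 / 4) {n : ℕ}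
    (hn : n * (2 * k * J * T) ≤ 1 / 16) :
    ‖coupledExp (fun t => total (φ + ν t)) 1 T -
      NormedSpace.exp (magnusGen (fun t => total (φ + ν t)) T n 1)‖ ≤
      3 * drive ν T * (1 / 2) ^ n := by
  have := FiniteDimensional.complete ℂ A
  have := isDedekindFiniteMonoid_of_finiteDimensional A
  let : NormedAlgebra ℚ A := NormedAlgebra.restrictScalars ℚ ℂ A
  set h : ℝ → A := fun t => total (φ + ν t) with hh
  have hi : IntervalIntegrable h volume 0 T := D.integrable_total
  have hT := D.time_nonneg
  have hJ := D.strength_nonneg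
  have hV := D.drive_nonneg
  have P := isPropagator_coupledExp hT hi
  set G : ℂ → A := fun y => ∫ s in (0 : ℝ)..T, coupledInv h y s * h s * coupledExp h y s with hG
  set K : ℂ → A := fun y => ∫ s in (0 : ℝ)..1, NormedSpace.exp (-(s • magnusGen h T n y)) *
    magnusGenDeriv h T n y * NormedSpace.exp (s • magnusGen h T n y) with hK
  have hU : ∀ y, HasDerivAt (fun y => coupledExp h y T) (coupledExp h y T * G y) y :=
    hasDerivAt_coupledExp hT hi
  have hW : ∀ y, HasDerivAt (fun y => NormedSpace.exp (magnusGen h T n y))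
      (NormedSpace.exp (magnusGen h T n y) * K y) y :=
    fun y => hasDerivAt_exp_comp (hasDerivAt_magnusGen h T n y)
  have hUi : ∀ y, coupledInv h y T * coupledExp h y T = 1 := fun y =>
    (P y).right_mul_left (P y).mem_right
  have hWi : ∀ y,
      NormedSpace.exp (-magnusGen h T n y) * NormedSpace.exp (magnusGen h T n y) = 1 := by
    intro y
    rw [← NormedSpace.exp_add_of_commute (Commute.neg_left (Commute.refl _)), neg_add_cancel,
      NormedSpace.exp_zero]
  have hbound : ∀ y, n * (2 * k * J * T * ‖y‖) ≤ 1 / 8 →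
      (n + 1) * (2 * k * J * T * ‖y‖) ≤ 1 / 4 → ‖G y - K y‖ ≤ 3 * drive ν T :=
    fun y h2 h3 => D.norm_logDeriv_sub_le rfl h2 h3
  have hunit : ∀ x ∈ Icc (0 : ℝ) 1, ‖G x - K x‖ ≤ 3 * drive ν T * (1 / 2) ^ n := by
    intro x hx
    have hx1 : ‖(x : ℂ)‖ ≤ 1 := by
      rw [Complex.norm_real, Real.norm_of_nonneg hx.1]; exact hx.2
    have hq : 0 ≤ 2 * k * J * T := by positivity
    have hnn : 0 ≤ 2 * k * J * T * ‖(x : ℂ)‖ := by positivity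
    -- For `n = 0` the disc of radius `2` could bring `ρ` up to `1/2`, beyond the locality bound,
    -- but no decay is required. For `n ≥ 1` one has `ρ ≤ nρ ≤ 1/8`, so `(n+1)ρ ≤ 1/4`.
    rcases Nat.eq_zero_or_pos n with rfl | hpos
    · rw [pow_zero, mul_one]
      have : 2 * k * J * T * ‖(x : ℂ)‖ ≤ 1 / 4 := (mul_le_of_le_one_right hq hx1).trans h4
      refine hbound x ?_ ?_ <;> simp only [Nat.cast_zero] <;> linarith
    · have h1n : (1 : ℝ) ≤ n := by exact_mod_cast hpos
      refine (norm_logDeriv_sub_le_of_isBigO hU hW hUi hWi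
        (exp_magnus_sub_coupledExp_isBigO hT hi (n + 1)) (M := 3 * drive ν T) (fun y hy => ?_)
        hx1).trans ?_
      · rw [mem_ball_zero_iff] at hy
        have b1 : 2 * k * J * T * ‖y‖ ≤ 2 * k * J * T * 2 := by gcongr
        have b2 : n * (2 * k * J * T * ‖y‖) ≤ 1 / 8 := by
          calc _ ≤ n * (2 * k * J * T * 2) := by gcongr
            _ = 2 * (n * (2 * k * J * T)) := by ring
            _ ≤ 1 / 8 := by linarith
        have b3 : 0 ≤ 2 * k * J * T * ‖y‖ := by positivity
        have b4 : 2 * k * J * T * ‖y‖ ≤ n * (2 * k * J * T * ‖y‖) := le_mul_of_one_le_left b3 h1n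
        exact hbound y b2 (by linarith)
      -- The Schwarz lemma gives `2^{-(n+1)}`; the spare factor `1/2` is dropped so that the bound
      -- also covers `n = 0`.
      · rw [pow_succ]
        have : 0 ≤ 3 * drive ν T * (1 / 2) ^ n := by positivity
        linarith
  have skewx : ∀ x : ℝ, ∀ t, star ((x : ℂ) • h t) = -((x : ℂ) • h t) := by
    intro x t
    rw [star_smul, hskew t]
    simp [hh]
  refine norm_sub_le_of_logDeriv hU hW hWi (coupledExp_zero_coupling hT hi)
    (by simp [magnusGen_zero]) (fun x => ?_) (fun x => ?_) (fun x => ?_) hunit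
  · exact norm_le_one_of_star_mul_self ((P x).star_mul_self (skewx x) (P x).mem_right)
  · exact norm_exp_le_one (star_magnusGen hi hskew n x)
  · refine norm_exp_le_one ?_
    rw [star_neg, star_magnusGen hi hskew n x]

end Comparison

/-! ### Self-adjoint logarithms of unitaries -/

section SelfAdjointLog

/-- By spectral mapping, every spectral value is a root of the minimal polynomial. -/
theorem finite_spectrum_of_finiteDimensional {A : Type*} [Ring A] [Algebra ℂ A]
    [FiniteDimensional ℂ A] (u : A) : (spectrum ℂ u).Finite := by
  rcases subsingleton_or_nontrivial A with _ | _
  · simp [spectrum.of_subsingleton]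
  have hu : IsIntegral ℂ u := Algebra.IsIntegral.isIntegral u
  refine ((minpoly ℂ u).rootSet_finite ℂ).subset fun μ hμ => ?_
  have h := spectrum.subset_polynomial_aeval u (minpoly ℂ u) ⟨μ, hμ, rfl⟩
  rw [minpoly.aeval, spectrum.zero_eq, mem_singleton_iff] at h
  rw [Polynomial.mem_rootSet]
  exact ⟨minpoly.ne_zero hu, by simpa [Polynomial.aeval_def] using h⟩

/-- The logarithm is `arg` in the functional calculus. The branch cut is harmless, since every
function is continuous on a finite spectrum. -/
theorem exists_isSelfAdjoint_exp {A : Type*} [CStarAlgebra A] [FiniteDimensional ℂ A] {u : A}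
    (hu : u ∈ unitary A) : ∃ x, IsSelfAdjoint x ∧ NormedSpace.exp (Complex.I • x) = u := by
  refine ⟨cfc (fun z : ℂ => (z.arg : ℂ)) u, IsSelfAdjoint.cfc_arg u, ?_⟩
  have hfin := finite_spectrum_of_finiteDimensional u
  have hn : IsStarNormal u := ⟨by rw [Commute, SemiconjBy, hu.1, hu.2]⟩
  have hc : ContinuousOn (fun z : ℂ => (z.arg : ℂ)) (spectrum ℂ u) := hfin.continuousOn _
  rw [← CFC.exp_eq_normedSpace_exp (𝕜 := ℂ), ← cfc_comp_smul .., ← cfc_comp' ..]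
  conv_rhs => rw [← cfc_id' ℂ u]
  refine cfc_congr fun y hy => ?_
  have hy₁ : ‖y‖ = 1 := spectrum.norm_eq_one_of_unitary hu hy
  have hy0 : y ≠ 0 := by rintro rfl; simp at hy₁
  have h : Complex.I * y.arg = Complex.log y :=
    Complex.ext (by simp [Complex.log_re, hy₁]) (by simp [Complex.log_im])
  simpa [← Complex.exp_eq_exp_ℂ, h] using Complex.exp_log hy0

end SelfAdjointLog

/-! ### Stroboscopic evolution over several periods -/

section Periodic

variable {A : Type*} [NormedRing A] [NormedAlgebra ℂ A] [FiniteDimensional ℂ A]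

/-- By periodicity the shifted propagator `t ↦ U(t + T)` solves the same equation with initial value
`U(T)`, and solutions are determined by their initial value. -/
theorem timeOrderedExp_add_period {H : ℝ → A} {T S : ℝ} (hT : 0 ≤ T) (hS : 0 ≤ S)
    (hp : Function.Periodic H T) (hi : IntervalIntegrable H volume 0 (S + T)) :
    timeOrderedExp H (S + T) = timeOrderedExp H S * timeOrderedExp H T := by
  have := FiniteDimensional.complete ℂ A
  have := isDedekindFiniteMonoid_of_finiteDimensional A
  have hST : 0 ≤ S + T := by linarith
  have P := isPropagator_timeOrderedExp hST hi
  have hTm : T ∈ Icc 0 (S + T) := ⟨hT, by linarith⟩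
  have h_int : ∀ a ∈ Icc 0 (S + T), ∀ b ∈ Icc 0 (S + T),
      IntervalIntegrable (fun s => ((-Complex.I) • H s) * timeOrderedExp H s) volume a b := by
    intro a ha b hb
    exact (P.left.integrable_of_mem ha).symm.trans (P.left.integrable_of_mem hb)
  have hF : IsPrimitive S (fun t => timeOrderedExp H (t + T))
      (fun t => ((-Complex.I) • H t) * timeOrderedExp H (t + T)) := by
    have hsh : (fun t => ((-Complex.I) • H t) * timeOrderedExp H (t + T)) =
        fun t => ((-Complex.I) • H (t + T)) * timeOrderedExp H (t + T) := by
      funext t; rw [hp t]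
    rw [hsh]
    refine ⟨hS, ?_, fun t ht => ?_⟩
    · have := (h_int T hTm (S + T) ⟨hST, le_rfl⟩).comp_add_right T
      simpa using this
    · have htm : t + T ∈ Icc 0 (S + T) := ⟨by linarith [ht.1], by linarith [ht.2]⟩
      rw [intervalIntegral.integral_comp_add_right
        (fun s => ((-Complex.I) • H s) * timeOrderedExp H s), zero_add, P.left.eq _ htm,
        P.left.eq _ hTm, add_assoc, intervalIntegral.integral_add_adjacent_intervals
          (P.left.integrable_of_mem hTm) (h_int T hTm _ htm)]
  have := (P.of_le (S := S) ⟨hS, by linarith⟩).eq_mul hF ⟨hS, le_rfl⟩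
  simpa using this

theorem timeOrderedExp_nat_mul_period {H : ℝ → A} {T : ℝ} (hT : 0 < T)
    (hp : Function.Periodic H T) (hi : IntervalIntegrable H volume 0 T) (m : ℕ) :
    timeOrderedExp H (m * T) = timeOrderedExp H T ^ m := by
  induction m with
  | zero => simp [timeOrderedExp_zero]
  | succ m ih =>
    have e : ((m + 1 : ℕ) : ℝ) * T = m * T + T := by push_cast; ring
    rw [e, timeOrderedExp_add_period hT.le (by positivity) hp
      (hp.intervalIntegrable₀ hT.ne' hi _ _), ih, pow_succ]

theorem evolution_nat_mul (G : A) (T : ℝ) (m : ℕ) : evolution G (m * T) = evolution G T ^ m := by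
  have := FiniteDimensional.complete ℂ A
  let : NormedAlgebra ℚ A := NormedAlgebra.restrictScalars ℚ ℂ A
  rw [evolution, evolution, ← NormedSpace.exp_nsmul]
  congr 1
  rw [← Nat.cast_smul_eq_nsmul ℂ, smul_smul]
  congr 1
  push_cast
  ring

/-- Telescoping: for contractions, errors over successive periods only add. -/
theorem norm_pow_sub_pow_le {a b : A} (h1 : ‖(1 : A)‖ ≤ 1) (ha : ‖a‖ ≤ 1) (hb : ‖b‖ ≤ 1) (m : ℕ) :
    ‖a ^ m - b ^ m‖ ≤ m * ‖a - b‖ := by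
  have hpow : ∀ m : ℕ, ‖a ^ m‖ ≤ 1 := by
    intro m
    induction m with
    | zero => simpa using h1
    | succ m ih =>
      rw [pow_succ]
      exact (norm_mul_le _ _).trans (mul_le_one₀ ih (norm_nonneg _) ha)
  induction m with
  | zero => simp
  | succ m ih =>
    have e : a ^ (m + 1) - b ^ (m + 1) = a ^ m * (a - b) + (a ^ m - b ^ m) * b := by
      rw [pow_succ, pow_succ]; noncomm_ring
    rw [e]
    calc _ ≤ ‖a ^ m‖ * ‖a - b‖ + ‖a ^ m - b ^ m‖ * ‖b‖ :=
          (norm_add_le _ _).trans (add_le_add (norm_mul_le _ _) (norm_mul_le _ _))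
      _ ≤ 1 * ‖a - b‖ + (m * ‖a - b‖) * 1 := by
          gcongr
          exact hpow m
      _ = _ := by push_cast; ring

end Periodic

/-! ### Floquet Hamiltonians and truncated Floquet–Magnus Hamiltonians -/

section Floquet

variable {A : Type*} [CStarAlgebra A] [FiniteDimensional ℂ A] {H : ℝ → A} {T : ℝ}

theorem star_neg_I_smul {a : A} (ha : IsSelfAdjoint a) :
    star ((-Complex.I) • a) = -((-Complex.I) • a) := by
  rw [star_smul, ha.star_eq]
  simp

/-- A Floquet Hamiltonian exists. -/
theorem exists_isFloquetHamiltonian (hT : 0 < T) (hi : IntervalIntegrable H volume 0 T)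
    (hH : ∀ t, IsSelfAdjoint (H t)) : ∃ G, IsFloquetHamiltonian H T G := by
  have := isDedekindFiniteMonoid_of_finiteDimensional A
  have P := isPropagator_timeOrderedExp hT.le hi
  have h1 := P.star_mul_self (fun t => star_neg_I_smul (hH t)) P.mem_right
  obtain ⟨x, hx, he⟩ := exists_isSelfAdjoint_exp (u := timeOrderedExp H T) ⟨h1, mul_eq_one_symm h1⟩
  refine ⟨((-(1 / T) : ℝ) : ℂ) • x, ?_, ?_⟩
  · rw [IsSelfAdjoint, star_smul, hx.star_eq, Complex.star_def, Complex.conj_ofReal]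
  · rw [evolution, smul_smul, ← he]
    congr 2
    have : (T : ℂ) ≠ 0 := by exact_mod_cast hT.ne'
    push_cast
    field_simp

theorem evolution_truncatedFloquet (hT : 0 < T) (hi : IntervalIntegrable H volume 0 T) (n : ℕ) :
    evolution (truncatedFloquet H T n) T =
      NormedSpace.exp (magnusGen (fun t => (-Complex.I) • H t) T n 1) := by
  rw [evolution, truncatedFloquet, magnusGen, Finset.smul_sum]
  congr 1
  refine Finset.sum_congr rfl fun m _ => ?_
  rw [one_pow, one_smul]
  exact smul_magnusTerm hT hi m

theorem coupledExp_one (H : ℝ → A) (t : ℝ) :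
    coupledExp (fun t => (-Complex.I) • H t) 1 t = timeOrderedExp H t := by
  rw [coupledExp]
  congr 1
  funext s
  rw [smul_smul]
  simp

variable {ι : Type*} [Fintype ι] [DecidableEq ι] {L : Finset ι → Subalgebra ℂ A} {k : ℕ} {J : ℝ}
  {φ : Finset ι → A} {ν : ℝ → Finset ι → A}

theorem IsDrivenInteraction.integrable_of_eq (D : IsDrivenInteraction L k J T φ ν)
    (hHt : ∀ t, (-Complex.I) • H t = total (φ + ν t)) : IntervalIntegrable H volume 0 T := by
  have e : H = fun t => Complex.I • total (φ + ν t) := by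
    funext t
    rw [← hHt, smul_smul]
    simp
  rw [e]
  exact D.integrable_total.smul Complex.I

/-- Both one-period evolutions are contractions, so the one-period error grows at most linearly in
`m`. Self-adjointness is needed only for the total `H(t)`, not for the single terms of the
interaction. -/
theorem IsDrivenInteraction.floquet_bounds (D : IsDrivenInteraction L k J T φ ν) (hT : 0 < T)
    (hHt : ∀ t, (-Complex.I) • H t = total (φ + ν t)) (hH : ∀ t, IsSelfAdjoint (H t))
    (hp : Function.Periodic H T) (hi : IntervalIntegrable H volume 0 T)
    (h4 : 2 * k * J * T ≤ 1 / 4) {n : ℕ} (hn : n * (2 * k * J * T) ≤ 1 / 16)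
    {G : A} (hG : IsFloquetHamiltonian H T G) (m : ℕ) :
    evolution G (m * T) = timeOrderedExp H (m * T) ∧
      ‖evolution G (m * T) - evolution (truncatedFloquet H T n) (m * T)‖ ≤
        m * (3 * drive ν T * (1 / 2) ^ n) := by
  have he : (fun t => (-Complex.I) • H t) = fun t => total (φ + ν t) := funext hHt
  have hi' : IntervalIntegrable (fun t => (-Complex.I) • H t) volume 0 T := hi.smul (-Complex.I)
  have hskew := fun t => star_neg_I_smul (hH t)
  have hb := D.norm_coupledExp_sub_exp_le (fun t => by rw [← hHt]; exact hskew t) h4 hn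
  rw [← he, coupledExp_one, ← evolution_truncatedFloquet hT hi, ← hG.2] at hb
  have P := isPropagator_timeOrderedExp hT.le hi
  have n1 : ‖evolution G T‖ ≤ 1 := by
    rw [hG.2]; exact norm_le_one_of_star_mul_self (P.star_mul_self hskew P.mem_right)
  have n2 : ‖evolution (truncatedFloquet H T n) T‖ ≤ 1 := by
    rw [evolution_truncatedFloquet hT hi]
    refine norm_exp_le_one ?_
    have := star_magnusGen hi' hskew n 1
    simpa using this
  refine ⟨?_, ?_⟩
  · rw [evolution_nat_mul, hG.2, timeOrderedExp_nat_mul_period hT hp hi]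
  · rw [evolution_nat_mul, evolution_nat_mul]
    refine (norm_pow_sub_pow_le (norm_le_one_of_star_mul_self (by simp)) n1 n2 m).trans ?_
    gcongr

end Floquet

/-! ### The spin Hamiltonian as a driven interaction -/

section SpinSystem

variable {N d k : ℕ} {J T : ℝ} {h : Finset (Fin N) → Op N d} {v : Finset (Fin N) → ℝ → Op N d}

/-- The terms on at most `k` sites, times `-i`. -/
def fewBodyGenerator (k : ℕ) (a : Finset (Fin N) → Op N d) (X : Finset (Fin N)) : Op N d :=
  if X.card ≤ k then (-Complex.I) • a X else 0

theorem total_fewBodyGenerator (a : Finset (Fin N) → Op N d) :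
    total (fewBodyGenerator k a) = (-Complex.I) • fewBodySum k a := by
  simp only [total, fewBodyGenerator, fewBodySum, Finset.smul_sum, Finset.sum_filter, smul_ite,
    smul_zero]

theorem isLocalInteraction_fewBodyGenerator {a : Finset (Fin N) → Op N d}
    (ha : ∀ X, X.card ≤ k → SupportedOn X (a X)) :
    IsLocalInteraction (localAlgebra N d) k (fewBodyGenerator k a) := by
  refine ⟨fun X => ?_, fun X hX => if_neg (not_le.2 hX)⟩
  unfold fewBodyGenerator
  split_ifs with hX
  · exact Subalgebra.smul_mem _ (ha X hX).mem_localAlgebra _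
  · exact zero_mem _

theorem norm_fewBodyGenerator (a : Finset (Fin N) → Op N d) (X : Finset (Fin N)) :
    ‖fewBodyGenerator k a X‖ = if X.card ≤ k then ‖a X‖ else 0 := by
  unfold fewBodyGenerator
  split_ifs <;> simp [norm_smul]

theorem integrable_fewBodyGenerator
    (hv : ∀ X, X.card ≤ k → IntervalIntegrable (v X) volume 0 T) :
    IntervalIntegrable (fun t => fewBodyGenerator k fun X => v X t) volume 0 T := by
  have hX : ∀ X,
      IntervalIntegrable (fun t => fewBodyGenerator k (fun X => v X t) X) volume 0 T := by
    intro X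
    unfold fewBodyGenerator
    split_ifs with hX
    · exact (hv X hX).smul (-Complex.I)
    · exact intervalIntegrable_const
  exact ⟨Integrable.of_eval fun X => (hX X).1, Integrable.of_eval fun X => (hX X).2⟩

theorem isDrivenInteraction_fewBodyGenerator (hJ : 0 ≤ J) (hT : 0 ≤ T)
    (h_supp : ∀ X, X.card ≤ k → SupportedOn X (h X))
    (v_supp : ∀ X, X.card ≤ k → ∀ t, SupportedOn X (v X t))
    (hv : ∀ X, X.card ≤ k → IntervalIntegrable (v X) volume 0 T)
    (local_strength : ∀ (t : ℝ) (i : Fin N),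
      ∑ X with X.card ≤ k ∧ i ∈ X, (‖h X‖ + ‖v X t‖) ≤ J) :
    IsDrivenInteraction (localAlgebra N d) k J T (fewBodyGenerator k h)
      (fun t => fewBodyGenerator k fun X => v X t) := by
  have key : ∀ (t : ℝ) (i : Fin N), normSum (regionsAt i) (fewBodyGenerator k h) +
      normSum (regionsAt i) (fewBodyGenerator k fun X => v X t) ≤ J := by
    intro t i
    refine le_trans (le_of_eq ?_) (local_strength t i)
    simp only [normSum, regionsAt, norm_fewBodyGenerator, Finset.sum_filter,
      ← Finset.sum_add_distrib]
    refine Finset.sum_congr rfl fun X _ => ?_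
    by_cases h1 : X.card ≤ k <;> by_cases h2 : i ∈ X <;> simp [h1, h2]
  exact
    { net := isLocalNet_localAlgebra N d
      strength_nonneg := hJ
      time_nonneg := hT
      integrable := integrable_fewBodyGenerator hv
      local_static := isLocalInteraction_fewBodyGenerator h_supp
      local_drive := fun t => isLocalInteraction_fewBodyGenerator fun X hX => v_supp X hX t
      static_le := fun i => by
        have := key 0 i
        have := normSum_nonneg (regionsAt i) (fewBodyGenerator k fun X => v X 0)
        linarith
      strength_le := fun t i => (normSum_add_le _ _ _).trans (key t i) }

theorem drive_fewBodyGenerator (hT : 0 < T)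
    (hv : ∀ X, X.card ≤ k → IntervalIntegrable (v X) volume 0 T) :
    IsDrivenInteraction.drive (fun t => fewBodyGenerator k fun X => v X t) T =
      drivingStrength k T v * T := by
  have e : ∀ t, normSum Finset.univ (fewBodyGenerator k fun X => v X t) =
      ∑ X with X.card ≤ k, ‖v X t‖ := fun t => by
    simp only [normSum, norm_fewBodyGenerator, Finset.sum_filter]
  simp only [IsDrivenInteraction.drive, e]
  rw [intervalIntegral.integral_finsetSum fun X hX => (hv X (Finset.mem_filter.1 hX).2).norm,
    drivingStrength, Finset.sum_mul]
  refine Finset.sum_congr rfl fun X _ => ?_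
  field_simp

end SpinSystem

end

end FloquetMagnus

/-! ### The Floquet–Magnus bound for spins -/

theorem theorem1 (N d k : ℕ) (hk : 1 ≤ k) (J T lam : ℝ) (hJ : 0 < J) (hT : 0 < T)
    (hlam : lam = 2 * k * J) (hTlam : T ≤ 1 / (4 * lam))
    (h : Finset (Fin N) → FloquetMagnus.Op N d)
    (v : Finset (Fin N) → ℝ → FloquetMagnus.Op N d)
    (H₀ : FloquetMagnus.Op N d) (V : ℝ → FloquetMagnus.Op N d)
    (h_supp : ∀ X, X.card ≤ k → FloquetMagnus.SupportedOn X (h X))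
    (v_supp : ∀ X, X.card ≤ k → ∀ t, FloquetMagnus.SupportedOn X (v X t))
    (hH₀ : H₀ = FloquetMagnus.fewBodySum k h)
    (hV : ∀ t, V t = FloquetMagnus.fewBodySum k (fun X => v X t))
    (H₀_selfAdjoint : IsSelfAdjoint H₀) (V_selfAdjoint : ∀ t, IsSelfAdjoint (V t))
    (V_periodic : Function.Periodic V T)
    (v_integrable : ∀ X, X.card ≤ k → IntervalIntegrable (v X) MeasureTheory.volume 0 T)
    (local_strength : ∀ (t : ℝ) (i : Fin N),
      ∑ X with X.card ≤ k ∧ i ∈ X, (‖h X‖ + ‖v X t‖) ≤ J)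
    (H : ℝ → FloquetMagnus.Op N d) (hH : ∀ t, H t = H₀ + V t)
    (V₀ : ℝ) (hV₀ : V₀ = FloquetMagnus.drivingStrength k T v)
    (n₀ : ℕ) (hn₀ : n₀ = ⌊1 / (16 * lam * T)⌋₊) :
    (∃ HF, FloquetMagnus.IsFloquetHamiltonian H T HF) ∧
    ∀ HF, FloquetMagnus.IsFloquetHamiltonian H T HF →
      ‖FloquetMagnus.evolution HF T -
          FloquetMagnus.evolution (FloquetMagnus.truncatedFloquet H T n₀) T‖
        ≤ 6 * V₀ * T * (2 ^ n₀)⁻¹ ∧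
      ∀ m : ℕ,
        FloquetMagnus.evolution HF (m * T) = FloquetMagnus.timeOrderedExp H (m * T) ∧
        ‖FloquetMagnus.evolution HF (m * T) -
            FloquetMagnus.evolution (FloquetMagnus.truncatedFloquet H T n₀) (m * T)‖
          ≤ 6 * V₀ * (m * T) * (2 ^ n₀)⁻¹ := by
  have D := FloquetMagnus.isDrivenInteraction_fewBodyGenerator hJ.le hT.le h_supp v_supp
    v_integrable local_strength
  have hdrive := FloquetMagnus.drive_fewBodyGenerator hT v_integrable
  rw [← hV₀] at hdrive
  have hnn := D.drive_nonneg
  rw [hdrive] at hnn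
  have hHt : ∀ t, (-Complex.I) • H t = FloquetMagnus.total (FloquetMagnus.fewBodyGenerator k h +
      FloquetMagnus.fewBodyGenerator k fun X => v X t) := by
    intro t
    rw [FloquetMagnus.total_add, FloquetMagnus.total_fewBodyGenerator,
      FloquetMagnus.total_fewBodyGenerator, hH, hH₀, hV, smul_add]
  have hsa : ∀ t, IsSelfAdjoint (H t) := fun t => by
    rw [hH]; exact IsSelfAdjoint.add (R := FloquetMagnus.Op N d) H₀_selfAdjoint (V_selfAdjoint t)
  have hper : Function.Periodic H T := fun t => by rw [hH, hH, V_periodic t]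
  have h_int := D.integrable_of_eq hHt
  have hk0 : (0 : ℝ) < k := by exact_mod_cast hk
  have hlam0 : 0 < lam := by rw [hlam]; positivity
  have h4 : 2 * k * J * T ≤ 1 / 4 := by
    rw [← hlam]
    rw [le_div_iff₀ (by positivity)] at hTlam
    linarith
  -- The floor defining `n₀` is exactly the condition `n₀ λ T ≤ 1/16`.
  have hn : n₀ * (2 * k * J * T) ≤ 1 / 16 := by
    rw [← hlam]
    have h1 : (n₀ : ℝ) ≤ 1 / (16 * lam * T) := by
      rw [hn₀]; exact Nat.floor_le (by positivity)
    rw [le_div_iff₀ (by positivity)] at h1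
    linarith
  have hpow : ((1 : ℝ) / 2) ^ n₀ = (2 ^ n₀)⁻¹ := by rw [one_div, inv_pow]
  refine ⟨FloquetMagnus.exists_isFloquetHamiltonian hT h_int hsa, fun HF hHF => ?_⟩
  have hb : ∀ m : ℕ, FloquetMagnus.evolution HF (m * T) = FloquetMagnus.timeOrderedExp H (m * T) ∧
      ‖FloquetMagnus.evolution HF (m * T) -
          FloquetMagnus.evolution (FloquetMagnus.truncatedFloquet H T n₀) (m * T)‖
        ≤ 6 * V₀ * (m * T) * (2 ^ n₀)⁻¹ := by
    intro m
    obtain ⟨h1, h2⟩ := D.floquet_bounds hT hHt hsa hper h_int h4 hn hHF m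
    refine ⟨h1, h2.trans ?_⟩
    rw [hdrive, hpow]
    -- The argument yields the constant `3`; nonnegativity of this quantity relaxes it to `6`.
    have : 0 ≤ m * (V₀ * T * ((2 : ℝ) ^ n₀)⁻¹) := by positivity
    linarith
  refine ⟨?_, hb⟩
  have := (hb 1).2
  simpa using this
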